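/- Let $\Bbbk$ be a field of characteristic $0$. For $n\ge 1$ let $As^{(n)}$ be the ($\Bbbk$-linear, symmetric) operad generated by $n$ binary operations $\star_1,\dots,\star_n$ without symmetry, subject to the relations $$a\star_i(b\star_j c)=(a\star_i b)\star_j c\qquad\text{for all } i,j=1,\dots,n .$$ Let $A$ be an associative unital $\Bbbk$-algebra, $A_t=A*\Bbbk[t]$ the free product algebra, $A_t^+$ its two-sided ideal generated by $t$, and identify $A_t=\bigoplus_{k\ge 1}A^{\otimes k}$, $A_t^+=\bigoplus_{k\ge 2}A^{\otimes k}$, where $a_1\otimes a_2\otimes\cdots\otimes a_k$ corresponds to $a_1\,t\,a_2\,t\cdots t\,a_k$. Let $C^p(A,A^{\otimes k})=\mathrm{Hom}_{\Bbbk}(A^{\otimes p},A^{\otimes k})$ and $$C(A,A_t^+)_{\ge 2}=\bigoplus_{p,k\ge 2}C^p(A,A^{\otimes k}).$$ For a linear map $f:A^{\otimes p}\to A^{\otimes k}$ write $f^{[i,i+p-1]}$ for the map that applies $f$ to the consecutive tensor components $i,\dots,i+p-1$. For $f\in C^p(A,A^{\otimes k})$ and $g\in C^q(A,A^{\otimes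 m})$ put $$f\vdash g=f^{[1,p]}\circ g^{[p,p+q-1]},\qquad f\dashv g=g^{[k,k+q-1]}\circ f^{[1,p]},\qquad f\vee g=f\vdash g-f\dashv g$$ (all three take values in $C^{p+q-1}(A,A^{\otimes(k+m-1)})$), and let $f\cup g\in C^{p+q}(A,A^{\otimes(k+m-1)})$ be the cup product induced by the multiplication of $A_t$, that is, $(f\cup g)(a_1\otimes\cdots\otimes a_{p+q})$ is the product in $A_t$ of $f(a_1\otimes\cdots\otimes a_p)$ and $g(a_{p+1}\otimes\cdots\otimes a_{p+q})$. Extend these operations bilinearly to $C(A,A_t^+)_{\ge 2}$. Then: (i) Each of the operads $As^{(2)}$ and $As^{(3)}$ is Koszul and self-dual (isomorphic to its quadratic dual operad), in the sense of Ginzburg and Kapranov. (ii) The operations $(\vee,\cup)$ make $C(A,A_t^+)_{\ge 2}$ an $As^{(2)}$-algebra, and the operations $(\vdash,\dashv,\cup)$ make $C(A,A_t^+)_{\ge 2}$ an $As^{(3)}$-algebra. -/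

import Mathlib

open scoped TensorProduct DirectSum

universe u v w

/-! ## Bijections of finite sets used in the operad axioms -/

def sumOptionEquiv (X Y : Type) : X ⊕ Option Y ≃ Option (X ⊕ Y) where
  toFun
    | Sum.inl x => some (Sum.inl x)
    | Sum.inr (some y) => some (Sum.inr y)
    | Sum.inr none => none
  invFun
    | some (Sum.inl x) => Sum.inl x
    | some (Sum.inr y) => Sum.inr (some y)
    | none => Sum.inr none
  left_inv := by rintro (x | _ | y) <;> rfl
  right_inv := by rintro (_ | x | y) <;> rfl

def optionSumEquiv (X Y : Type) : Option X ⊕ Y ≃ Option (X ⊕ Y) where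
  toFun
    | Sum.inl (some x) => some (Sum.inl x)
    | Sum.inl none => none
    | Sum.inr y => some (Sum.inr y)
  invFun
    | some (Sum.inl x) => Sum.inl (some x)
    | some (Sum.inr y) => Sum.inr y
    | none => Sum.inl none
  left_inv := by rintro ((_ | x) | y) <;> rfl
  right_inv := by rintro (_ | x | y) <;> rfl

def optionSwapEquiv (X : Type) : Option (Option X) ≃ Option (Option X) where
  toFun
    | none => some none
    | some none => none
    | some (some x) => some (some x)
  invFun
    | none => some none
    | some none => none
    | some (some x) => some (some x)
  left_inv := by rintro (_ | _ | x) <;> rfl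
  right_inv := by rintro (_ | _ | x) <;> rfl

def sumSwapRightEquiv (X Y Z : Type) : (X ⊕ Y) ⊕ Z ≃ (X ⊕ Z) ⊕ Y where
  toFun
    | Sum.inl (Sum.inl x) => Sum.inl (Sum.inl x)
    | Sum.inl (Sum.inr y) => Sum.inr y
    | Sum.inr z => Sum.inl (Sum.inr z)
  invFun
    | Sum.inl (Sum.inl x) => Sum.inl (Sum.inl x)
    | Sum.inl (Sum.inr z) => Sum.inr z
    | Sum.inr y => Sum.inl (Sum.inr y)
  left_inv := by rintro ((x | y) | z) <;> rfl
  right_inv := by rintro ((x | y) | z) <;> rfl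

def unitOptionEquiv : Unit ≃ Option Empty where
  toFun _ := none
  invFun _ := ()
  left_inv _ := rfl
  right_inv := by rintro (_ | ⟨⟨⟩⟩); rfl

/-! ## Symmetric operads -/

/-- A `k`-linear symmetric operad, as a functor on finite sets and bijections with a unit and
partial compositions. `obj X` is the space of operations whose inputs are labelled by the finite
set `X` (so `obj (Fin n)` is the usual `P(n)` with its action of the symmetric group), and
`comp p q` plugs the output of `q` into the input `none` of `p`. -/
structure SymOperad (k : Type u) [Field k] where
  obj : (X : Type) → [Finite X] → Type v
  [addCommGroup : ∀ (X : Type) [Finite X], AddCommGroup (obj X)]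
  [module : ∀ (X : Type) [Finite X], Module k (obj X)]
  map : {X Y : Type} → [Finite X] → [Finite Y] → (X ≃ Y) → obj X →ₗ[k] obj Y
  one : obj Unit
  comp : {X Y : Type} → [Finite X] → [Finite Y] →
    obj (Option X) →ₗ[k] obj Y →ₗ[k] obj (X ⊕ Y)
  map_refl : ∀ {X : Type} [Finite X] (p : obj X), map (Equiv.refl X) p = p
  map_trans : ∀ {X Y Z : Type} [Finite X] [Finite Y] [Finite Z] (e : X ≃ Y) (f : Y ≃ Z)
    (p : obj X), map (e.trans f) p = map f (map e p)
  comp_map : ∀ {X X' Y Y' : Type} [Finite X] [Finite X'] [Finite Y] [Finite Y']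
    (e : X ≃ X') (f : Y ≃ Y') (p : obj (Option X)) (q : obj Y),
    comp (map (Equiv.optionCongr e) p) (map f q) = map (Equiv.sumCongr e f) (comp p q)
  one_comp : ∀ {X : Type} [Finite X] (q : obj X),
    map (Equiv.emptySum Empty X) (comp (map unitOptionEquiv one) q) = q
  comp_one : ∀ {X : Type} [Finite X] (p : obj (Option X)),
    map (Equiv.optionEquivSumPUnit X).symm (comp p one) = p
  comp_assoc : ∀ {X Y Z : Type} [Finite X] [Finite Y] [Finite Z]
    (p : obj (Option X)) (q : obj (Option Y)) (r : obj Z),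
    map (Equiv.sumAssoc X Y Z) (comp (map (sumOptionEquiv X Y) (comp p q)) r) =
      comp p (comp q r)
  comp_comm : ∀ {X Y Z : Type} [Finite X] [Finite Y] [Finite Z]
    (p : obj (Option (Option X))) (q : obj Y) (r : obj Z),
    map (sumSwapRightEquiv X Y Z) (comp (map (optionSumEquiv X Y) (comp p q)) r) =
      comp (map (optionSumEquiv X Z) (comp (map (optionSwapEquiv X) p) r)) q

attribute [instance] SymOperad.addCommGroup SymOperad.module

namespace SymOperad

variable {k : Type u} [Field k]

/-- Morphisms of operads. -/
structure Hom (P : SymOperad.{u, v} k) (Q : SymOperad.{u, w} k) where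
  app : (X : Type) → [Finite X] → P.obj X →ₗ[k] Q.obj X
  app_map : ∀ {X Y : Type} [Finite X] [Finite Y] (e : X ≃ Y) (p : P.obj X),
    app Y (P.map e p) = Q.map e (app X p)
  app_one : app Unit P.one = Q.one
  app_comp : ∀ {X Y : Type} [Finite X] [Finite Y] (p : P.obj (Option X)) (q : P.obj Y),
    app (X ⊕ Y) (P.comp p q) = Q.comp (app (Option X) p) (app Y q)

/-- Two operads are isomorphic if there is a bijective morphism between them. -/
def Isomorphic (P : SymOperad.{u, v} k) (Q : SymOperad.{u, w} k) : Prop :=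
  ∃ φ : Hom P Q, ∀ (X : Type) [Finite X], Function.Bijective (φ.app X)

/-- Operadic ideals. -/
structure OpIdeal (P : SymOperad.{u, v} k) where
  carrier : (X : Type) → [Finite X] → Submodule k (P.obj X)
  map_mem : ∀ {X Y : Type} [Finite X] [Finite Y] (e : X ≃ Y) {p : P.obj X},
    p ∈ carrier X → P.map e p ∈ carrier Y
  comp_mem_left : ∀ {X Y : Type} [Finite X] [Finite Y] {p : P.obj (Option X)} (q : P.obj Y),
    p ∈ carrier (Option X) → P.comp p q ∈ carrier (X ⊕ Y)
  comp_mem_right : ∀ {X Y : Type} [Finite X] [Finite Y] (p : P.obj (Option X)) {q : P.obj Y},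
    q ∈ carrier Y → P.comp p q ∈ carrier (X ⊕ Y)

/-- The smallest operadic ideal containing a given family of elements. -/
def idealSpan (P : SymOperad.{u, v} k) (S : (X : Type) → [Finite X] → Set (P.obj X)) :
    OpIdeal P where
  carrier X _ := sInf {M | ∃ I : OpIdeal P,
    (∀ (Y : Type) [Finite Y], S Y ⊆ I.carrier Y) ∧ M = I.carrier X}
  map_mem := by
    intro X Y _ _ e p hp
    simp only [Submodule.mem_sInf] at hp ⊢
    rintro _ ⟨I, hI, rfl⟩
    exact I.map_mem e (hp _ ⟨I, hI, rfl⟩)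
  comp_mem_left := by
    intro X Y _ _ p q hp
    simp only [Submodule.mem_sInf] at hp ⊢
    rintro _ ⟨I, hI, rfl⟩
    exact I.comp_mem_left q (hp _ ⟨I, hI, rfl⟩)
  comp_mem_right := by
    intro X Y _ _ p q hq
    simp only [Submodule.mem_sInf] at hq ⊢
    rintro _ ⟨I, hI, rfl⟩
    exact I.comp_mem_right p (hq _ ⟨I, hI, rfl⟩)

/-- The quotient of an operad by an operadic ideal. -/
def quotient (P : SymOperad.{u, v} k) (I : OpIdeal P) : SymOperad.{u, v} k where
  obj X _ := P.obj X ⧸ I.carrier X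
  map {X Y} _ _ e := Submodule.mapQ _ _ (P.map e) (fun _ hp => I.map_mem e hp)
  one := Submodule.Quotient.mk P.one
  comp {X Y} _ _ :=
    Submodule.liftQ _
      (LinearMap.mk₂ k (fun p => Submodule.mapQ _ _ (P.comp p)
          (fun _ hq => I.comp_mem_right p hq))
        (by rintro p p' ⟨q⟩; exact congrArg Submodule.Quotient.mk (P.comp.map_add₂ p p' q))
        (by rintro c p ⟨q⟩; exact congrArg Submodule.Quotient.mk (P.comp.map_smul₂ c p q))
        (by intro p q q'; exact map_add _ q q')
        (by intro c p q; exact map_smul _ c q))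
      (by
        intro p hp
        rw [LinearMap.mem_ker]
        ext q
        exact (Submodule.Quotient.mk_eq_zero _).2 (I.comp_mem_left q hp))
  map_refl := by
    rintro X _ ⟨p⟩
    exact congrArg Submodule.Quotient.mk (P.map_refl p)
  map_trans := by
    rintro X Y Z _ _ _ e f ⟨p⟩
    exact congrArg Submodule.Quotient.mk (P.map_trans e f p)
  comp_map := by
    rintro X X' Y Y' _ _ _ _ e f ⟨p⟩ ⟨q⟩
    exact congrArg Submodule.Quotient.mk (P.comp_map e f p q)
  one_comp := by
    rintro X _ ⟨q⟩
    exact congrArg Submodule.Quotient.mk (P.one_comp q)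
  comp_one := by
    rintro X _ ⟨p⟩
    exact congrArg Submodule.Quotient.mk (P.comp_one p)
  comp_assoc := by
    rintro X Y Z _ _ _ ⟨p⟩ ⟨q⟩ ⟨r⟩
    exact congrArg Submodule.Quotient.mk (P.comp_assoc p q r)
  comp_comm := by
    rintro X Y Z _ _ _ ⟨p⟩ ⟨q⟩ ⟨r⟩
    exact congrArg Submodule.Quotient.mk (P.comp_comm p q r)

/-- The projection of an operad onto a quotient, in each arity. -/
def quotientMk (P : SymOperad.{u, v} k) (I : OpIdeal P) (X : Type) [Finite X] :
    P.obj X →ₗ[k] (P.quotient I).obj X :=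
  (I.carrier X).mkQ

end SymOperad

/-! ## The endomorphism operad of a vector space -/

section EndOperad

variable (k : Type u) [Field k] (V : Type v) [AddCommGroup V] [Module k V]

/-- The inputs of `p` when the output of `q` is plugged into its input `none`. -/
def endArgs {V : Type v} {X Y : Type} (q : (Y → V) → V) (x : X ⊕ Y → V) : Option X → V
  | none => q (fun y => x (Sum.inr y))
  | some a => x (Sum.inl a)

theorem endArgs_update_inl {V : Type v} {X Y : Type} [DecidableEq X] [DecidableEq (X ⊕ Y)]
    [DecidableEq (Option X)]
    (q : (Y → V) → V) (x : X ⊕ Y → V) (a : X) (z : V) :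
    endArgs q (Function.update x (Sum.inl a) z) =
      Function.update (endArgs q x) (some a) z := by
  funext o
  rcases o with _ | b
  · simp [endArgs]
  · by_cases h : b = a
    · subst h; simp [endArgs]
    · simp [endArgs, Function.update_of_ne, h]

theorem endArgs_update_inr {V : Type v} {X Y : Type} [DecidableEq Y] [DecidableEq (X ⊕ Y)]
    [DecidableEq (Option X)]
    (q : (Y → V) → V) (x : X ⊕ Y → V) (b : Y) (z : V) :
    endArgs q (Function.update x (Sum.inr b) z) =
      Function.update (endArgs q x) none
        (q (Function.update (fun y => x (Sum.inr y)) b z)) := by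
  funext o
  rcases o with _ | a
  · simp only [endArgs, Function.update_self]
    congr 1
    funext y
    by_cases h : y = b
    · subst h; simp
    · simp [Function.update_of_ne, h]
  · simp [endArgs]

/-- Partial composition of multilinear maps. -/
def endComp {X Y : Type} (p : MultilinearMap k (fun _ : Option X => V) V)
    (q : MultilinearMap k (fun _ : Y => V) V) : MultilinearMap k (fun _ : X ⊕ Y => V) V where
  toFun x := p (endArgs q x)
  map_update_add' := by
    classical
    rintro _ x (a | b) z z'
    · simp [endArgs_update_inl]
    · simp [endArgs_update_inr]
  map_update_smul' := by
    classical
    rintro _ x (a | b) c z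
    · simp [endArgs_update_inl]
    · simp [endArgs_update_inr]

theorem endArgs_eq_update {V : Type v} {X Y : Type} [DecidableEq (Option X)]
    (q q' : (Y → V) → V) (x : X ⊕ Y → V) :
    endArgs q x = Function.update (endArgs q' x) none (q (fun y => x (Sum.inr y))) := by
  funext o
  rcases o with _ | a <;> simp [endArgs]

/-- The endomorphism operad: `obj X` is the space of `X`-ary multilinear operations on `V`. -/
def endOperad : SymOperad.{u, v} k where
  obj X _ := MultilinearMap k (fun _ : X => V) V
  map e := (MultilinearMap.domDomCongrLinearEquiv k k V V e).toLinearMap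
  one := MultilinearMap.ofSubsingleton k V V () LinearMap.id
  comp := LinearMap.mk₂ k (endComp k V)
    (fun _ _ _ => rfl) (fun _ _ _ => rfl)
    (by
      classical
      intro p q q'
      ext x
      change p (endArgs (q + q') x) = p (endArgs q x) + p (endArgs q' x)
      rw [endArgs_eq_update (q + q') q x, endArgs_eq_update q' q x]
      rw [add_apply, MultilinearMap.map_update_add]
      congr 2
      funext o
      rcases o with _ | a <;> simp [endArgs])
    (by
      classical
      intro c p q
      ext x
      change p (endArgs (c • q) x) = c • p (endArgs q x)
      rw [endArgs_eq_update (c • q) q x]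
      rw [smul_apply, MultilinearMap.map_update_smul]
      congr 2
      funext o
      rcases o with _ | a <;> simp [endArgs])
  map_refl _ := rfl
  map_trans _ _ _ := rfl
  comp_map := by
    intro X X' Y Y' _ _ _ _ e f p q
    ext x
    change p (fun o => endArgs _ x (Equiv.optionCongr e o)) = p (endArgs q _)
    congr 1
    funext o
    rcases o with _ | a <;> rfl
  one_comp := by
    intro X _ q
    ext x
    rfl
  comp_one := by
    intro X _ p
    ext x
    change p (endArgs _ _) = p x
    congr 1
    funext o
    rcases o with _ | a <;> rfl
  comp_assoc := by
    intro X Y Z _ _ _ p q r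
    ext x
    change p (endArgs q _) = p (endArgs _ x)
    congr 1
    funext o
    rcases o with _ | a
    · change q _ = q _
      congr 1
      funext o
      rcases o with _ | b <;> rfl
    · rfl
  comp_comm := by
    intro X Y Z _ _ _ p q r
    ext x
    change p (endArgs q _) = p _
    congr 1
    funext o
    rcases o with _ | _ | a <;> rfl

/-- The value of a multilinear operation. -/
def endEval {X : Type} [Finite X] (p : (endOperad k V).obj X) (x : X → V) : V :=
  (show MultilinearMap k (fun _ : X => V) V from p) x

end EndOperad

/-! ## The free operad on a set of binary operations -/

/-- Planar binary trees with vertices labelled by `G` and leaves labelled by `X`. -/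
inductive BinTree (G : Type u) (X : Type) : Type u
  | leaf (x : X) : BinTree G X
  | node (g : G) (l r : BinTree G X) : BinTree G X

namespace BinTree

variable {G : Type u} {X Y Z : Type}

open Classical in
/-- The number of leaves with label `x`. -/
noncomputable def count (x : X) : BinTree G X → ℕ
  | leaf y => if y = x then 1 else 0
  | node _ l r => l.count x + r.count x

/-- Replace every leaf with label `x` by the tree `f x`. -/
def bind (f : X → BinTree G Y) : BinTree G X → BinTree G Y
  | leaf x => f x
  | node g l r => node g (l.bind f) (r.bind f)

/-- Relabelling of the leaves. -/
def relabel (f : X → Y) (t : BinTree G X) : BinTree G Y := t.bind (fun x => leaf (f x))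

/-- Grafting of `s` onto the leaf `none`. -/
def graftArgs (s : BinTree G Y) : Option X → BinTree G (X ⊕ Y)
  | none => s.relabel Sum.inr
  | some x => leaf (Sum.inl x)

theorem bind_bind (f : X → BinTree G Y) (g : Y → BinTree G Z) (t : BinTree G X) :
    (t.bind f).bind g = t.bind (fun x => (f x).bind g) := by
  induction t with
  | leaf x => rfl
  | node a l r hl hr => simp [bind, hl, hr]

theorem bind_leaf (t : BinTree G X) : t.bind leaf = t := by
  induction t with
  | leaf x => rfl
  | node a l r hl hr => simp [bind, hl, hr]

theorem count_relabel (e : X ≃ Y) (t : BinTree G X) (y : Y) :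
    (t.relabel e).count y = t.count (e.symm y) := by
  induction t with
  | leaf x =>
    by_cases h : e x = y
    · subst h; simp [relabel, bind, count]
    · have h' : x ≠ e.symm y := fun h' => h (by rw [h']; simp)
      simp [relabel, bind, count, h, h']
  | node a l r hl hr => simp only [relabel, bind, count] at *; rw [hl, hr]

theorem count_relabel_inr (s : BinTree G Y) (y : Y) :
    (s.relabel (Sum.inr : Y → X ⊕ Y)).count (Sum.inr y) = s.count y := by
  induction s with
  | leaf x => by_cases h : x = y <;> simp [relabel, bind, count, h]
  | node a l r hl hr => simp only [relabel, bind, count] at *; rw [hl, hr]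

theorem count_relabel_inl (s : BinTree G Y) (x : X) :
    (s.relabel (Sum.inr : Y → X ⊕ Y)).count (Sum.inl x) = 0 := by
  induction s with
  | leaf x => simp [relabel, bind, count]
  | node a l r hl hr => simp only [relabel, bind, count] at *; rw [hl, hr]

theorem count_graft_inl (t : BinTree G (Option X)) (s : BinTree G Y) (x : X) :
    (t.bind (graftArgs s)).count (Sum.inl x) = t.count (some x) := by
  induction t with
  | leaf o =>
    rcases o with _ | x'
    · simp [bind, graftArgs, count, count_relabel_inl]
    · by_cases h : x' = x <;> simp [bind, graftArgs, count, h]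
  | node a l r hl hr => simp only [bind, count, hl, hr]

theorem count_graft_inr (t : BinTree G (Option X)) (s : BinTree G Y) (y : Y) :
    (t.bind (graftArgs s)).count (Sum.inr y) = t.count none * s.count y := by
  induction t with
  | leaf o =>
    rcases o with _ | x'
    · simp [bind, graftArgs, count, count_relabel_inr]
    · simp [bind, graftArgs, count]
  | node a l r hl hr => simp only [bind, count, hl, hr, add_mul]

end BinTree

/-- Planar binary trees whose leaves are labelled bijectively by `X`. -/
def MonoTree (G : Type u) (X : Type) : Type u :=
  {t : BinTree G X // ∀ x, t.count x = 1}

namespace MonoTree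

variable {G : Type u} {X Y : Type}

def relabel (e : X ≃ Y) (t : MonoTree G X) : MonoTree G Y :=
  ⟨t.1.relabel e, fun y => by rw [BinTree.count_relabel, t.2]⟩

def graft (t : MonoTree G (Option X)) (s : MonoTree G Y) : MonoTree G (X ⊕ Y) :=
  ⟨t.1.bind (BinTree.graftArgs s.1), by
    rintro (x | y)
    · rw [BinTree.count_graft_inl, t.2]
    · rw [BinTree.count_graft_inr, t.2, s.2]⟩

def unit : MonoTree G Unit := ⟨BinTree.leaf (), fun _ => by simp [BinTree.count]⟩

/-- The tree with one vertex, whose left leaf is `0` and whose right leaf is `1`. -/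
def corolla (g : G) : MonoTree G (Fin 2) :=
  ⟨BinTree.node g (BinTree.leaf 0) (BinTree.leaf 1), fun x => by
    fin_cases x <;> simp [BinTree.count]⟩

end MonoTree

section FreeOperad

variable (k : Type u) [Field k] (G : Type u)

theorem finsupp_comp_single {α β γ : Type*} (F : α → β → γ) (a : α) (b : β) (c d : k) :
    Finsupp.linearCombination k (fun t => Finsupp.lmapDomain k k (F t)) (Finsupp.single a c)
      (Finsupp.single b d) = Finsupp.single (F a b) (c * d) := by
  simp

/-- The free operad on the set `G` of binary operations without any symmetry: `obj X` has as a
basis the planar binary trees with vertices labelled by `G` and leaves labelled bijectively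
by `X`. -/
noncomputable def freeOperad : SymOperad.{u, u} k where
  obj X _ := MonoTree G X →₀ k
  map e := Finsupp.lmapDomain k k (MonoTree.relabel e)
  one := Finsupp.single MonoTree.unit 1
  comp := Finsupp.linearCombination k (fun t => Finsupp.lmapDomain k k (MonoTree.graft t))
  map_refl := by
    intro X _ p
    induction p using Finsupp.induction_linear with
    | zero => simp
    | add p p' h h' => rw [map_add, h, h']
    | single t c =>
      simp only [Finsupp.lmapDomain_apply, Finsupp.mapDomain_single]
      congr 1
      exact Subtype.ext (BinTree.bind_leaf _)
  map_trans := by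
    intro X Y Z _ _ _ e f p
    induction p using Finsupp.induction_linear with
    | zero => simp
    | add p p' h h' => simp only [map_add, h, h']
    | single t c =>
      simp only [Finsupp.lmapDomain_apply, Finsupp.mapDomain_single]
      congr 1
      apply Subtype.ext
      change t.1.bind _ = (t.1.bind _).bind _
      rw [BinTree.bind_bind]
      rfl
  comp_map := by
    intro X X' Y Y' _ _ _ _ e f p q
    induction p using Finsupp.induction_linear with
    | zero => simp
    | add p p' h h' => simp only [map_add, LinearMap.add_apply, h, h']
    | single t c =>
    induction q using Finsupp.induction_linear with
    | zero => simp
    | add p p' h h' => simp only [map_add, h, h']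
    | single s d =>
      rw [finsupp_comp_single]
      simp only [Finsupp.lmapDomain_apply, Finsupp.mapDomain_single]
      rw [finsupp_comp_single]
      congr 1
      apply Subtype.ext
      simp only [MonoTree.graft, MonoTree.relabel, BinTree.relabel, BinTree.bind_bind]
      congr 1
      funext o
      rcases o with _ | a
      · simp [BinTree.bind, BinTree.graftArgs, BinTree.relabel, BinTree.bind_bind]
      · rfl
  one_comp := by
    intro X _ q
    induction q using Finsupp.induction_linear with
    | zero => simp
    | add p p' h h' => simp only [map_add, h, h']
    | single s d =>
      simp only [Finsupp.lmapDomain_apply, Finsupp.mapDomain_single]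
      rw [finsupp_comp_single, Finsupp.mapDomain_single, one_mul]
      congr 1
      apply Subtype.ext
      change ((s.1.relabel Sum.inr).relabel _) = s.1
      simp [BinTree.relabel, BinTree.bind_bind, BinTree.bind, BinTree.bind_leaf]
  comp_one := by
    intro X _ p
    induction p using Finsupp.induction_linear with
    | zero => simp
    | add p p' h h' => simp only [map_add, LinearMap.add_apply, h, h']
    | single t c =>
      rw [finsupp_comp_single]
      simp only [Finsupp.lmapDomain_apply, Finsupp.mapDomain_single, mul_one]
      congr 1
      apply Subtype.ext
      change (t.1.bind _).bind _ = t.1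
      rw [BinTree.bind_bind]
      conv_rhs => rw [← BinTree.bind_leaf t.1]
      congr 1
      funext o
      rcases o with _ | a <;> rfl
  comp_assoc := by
    intro X Y Z _ _ _ p q r
    induction p using Finsupp.induction_linear with
    | zero => simp
    | add p p' h h' => simp only [map_add, LinearMap.add_apply, h, h']
    | single t c =>
    induction q using Finsupp.induction_linear with
    | zero => simp
    | add p p' h h' => simp only [map_add, LinearMap.add_apply, h, h']
    | single s d =>
    induction r using Finsupp.induction_linear with
    | zero => simp
    | add p p' h h' => simp only [map_add, h, h']
    | single r e =>
      rw [finsupp_comp_single, finsupp_comp_single, finsupp_comp_single]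
      simp only [Finsupp.lmapDomain_apply, Finsupp.mapDomain_single]
      rw [finsupp_comp_single, Finsupp.mapDomain_single, mul_assoc]
      congr 1
      apply Subtype.ext
      change (((t.1.bind _).bind _).bind _).bind _ = t.1.bind _
      simp only [BinTree.bind_bind]
      congr 1
      funext o
      rcases o with _ | a
      · simp only [BinTree.graftArgs, BinTree.relabel, BinTree.bind_bind, MonoTree.graft]
        congr 1
        funext o
        rcases o with _ | b
        · simp [sumOptionEquiv, BinTree.bind, BinTree.bind_bind]
        · rfl
      · rfl
  comp_comm := by
    intro X Y Z _ _ _ p q r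
    induction p using Finsupp.induction_linear with
    | zero => simp
    | add p p' h h' => simp only [map_add, LinearMap.add_apply, h, h']
    | single t c =>
    induction q using Finsupp.induction_linear with
    | zero => simp
    | add p p' h h' => simp only [map_add, LinearMap.add_apply, h, h']
    | single s d =>
    induction r using Finsupp.induction_linear with
    | zero => simp
    | add p p' h h' => simp only [map_add, LinearMap.add_apply, h, h']
    | single r e =>
      simp only [Finsupp.lmapDomain_apply, Finsupp.mapDomain_single, finsupp_comp_single]
      rw [mul_right_comm]
      congr 1
      apply Subtype.ext
      change (((t.1.bind _).bind _).bind _).bind _ = (((t.1.bind _).bind _).bind _).bind _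
      simp only [BinTree.bind_bind]
      congr 1
      funext o
      rcases o with _ | _ | a
      · simp [optionSumEquiv, optionSwapEquiv, sumSwapRightEquiv, BinTree.bind,
          BinTree.graftArgs, BinTree.relabel, BinTree.bind_bind]
      · simp [optionSumEquiv, optionSwapEquiv, sumSwapRightEquiv, BinTree.bind,
          BinTree.graftArgs, BinTree.relabel, BinTree.bind_bind]
      · rfl

end FreeOperad

/-! ## Binary quadratic operads and their duals -/

/-- The relabelling of the inputs that turns a composite `μ(ν(x, y), z)` of two binary operations
into `μ(ν(x_u, x_{u+1}), x_{u+2})`, with indices modulo 3. -/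
def cubicLabel (u : Fin 3) : Unit ⊕ Fin 2 ≃ Fin 3 :=
  Equiv.trans
    { toFun := Sum.elim (fun _ => 2) ![0, 1]
      invFun := ![Sum.inr 0, Sum.inr 1, Sum.inl ()]
      left_inv := by rintro (_ | i) <;> [rfl; (fin_cases i <;> rfl)]
      right_inv := by intro i; fin_cases i <;> rfl }
    (Equiv.addRight u)

/-- The labelling of the two inputs of a binary operation, into the first of which something is
to be plugged. -/
def firstInput : Fin 2 ≃ Option Unit where
  toFun := ![none, some ()]
  invFun
    | none => 0
    | some _ => 1
  left_inv := by intro i; fin_cases i <;> rfl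
  right_inv := by rintro (_ | _) <;> rfl

section Quadratic

variable {k : Type u} [Field k]

/-- Given binary operations `g e` of an operad `P`, linear in `e ∈ E`, this sends the family
`r = (r_0, r_1, r_2)` of elements of `E ⊗ E` to the sum of the operations
`μ(ν(x_u, x_{u+1}), x_{u+2})`, where `r_u` is the sum of the `μ ⊗ ν`. -/
noncomputable def cubicEval (P : SymOperad.{u, v} k) {E : Type u} [AddCommGroup E] [Module k E]
    (g : E →ₗ[k] P.obj (Fin 2)) : (Fin 3 → E ⊗[k] E) →ₗ[k] P.obj (Fin 3) :=
  ∑ u : Fin 3, P.map (cubicLabel u) ∘ₗ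
    TensorProduct.lift ((P.comp ∘ₗ P.map firstInput).compl₁₂ g g) ∘ₗ LinearMap.proj u

/-- The action of the cyclic permutations of the three inputs on `(E ⊗ E)³`. -/
def cubicRot (k : Type u) [Field k] (E : Type u) [AddCommGroup E] [Module k E] :
    (Fin 3 → E ⊗[k] E) →ₗ[k] (Fin 3 → E ⊗[k] E) :=
  LinearMap.funLeft k _ (fun u => u + 1)

/-- The action of the transposition of the first two inputs on `(E ⊗ E)³`: it turns
`μ(ν(x_u, x_{u+1}), x_{u+2})` into `μ((swap ν)(x_{-u}, x_{-u+1}), x_{-u+2})`. -/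
noncomputable def cubicSwap {E : Type u} [AddCommGroup E] [Module k E] (swap : E →ₗ[k] E) :
    (Fin 3 → E ⊗[k] E) →ₗ[k] (Fin 3 → E ⊗[k] E) :=
  (LinearMap.compLeft (TensorProduct.map LinearMap.id swap) (Fin 3)) ∘ₗ
    LinearMap.funLeft k _ (fun u => -u)

/-- The data defining a binary quadratic operad: a finite-dimensional space `E` of binary
operations with an action of the symmetric group on two letters, whose transposition acts by
`swap`, and an `S₃`-stable space `R` of relations in the space `(E ⊗ E)³` of ternary operations of
the free operad on `E`. Here the element `μ ⊗ ν` of the component `u` stands for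
`μ(ν(x_u, x_{u+1}), x_{u+2})`. -/
structure BinaryQuadraticData (k : Type u) [Field k] where
  E : Type u
  [addCommGroup : AddCommGroup E]
  [module : Module k E]
  [finiteDimensional : FiniteDimensional k E]
  swap : E →ₗ[k] E
  swap_swap : ∀ e, swap (swap e) = e
  R : Submodule k (Fin 3 → E ⊗[k] E)
  rot_mem : ∀ r ∈ R, cubicRot k E r ∈ R
  swap_mem : ∀ r ∈ R, cubicSwap swap r ∈ R

attribute [instance] BinaryQuadraticData.addCommGroup BinaryQuadraticData.module
  BinaryQuadraticData.finiteDimensional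

/-- The binary operation `e(x_0, x_1)` in the free operad on the set `G`. -/
noncomputable def freeOperadGen (k : Type u) [Field k] {G : Type u} (g : G) :
    (freeOperad k G).obj (Fin 2) :=
  Finsupp.single (MonoTree.corolla g) (1 : k)

/-- The relations turning the free operad on the underlying set of `E` into the free operad on
the `S₂`-module `E`. -/
inductive GenRel {E : Type u} [AddCommGroup E] [Module k E] (swap : E →ₗ[k] E) :
    (X : Type) → [Finite X] → (freeOperad k E).obj X → Prop
  | add (a b : E) : GenRel swap (Fin 2)
      (freeOperadGen k (a + b) - (freeOperadGen k a + freeOperadGen k b))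
  | smul (c : k) (a : E) : GenRel swap (Fin 2)
      (freeOperadGen k (c • a) - c • freeOperadGen k a)
  | swap (a : E) : GenRel swap (Fin 2)
      (freeOperadGen k (swap a) -
        (freeOperad k E).map (Equiv.swap 0 1) (freeOperadGen k a))

theorem SymOperad.subset_idealSpan (P : SymOperad.{u, v} k)
    (S : (X : Type) → [Finite X] → Set (P.obj X)) (X : Type) [Finite X] :
    S X ⊆ (P.idealSpan S).carrier X := by
  intro p hp
  simp only [SymOperad.idealSpan, SetLike.mem_coe, Submodule.mem_sInf]
  rintro _ ⟨I, hI, rfl⟩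
  exact hI X hp

namespace BinaryQuadraticData

variable (D : BinaryQuadraticData k)

/-- The ideal of the free operad on the set `E` whose quotient is the free operad on the
`S₂`-module `E`. -/
noncomputable def genIdeal : SymOperad.OpIdeal (freeOperad k D.E) :=
  (freeOperad k D.E).idealSpan (fun X _ => {p | GenRel D.swap X p})

/-- The free operad `F(E)` on the `S₂`-module `E` of binary operations. -/
noncomputable def free : SymOperad.{u, u} k := (freeOperad k D.E).quotient D.genIdeal

/-- The inclusion of the generators `E` in the free operad `F(E)`. -/
noncomputable def freeGen : D.E →ₗ[k] D.free.obj (Fin 2) where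
  toFun e := (freeOperad k D.E).quotientMk D.genIdeal (Fin 2) (freeOperadGen k e)
  map_add' a b := by
    exact (Submodule.Quotient.eq _).2
      ((freeOperad k D.E).subset_idealSpan _ (Fin 2) (GenRel.add a b))
  map_smul' c a := by
    exact (Submodule.Quotient.eq _).2
      ((freeOperad k D.E).subset_idealSpan _ (Fin 2) (GenRel.smul c a))

/-- The relations `R`, as operations of the free operad `F(E)`. -/
inductive Rel : (X : Type) → [Finite X] → D.free.obj X → Prop
  | mk (r : Fin 3 → D.E ⊗[k] D.E) (hr : r ∈ D.R) : Rel (Fin 3) (cubicEval D.free D.freeGen r)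

/-- The ideal of `F(E)` generated by `R`. -/
noncomputable def relIdeal : SymOperad.OpIdeal D.free :=
  D.free.idealSpan (fun X _ => {p | D.Rel X p})

/-- The quadratic operad `P(E, R) = F(E) / (R)`. -/
noncomputable def operad : SymOperad.{u, u} k := D.free.quotient D.relIdeal

/-- The generating operations of `P(E, R)`. -/
noncomputable def gen : D.E →ₗ[k] D.operad.obj (Fin 2) :=
  D.free.quotientMk D.relIdeal (Fin 2) ∘ₗ D.freeGen

/-- The pairing of `(E* ⊗ E*)³` with `(E ⊗ E)³`. -/
noncomputable def pairing : (Fin 3 → Module.Dual k D.E ⊗[k] Module.Dual k D.E) →ₗ[k]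
    Module.Dual k (Fin 3 → D.E ⊗[k] D.E) :=
  ∑ u : Fin 3, (LinearMap.proj u).dualMap ∘ₗ
    TensorProduct.dualDistrib k D.E D.E ∘ₗ LinearMap.proj u

theorem pairing_apply (s : Fin 3 → Module.Dual k D.E ⊗[k] Module.Dual k D.E)
    (r : Fin 3 → D.E ⊗[k] D.E) :
    D.pairing s r = ∑ u : Fin 3, TensorProduct.dualDistrib k D.E D.E (s u) (r u) := by
  simp [pairing, LinearMap.sum_apply]

theorem pairing_rot (s : Fin 3 → Module.Dual k D.E ⊗[k] Module.Dual k D.E)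
    (r : Fin 3 → D.E ⊗[k] D.E) :
    D.pairing (cubicRot k _ s) r = D.pairing s (cubicRot k _ (cubicRot k _ r)) := by
  simp only [pairing_apply, cubicRot, LinearMap.funLeft_apply, Fin.sum_univ_three]
  change _ + _ + TensorProduct.dualDistrib k D.E D.E (s 0) (r 2) =
    TensorProduct.dualDistrib k D.E D.E (s 0) (r 2) +
    TensorProduct.dualDistrib k D.E D.E (s 1) (r 0) +
    TensorProduct.dualDistrib k D.E D.E (s 2) (r 1)
  change TensorProduct.dualDistrib k D.E D.E (s 1) (r 0) +
    TensorProduct.dualDistrib k D.E D.E (s 2) (r 1) + _ = _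
  abel

theorem dualDistrib_swap (s : Module.Dual k D.E ⊗[k] Module.Dual k D.E) (r : D.E ⊗[k] D.E) :
    TensorProduct.dualDistrib k D.E D.E
      (TensorProduct.map LinearMap.id (-D.swap.dualMap) s) r =
    -TensorProduct.dualDistrib k D.E D.E s (TensorProduct.map LinearMap.id D.swap r) := by
  induction s using TensorProduct.induction_on with
  | zero => simp
  | add s s' h h' => simp only [map_add, LinearMap.add_apply, h, h', neg_add]
  | tmul f g =>
  induction r using TensorProduct.induction_on with
  | zero => simp
  | add r r' h h' => simp only [map_add, h, h', neg_add]
  | tmul a b => simp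

theorem pairing_swap (s : Fin 3 → Module.Dual k D.E ⊗[k] Module.Dual k D.E)
    (r : Fin 3 → D.E ⊗[k] D.E) :
    D.pairing (cubicSwap (-D.swap.dualMap) s) r = -D.pairing s (cubicSwap D.swap r) := by
  simp only [pairing_apply, cubicSwap, LinearMap.comp_apply, LinearMap.funLeft_apply,
    LinearMap.compLeft_apply, Function.comp_apply, dualDistrib_swap, Fin.sum_univ_three]
  change -TensorProduct.dualDistrib k D.E D.E (s 0) _ +
    -TensorProduct.dualDistrib k D.E D.E (s 2) _ +
    -TensorProduct.dualDistrib k D.E D.E (s 1) _ =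
    -(TensorProduct.dualDistrib k D.E D.E (s 0) (TensorProduct.map LinearMap.id D.swap (r 0)) +
    TensorProduct.dualDistrib k D.E D.E (s 1) (TensorProduct.map LinearMap.id D.swap (r 2)) +
    TensorProduct.dualDistrib k D.E D.E (s 2) (TensorProduct.map LinearMap.id D.swap (r 1)))
  abel

/-- The quadratic dual data: `E` is replaced by `E* ⊗ sgn`, and `R` by its orthogonal. The
quadratic dual operad `P(E, R)^!` is `P(E* ⊗ sgn, R^⊥)`. -/
noncomputable def dual : BinaryQuadraticData k where
  E := Module.Dual k D.E
  swap := -D.swap.dualMap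
  swap_swap f := by
    ext e
    simp [D.swap_swap]
  R := D.R.dualAnnihilator.comap D.pairing
  rot_mem := by
    intro s hs
    simp only [Submodule.mem_comap, Submodule.mem_dualAnnihilator] at hs ⊢
    intro r hr
    rw [pairing_rot]
    exact hs _ (D.rot_mem _ (D.rot_mem _ hr))
  swap_mem := by
    intro s hs
    simp only [Submodule.mem_comap, Submodule.mem_dualAnnihilator] at hs ⊢
    intro r hr
    rw [pairing_swap, hs _ (D.swap_mem _ hr), neg_zero]

/-- A quadratic operad is self-dual if it is isomorphic to its quadratic dual. -/
def IsSelfDual : Prop := SymOperad.Isomorphic D.dual.operad D.operad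

end BinaryQuadraticData

end Quadratic

/-! ## The operads of several pairwise mutually associative operations -/

section MutuallyAssociative

variable (k : Type u) [Field k] (m : ℕ)

/-- The operation `x ⋆_i y` in the space `k^m ⊕ k^m` spanned by the operations `x ⋆_i y` and
`y ⋆_i x`. -/
def starOp (i : Fin m) : (Fin m → k) × (Fin m → k) := (Pi.single i 1, 0)

/-- The transposition of the two arguments. -/
def starSwap : ((Fin m → k) × (Fin m → k)) →ₗ[k] ((Fin m → k) × (Fin m → k)) :=
  (LinearEquiv.prodComm k (Fin m → k) (Fin m → k)).toLinearMap

/-- The relation `x ⋆_i (y ⋆_j z) - (x ⋆_i y) ⋆_j z`. -/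
noncomputable def starRel (i j : Fin m) :
    Fin 3 → (((Fin m → k) × (Fin m → k)) ⊗[k] ((Fin m → k) × (Fin m → k))) :=
  ![-(starOp k m j ⊗ₜ[k] starOp k m i), starSwap k m (starOp k m i) ⊗ₜ[k] starOp k m j, 0]

/-- The operad `As^(m)`, generated by `m` binary operations without symmetry, subject to the
relations `x ⋆_i (y ⋆_j z) = (x ⋆_i y) ⋆_j z` for all `i` and `j`. -/
noncomputable def asData : BinaryQuadraticData k where
  E := (Fin m → k) × (Fin m → k)
  swap := starSwap k m
  swap_swap _ := rfl
  R := sInf {M | (∀ i j, starRel k m i j ∈ M) ∧ (∀ r ∈ M, cubicRot k _ r ∈ M) ∧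
    ∀ r ∈ M, cubicSwap (starSwap k m) r ∈ M}
  rot_mem := by
    intro r hr
    simp only [Submodule.mem_sInf] at hr ⊢
    intro M hM
    exact hM.2.1 r (hr M hM)
  swap_mem := by
    intro r hr
    simp only [Submodule.mem_sInf] at hr ⊢
    intro M hM
    exact hM.2.2 r (hr M hM)

/-- The vector space `V` with the bilinear operations `op i`, for `i = 1, …, m`, is an algebra
over the operad `As^(m)`, with `⋆_i` acting as `op i`. -/
def IsAsAlgebra (V : Type v) [AddCommGroup V] [Module k V] (op : Fin m → V →ₗ[k] V →ₗ[k] V) :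
    Prop :=
  ∃ φ : SymOperad.Hom (asData k m).operad (endOperad k V), ∀ (i : Fin m) (a b : V),
    endEval k V (φ.app (Fin 2) ((asData k m).gen (starOp k m i))) ![a, b] = op i a b

end MutuallyAssociative

/-! ## The cobar complex and Koszul operads -/

section Cobar

/-- A reduced rooted tree with leaves `Fin n` (every vertex has at least two inputs) is determined
by the sets of leaves lying above its vertices. `T` is the collection of these sets for the
vertices other than the root, whose set is `Finset.univ`; so the elements of `T` correspond to the
internal edges of the tree. -/
def IsReducedTree {n : ℕ} (T : Finset (Finset (Fin n))) : Prop :=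
  (∀ U ∈ T, 2 ≤ U.card ∧ U ≠ Finset.univ) ∧
    ∀ U ∈ T, ∀ V ∈ T, U ⊆ V ∨ V ⊆ U ∨ Disjoint U V

/-- `W` is (the set of leaves of) a vertex or a leaf of `T` attached directly to the vertex `v`. -/
def IsChild {n : ℕ} (T : Finset (Finset (Fin n))) (v W : Finset (Fin n)) : Prop :=
  (W ∈ T ∨ W.card = 1) ∧ W ⊂ v ∧ ∀ W' ∈ T, W ⊂ W' → ¬ W' ⊂ v

/-- The set of inputs of the vertex `v` of `T`. -/
abbrev TreeIn {n : ℕ} (T : Finset (Finset (Fin n))) (v : Finset (Fin n)) : Type :=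
  {W : Finset (Fin n) // IsChild T v W}

/-- The vertices of `T`. -/
abbrev TreeVert {n : ℕ} (T : Finset (Finset (Fin n))) : Type :=
  {v : Finset (Fin n) // v = Finset.univ ∨ v ∈ T}

section Trees

variable {n : ℕ} {T : Finset (Finset (Fin n))} {U v : Finset (Fin n)}

theorem IsReducedTree.erase (hT : IsReducedTree T) (U : Finset (Fin n)) :
    IsReducedTree (T.erase U) :=
  ⟨fun V hV => hT.1 V (Finset.mem_of_mem_erase hV), fun V hV W hW =>
    hT.2 V (Finset.mem_of_mem_erase hV) W (Finset.mem_of_mem_erase hW)⟩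

theorem isChild_erase_of_not (hU : U ∈ T) (h : ¬ IsChild T v U) (W : Finset (Fin n)) :
    IsChild T v W ↔ IsChild (T.erase U) v W := by
  have key : U ⊂ v → ∃ U' ∈ T, U ⊂ U' ∧ U' ⊂ v := by
    intro hUv
    by_contra hc
    push Not at hc
    exact h ⟨Or.inl hU, hUv, fun W' hW' h1 => hc W' hW' h1⟩
  constructor
  · rintro ⟨h1, h2, h3⟩
    refine ⟨?_, h2, fun W' hW' => h3 W' (Finset.mem_of_mem_erase hW')⟩
    rcases h1 with h1 | h1
    · refine Or.inl (Finset.mem_erase.2 ⟨?_, h1⟩)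
      rintro rfl
      exact h ⟨Or.inl h1, h2, h3⟩
    · exact Or.inr h1
  · rintro ⟨h1, h2, h3⟩
    refine ⟨h1.imp_left Finset.mem_of_mem_erase, h2, fun W' hW' hWW' hW'v => ?_⟩
    by_cases hWU : W' = U
    · subst hWU
      obtain ⟨U', hU', h4, h5⟩ := key hW'v
      exact h3 U' (Finset.mem_erase.2 ⟨h4.ne', hU'⟩) (hWW'.trans h4) h5
    · exact h3 W' (Finset.mem_erase.2 ⟨hWU, hW'⟩) hWW' hW'v

theorem isChild_erase_iff (hT : IsReducedTree T) (hU : U ∈ T) (h : IsChild T v U)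
    (W : Finset (Fin n)) :
    IsChild (T.erase U) v W ↔ (IsChild T v W ∧ W ≠ U) ∨ IsChild T U W := by
  have hUc := (hT.1 U hU).1
  constructor
  · rintro ⟨h1, h2, h3⟩
    have hWU : W ≠ U := by
      rintro rfl
      rcases h1 with h1 | h1
      · simp at h1
      · omega
    by_cases hs : W ⊂ U
    · refine Or.inr ⟨h1.imp_left Finset.mem_of_mem_erase, hs, fun W' hW' h4 h5 => ?_⟩
      exact h3 W' (Finset.mem_erase.2 ⟨h5.ne, hW'⟩) h4 (h5.trans h.2.1)
    · refine Or.inl ⟨⟨h1.imp_left Finset.mem_of_mem_erase, h2, fun W' hW' h4 h5 => ?_⟩, hWU⟩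
      refine h3 W' (Finset.mem_erase.2 ⟨?_, hW'⟩) h4 h5
      rintro rfl
      exact hs h4
  · rintro (⟨⟨h1, h2, h3⟩, hWU⟩ | ⟨h1, h2, h3⟩)
    · exact ⟨h1.imp_left (fun h1 => Finset.mem_erase.2 ⟨hWU, h1⟩), h2,
        fun W' hW' => h3 W' (Finset.mem_of_mem_erase hW')⟩
    · refine ⟨h1.imp_left (fun h1 => Finset.mem_erase.2 ⟨h2.ne, h1⟩), h2.trans h.2.1,
        fun W' hW' h4 h5 => ?_⟩
      obtain ⟨hne, hW'T⟩ := Finset.mem_erase.1 hW'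
      have hWne : W.Nonempty := by
        rcases h1 with h1 | h1
        · exact Finset.card_pos.1 (by have := (hT.1 W h1).1; omega)
        · exact Finset.card_pos.1 (by omega)
      rcases hT.2 W' hW'T U hU with h6 | h6 | h6
      · exact h3 W' hW'T h4 (lt_of_le_of_ne h6 hne)
      · exact h.2.2 W' hW'T (lt_of_le_of_ne h6 hne.symm) h5
      · obtain ⟨a, ha⟩ := hWne
        exact Finset.disjoint_left.1 h6 (h4.1 ha) (h2.1 ha)

/-- If `U` is attached to `v`, contracting the edge `U` replaces the input `U` of `v` by the
inputs of `U`. -/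
noncomputable def contractEquiv (hT : IsReducedTree T) (hU : U ∈ T) (h : IsChild T v U) :
    {W : TreeIn T v // W ≠ ⟨U, h⟩} ⊕ TreeIn T U ≃ TreeIn (T.erase U) v :=
  Equiv.ofBijective
    (Sum.elim
      (fun W => ⟨W.1.1, (isChild_erase_iff hT hU h _).2
        (Or.inl ⟨W.1.2, fun hW => W.2 (Subtype.ext hW)⟩)⟩)
      (fun W => ⟨W.1, (isChild_erase_iff hT hU h _).2 (Or.inr W.2)⟩))
    (by
      constructor
      · rintro (⟨⟨W, hW⟩, hWU⟩ | ⟨W, hW⟩) (⟨⟨W', hW'⟩, hWU'⟩ | ⟨W', hW'⟩) heq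
        · simp only [Sum.elim_inl, Subtype.mk.injEq] at heq
          subst heq; rfl
        · simp only [Sum.elim_inl, Sum.elim_inr, Subtype.mk.injEq] at heq
          subst heq
          exact absurd h.2.1 (hW.2.2 U hU hW'.2.1)
        · simp only [Sum.elim_inl, Sum.elim_inr, Subtype.mk.injEq] at heq
          subst heq
          exact absurd h.2.1 (hW'.2.2 U hU hW.2.1)
        · simp only [Sum.elim_inr, Subtype.mk.injEq] at heq
          subst heq; rfl
      · rintro ⟨W, hW⟩
        rcases (isChild_erase_iff hT hU h W).1 hW with ⟨h1, h2⟩ | h1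
        · exact ⟨Sum.inl ⟨⟨W, h1⟩, fun hW => h2 (congrArg Subtype.val hW)⟩, rfl⟩
        · exact ⟨Sum.inr ⟨W, h1⟩, rfl⟩)

theorem exists_parent (hT : IsReducedTree T) (hU : U ∈ T) :
    ∃ v : TreeVert (T.erase U), IsChild T v.1 U := by
  classical
  obtain ⟨v, hv, hmin⟩ := Finset.exists_min_image
    (insert Finset.univ (T.filter (fun V => U ⊂ V))) Finset.card ⟨_, Finset.mem_insert_self _ _⟩
  have hUv : U ⊂ v := by
    rcases Finset.mem_insert.1 hv with rfl | hv
    · exact Finset.ssubset_univ_iff.2 (hT.1 U hU).2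
    · exact (Finset.mem_filter.1 hv).2
  refine ⟨⟨v, ?_⟩, Or.inl hU, hUv, fun W hW h1 h2 => ?_⟩
  · rcases Finset.mem_insert.1 hv with rfl | hv
    · exact Or.inl rfl
    · exact Or.inr (Finset.mem_erase.2 ⟨hUv.ne', (Finset.mem_filter.1 hv).1⟩)
  · exact absurd (Finset.card_lt_card h2)
      (not_lt.2 (hmin W (Finset.mem_insert_of_mem (Finset.mem_filter.2 ⟨hW, h1⟩))))

theorem parent_unique (hT : IsReducedTree T) (hU : U ∈ T) {v v' : TreeVert (T.erase U)}
    (h : IsChild T v.1 U) (h' : IsChild T v'.1 U) : v = v' := by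
  have hsub : ∀ {v v' : TreeVert (T.erase U)}, IsChild T v.1 U → IsChild T v'.1 U →
      ¬ v.1 ⊂ v'.1 := by
    intro v v' h h' hlt
    rcases v.2 with hv | hv
    · rw [hv] at hlt
      exact hlt.2 (Finset.subset_univ _)
    · exact h'.2.2 v.1 (Finset.mem_of_mem_erase hv) h.2.1 hlt
  apply Subtype.ext
  by_contra hne
  have hcomp : v.1 ⊆ v'.1 ∨ v'.1 ⊆ v.1 := by
    rcases v.2 with hv | hv
    · rw [hv]; exact Or.inr (Finset.subset_univ _)
    rcases v'.2 with hv' | hv'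
    · rw [hv']; exact Or.inl (Finset.subset_univ _)
    rcases hT.2 _ (Finset.mem_of_mem_erase hv) _ (Finset.mem_of_mem_erase hv') with h1 | h1 | h1
    · exact Or.inl h1
    · exact Or.inr h1
    · obtain ⟨a, ha⟩ : U.Nonempty :=
        Finset.card_pos.1 (by have := (hT.1 U hU).1; omega)
      exact absurd (h'.2.1.1 ha) (Finset.disjoint_left.1 h1 (h.2.1.1 ha))
  rcases hcomp with h1 | h1
  · exact hsub h h' (lt_of_le_of_ne h1 hne)
  · exact hsub h' h (lt_of_le_of_ne h1 (Ne.symm hne))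

/-- A vertex of the contracted tree, as a vertex of the original tree. -/
def TreeVert.ofErase (v : TreeVert (T.erase U)) : TreeVert T :=
  ⟨v.1, v.2.imp_right Finset.mem_of_mem_erase⟩

end Trees

variable {k : Type u} [Field k] (P : SymOperad.{u, v} k)

/-- A decoration of each vertex of `T` by an operation whose inputs are those of the vertex. -/
abbrev TreeDec {n : ℕ} (T : Finset (Finset (Fin n))) : Type v :=
  (v : TreeVert T) → P.obj (TreeIn T v.1)

open Classical in
/-- Contraction of the internal edge `U` of the tree `T`: the operations at the two ends of the
edge are composed. -/
noncomputable def contract {n : ℕ} {T : Finset (Finset (Fin n))} (hT : IsReducedTree T)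
    {U : Finset (Fin n)} (hU : U ∈ T) (x : TreeDec P T) : TreeDec P (T.erase U) := fun v =>
  if h : IsChild T v.1 U then
    P.map (contractEquiv hT hU h)
      (P.comp (P.map (Equiv.optionSubtypeNe (⟨U, h⟩ : TreeIn T v.1)).symm (x v.ofErase))
        (x ⟨U, Or.inr hU⟩))
  else P.map (Equiv.subtypeEquivRight (isChild_erase_of_not hU h)) (x v.ofErase)

theorem contract_update {n : ℕ} {T : Finset (Finset (Fin n))} (hT : IsReducedTree T)
    {U : Finset (Fin n)} (hU : U ∈ T) [DecidableEq (TreeVert T)]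
    [DecidableEq (TreeVert (T.erase U))] (x : TreeDec P T) (v : TreeVert T) :
    ∃ (w : TreeVert (T.erase U)) (L : P.obj (TreeIn T v.1) →ₗ[k] P.obj (TreeIn (T.erase U) w.1)),
      ∀ a, contract P hT hU (Function.update x v a) =
        Function.update (contract P hT hU x) w (L a) := by
  by_cases hv : v.1 = U
  · obtain ⟨v, hv'⟩ := v
    subst hv
    obtain ⟨w, hw⟩ := exists_parent hT hU
    have hne : ∀ w' : TreeVert (T.erase v), w'.ofErase ≠ (⟨v, hv'⟩ : TreeVert T) := by
      intro w' h
      have h1 : w'.1 = v := congrArg Subtype.val h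
      rcases w'.2 with h2 | h2
      · exact (hT.1 v hU).2 (h1.symm.trans h2)
      · exact (Finset.mem_erase.1 h2).1 h1
    refine ⟨w, P.map (contractEquiv hT hU hw) ∘ₗ
      P.comp (P.map (Equiv.optionSubtypeNe (⟨v, hw⟩ : TreeIn T w.1)).symm (x w.ofErase)), ?_⟩
    intro a
    funext w'
    by_cases h : w' = w
    · subst h
      rw [Function.update_self, contract, dif_pos hw, Function.update_self,
        Function.update_of_ne (hne w')]
      rfl
    · have h' : ¬ IsChild T w'.1 v := fun h' => h (parent_unique hT hU h' hw)
      rw [Function.update_of_ne h, contract, contract, dif_neg h', dif_neg h',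
        Function.update_of_ne (hne w')]
  · have hvU : (⟨U, Or.inr hU⟩ : TreeVert T) ≠ v := fun h => hv (congrArg Subtype.val h).symm
    let w : TreeVert (T.erase U) := ⟨v.1, v.2.imp_right fun h => Finset.mem_erase.2 ⟨hv, h⟩⟩
    have hne : ∀ w' : TreeVert (T.erase U), w' ≠ w → w'.ofErase ≠ v := by
      intro w' h h'
      exact h (Subtype.ext (congrArg (fun z : TreeVert T => z.1) h'))
    by_cases hc : IsChild T w.1 U
    · refine ⟨w, P.map (contractEquiv hT hU hc) ∘ₗ (P.comp.flip (x ⟨U, Or.inr hU⟩)) ∘ₗ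
        P.map (Equiv.optionSubtypeNe (⟨U, hc⟩ : TreeIn T w.1)).symm, ?_⟩
      intro a
      funext w'
      by_cases h : w' = w
      · subst h
        rw [Function.update_self, contract, dif_pos hc, Function.update_of_ne hvU]
        have : Function.update x v a w.ofErase = a := Function.update_self v a x
        rw [this]
        rfl
      · rw [Function.update_of_ne h, contract, contract]
        rw [Function.update_of_ne hvU, Function.update_of_ne (hne w' h)]
    · refine ⟨w, P.map (Equiv.subtypeEquivRight (isChild_erase_of_not hU hc)), ?_⟩
      intro a
      funext w'
      by_cases h : w' = w
      · subst h
        rw [Function.update_self, contract, dif_neg hc]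
        have : Function.update x v a w.ofErase = a := Function.update_self v a x
        rw [this]
      · rw [Function.update_of_ne h, contract, contract]
        rw [Function.update_of_ne hvU, Function.update_of_ne (hne w' h)]

/-- The dual `P(T)*` of the tensor product `P(T)` of the spaces `P(In(v))` over all vertices `v`
of the tree `T`. -/
abbrev TreeForm {n : ℕ} (T : Finset (Finset (Fin n))) : Type (max u v) :=
  MultilinearMap k (fun v : TreeVert T => P.obj (TreeIn T v.1)) k

/-- The dual `P(T/U)* → P(T)*` of the contraction of the internal edge `U`. -/
noncomputable def expand {n : ℕ} {T : Finset (Finset (Fin n))} (hT : IsReducedTree T)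
    {U : Finset (Fin n)} (hU : U ∈ T) : TreeForm P (T.erase U) →ₗ[k] TreeForm P T where
  toFun φ :=
    { toFun := fun x => φ (contract P hT hU x)
      map_update_add' := by
        classical
        intro _ x v a b
        obtain ⟨w, L, hL⟩ := contract_update P hT hU x v
        simp only [hL, map_add, MultilinearMap.map_update_add]
      map_update_smul' := by
        classical
        intro _ x v c a
        obtain ⟨w, L, hL⟩ := contract_update P hT hU x v
        simp only [hL, map_smul, MultilinearMap.map_update_smul] }
  map_add' _ _ := rfl
  map_smul' _ _ := rfl

/-- The reduced trees with leaves `Fin n` and with `i` internal edges. -/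
abbrev TreesWith (n i : ℕ) : Type := {T : Finset (Finset (Fin n)) // IsReducedTree T ∧ T.card = i}

/-- The term in degree `i` of the cobar complex `D(P)(n)`: the direct sum of the spaces
`P(T)* ⊗ det(T)` over all reduced trees `T` with `n` leaves and `i` internal edges. The
one-dimensional space `det(T)`, the top exterior power of the space spanned by the internal edges,
is trivialized by ordering the internal edges, as sets of leaves, colexicographically. -/
abbrev CobarTerm (n i : ℕ) : Type (max u v) := (T : TreesWith n i) → TreeForm P T.1

open Classical in
/-- The sign with which the internal edge `U` occurs in the differential: the parity of the
number of internal edges preceding it. -/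
noncomputable def edgeSign (k : Type u) [Field k] {n : ℕ} (T : Finset (Finset (Fin n)))
    (U : Finset (Fin n)) : k :=
  (-1) ^ (T.filter (fun V => toColex V < toColex U)).card

/-- The differential of the cobar complex `D(P)(n)`, dual to the sum of the contractions of all
internal edges. -/
noncomputable def cobarD (n i : ℕ) : CobarTerm P n i →ₗ[k] CobarTerm P n (i + 1) :=
  LinearMap.pi fun T => ∑ U : {U // U ∈ T.1}, edgeSign k T.1 U.1 •
    (expand P T.2.1 U.2 ∘ₗ LinearMap.proj (⟨T.1.erase U.1, T.2.1.erase U.1, by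
      rw [Finset.card_erase_of_mem U.2, T.2.2]; rfl⟩ : TreesWith n i))

/-- The operad `P` (with `P(0) = 0` and `P(1) = k`) is Koszul if, for all `n ≥ 2`, the complex
`D(P)(n)`, which is concentrated in the degrees `0, …, n - 2`, is exact in all degrees other
than `n - 2`. -/
def SymOperad.IsKoszul : Prop :=
  ∀ n : ℕ, 2 ≤ n → (n ≠ 2 → Function.Injective (cobarD P n 0)) ∧
    ∀ i : ℕ, i + 1 ≠ n - 2 → Function.Exact (cobarD P n i) (cobarD P n (i + 1))

end Cobar

/-! ## Operations on Hochschild cochains with values in tensor powers -/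

section Cochains

variable (k : Type u) [Field k] (A : Type v) [Ring A] [Algebra k A]

/-- The Hochschild cochains `C^p(A, A^{⊗ r})`. -/
abbrev TensorCochain (p r : ℕ) : Type (max u v) := (⨂[k]^p A) →ₗ[k] (⨂[k]^r A)

variable {A}

/-- The map `f ⊗ g` on `A^{⊗ (p + q)} = A^{⊗ p} ⊗ A^{⊗ q}`. -/
noncomputable def cochainTensor {p q r s : ℕ} : TensorCochain k A p r →ₗ[k]
    TensorCochain k A q s →ₗ[k] TensorCochain k A (p + q) (r + s) :=
  LinearMap.mk₂ k
    (fun f g => TensorPower.mulEquiv.toLinearMap ∘ₗ TensorProduct.map f g ∘ₗ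
      TensorPower.mulEquiv.symm.toLinearMap)
    (fun f f' g => by rw [TensorProduct.map_add_left, LinearMap.add_comp, LinearMap.comp_add])
    (fun c f g => by rw [TensorProduct.map_smul_left, LinearMap.smul_comp, LinearMap.comp_smul])
    (fun f g g' => by rw [TensorProduct.map_add_right, LinearMap.add_comp, LinearMap.comp_add])
    (fun c f g => by rw [TensorProduct.map_smul_right, LinearMap.smul_comp, LinearMap.comp_smul])

/-- The identification of spaces of cochains with equal indices. -/
noncomputable def cochainCast {p p' r r' : ℕ} (hp : p = p') (hr : r = r') :
    TensorCochain k A p r →ₗ[k] TensorCochain k A p' r' :=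
  ((TensorPower.cast k A hp).arrowCongr (TensorPower.cast k A hr)).toLinearMap

/-- The multiplication of `A`, as a map `A^{⊗ 2} → A^{⊗ 1}`. -/
noncomputable def mulCochain : TensorCochain k A 2 1 :=
  (PiTensorProduct.subsingletonEquiv (R := k) (s := fun _ : Fin 1 => A) 0).symm.toLinearMap ∘ₗ
    PiTensorProduct.lift (MultilinearMap.mkPiAlgebraFin k 2 A)

/-- Composition of cochains: apply `g`, then `f`. -/
noncomputable def cochainComp {p r s : ℕ} : TensorCochain k A r s →ₗ[k]
    TensorCochain k A p r →ₗ[k] TensorCochain k A p s :=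
  LinearMap.llcomp k _ _ _

/-- The operation `f ⊢ g`: apply `g` to the last components and then `f` to the first components.
Here `f` has `p + 1` arguments, and `g` has values in `A^{⊗ (s + 1)}`. -/
noncomputable def cochainVdash {p q r s : ℕ} : TensorCochain k A (p + 1) r →ₗ[k]
    TensorCochain k A q (s + 1) →ₗ[k] TensorCochain k A (p + q) (r + s) :=
  (cochainComp k).compl₁₂
    ((cochainTensor k).flip (LinearMap.id : TensorCochain k A s s))
    (cochainCast k (A := A) (rfl : p + q = p + q) (by omega : p + (s + 1) = (p + 1) + s) ∘ₗ
      cochainTensor k (LinearMap.id : TensorCochain k A p p))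

/-- The operation `f ⊣ g`: apply `f` to the first components and then `g` to the last components.
Here `f` has values in `A^{⊗ (r + 1)}`, and `g` has `q + 1` arguments. -/
noncomputable def cochainDashv {p q r s : ℕ} : TensorCochain k A p (r + 1) →ₗ[k]
    TensorCochain k A (q + 1) s →ₗ[k] TensorCochain k A (p + q) (r + s) :=
  ((cochainComp k).compl₁₂
    (cochainTensor k (LinearMap.id : TensorCochain k A r r))
    (cochainCast k (A := A) (rfl : p + q = p + q) (by omega : (r + 1) + q = r + (q + 1)) ∘ₗ
      (cochainTensor k).flip (LinearMap.id : TensorCochain k A q q))).flip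

/-- The product `A^{⊗ (r + 1)} ⊗ A^{⊗ (s + 1)} → A^{⊗ (r + 1 + s)}`, which multiplies the last
component of the first factor with the first component of the second factor. It is the product of
the free product algebra `A * k[t]`, with `a_1 ⊗ ⋯ ⊗ a_n` identified with
`a_1 t a_2 t ⋯ t a_n`. -/
noncomputable def mergeCochain (r s : ℕ) :
    TensorCochain k A ((r + 1) + (s + 1)) (r + 1 + s) :=
  cochainCast k (by omega : r + 2 + s = (r + 1) + (s + 1)) rfl
    (cochainTensor k
      (cochainTensor k (LinearMap.id : TensorCochain k A r r) (mulCochain k))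
      (LinearMap.id : TensorCochain k A s s))

/-- The cup product `f ∪ g`. -/
noncomputable def cochainCup {p q r s : ℕ} : TensorCochain k A p (r + 1) →ₗ[k]
    TensorCochain k A q (s + 1) →ₗ[k] TensorCochain k A (p + q) (r + 1 + s) :=
  (cochainTensor k).compr₂ (cochainComp k (mergeCochain k r s))

/-- The bilinear map on direct sums with given components. -/
noncomputable def directSumBilin {ι : Type} [DecidableEq ι] {M : ι → Type w} {N : Type w}
    [∀ i, AddCommMonoid (M i)] [∀ i, Module k (M i)] [AddCommMonoid N] [Module k N]
    (op : ∀ i j, M i →ₗ[k] M j →ₗ[k] N) : (⨁ i, M i) →ₗ[k] (⨁ i, M i) →ₗ[k] N :=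
  DirectSum.toModule k ι _ (fun i =>
    (DirectSum.toModule k ι _ (fun j => (op i j).flip)).flip)

variable (A)

/-- The space `C(A, A_t^+)_{≥ 2}`, the direct sum of the spaces `C^p(A, A^{⊗ r})` over all
`p, r ≥ 2`. The summand with index `(a, b)` is the one with `p = a + 2` and `r = b + 2`. -/
abbrev CochainSpace : Type (max u v) :=
  ⨁ i : ℕ × ℕ, TensorCochain k A (i.1 + 2) (i.2 + 2)

/-- The inclusion of `C^p(A, A^{⊗ r})`, for `p = a + 2` and `r = b + 2`. -/
noncomputable def cochainIncl (a b : ℕ) {p r : ℕ} (hp : p = a + 2) (hr : r = b + 2) :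
    TensorCochain k A p r →ₗ[k] CochainSpace k A :=
  DirectSum.lof k (ℕ × ℕ) (fun i => TensorCochain k A (i.1 + 2) (i.2 + 2)) (a, b) ∘ₗ
    cochainCast k hp hr

/-- The operation `⊢` on `C(A, A_t^+)_{≥ 2}`. -/
noncomputable def opVdash : CochainSpace k A →ₗ[k] CochainSpace k A →ₗ[k] CochainSpace k A :=
  directSumBilin k fun (i j : ℕ × ℕ) =>
    (cochainVdash k (p := i.1 + 1) (q := j.1 + 2) (r := i.2 + 2) (s := j.2 + 1)).compr₂
      (cochainIncl k A (i.1 + j.1 + 1) (i.2 + j.2 + 1) (by omega) (by omega))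

/-- The operation `⊣` on `C(A, A_t^+)_{≥ 2}`. -/
noncomputable def opDashv : CochainSpace k A →ₗ[k] CochainSpace k A →ₗ[k] CochainSpace k A :=
  directSumBilin k fun (i j : ℕ × ℕ) =>
    (cochainDashv k (p := i.1 + 2) (q := j.1 + 1) (r := i.2 + 1) (s := j.2 + 2)).compr₂
      (cochainIncl k A (i.1 + j.1 + 1) (i.2 + j.2 + 1) (by omega) (by omega))

/-- The cup product on `C(A, A_t^+)_{≥ 2}`. -/
noncomputable def opCup : CochainSpace k A →ₗ[k] CochainSpace k A →ₗ[k] CochainSpace k A :=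
  directSumBilin k fun (i j : ℕ × ℕ) =>
    (cochainCup k (p := i.1 + 2) (q := j.1 + 2) (r := i.2 + 1) (s := j.2 + 1)).compr₂
      (cochainIncl k A (i.1 + j.1 + 2) (i.2 + j.2 + 1) (by omega) (by omega))

/-- The operation `f ∨ g = f ⊢ g - f ⊣ g` on `C(A, A_t^+)_{≥ 2}`. -/
noncomputable def opVee : CochainSpace k A →ₗ[k] CochainSpace k A →ₗ[k] CochainSpace k A :=
  LinearMap.mk₂ k (fun f g => opVdash k A f g - opDashv k A f g)
    (fun f f' g => by simp only [map_add, LinearMap.add_apply]; abel)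
    (fun c f g => by simp only [map_smul, LinearMap.smul_apply, smul_sub])
    (fun f g g' => by simp only [map_add]; abel)
    (fun c f g => by simp only [map_smul, smul_sub])

end Cochains

/-! Everything rests on an explicit basis of `As^(m)`: the words `x₁ i₁ x₂ i₂ … xₙ` in which each
input occurs once and a label from `Fin m` stands between neighbours. These words span, because the
relations turn every tree into a right comb (`treeRel_mul`, `span_wordElem`). They are independent,
because the labelled words span an `As^(m)`-algebra under concatenation, and in it different words
take different basis vectors as values at the generators (`genericValue`, `wordBasis`). Partial
composition takes basis words to basis words, by substitution (`comp_wordElem`).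

Koszulness: a reduced tree with words at its vertices is the same as one word `w` on all leaves
together with a set of pairwise nested or disjoint intervals of `w` (`exists_induced`,
`Induced.unique`). The word at a vertex lists the inputs in the order of their last leaves, and the
label after an input is the label of `w` after its last leaf. Contracting an edge erases an interval
and keeps `w`. Hence the cobar complex in arity `n` is a product, over the words `w`, of copies of
one simplicial cochain complex (`cobarEval_cobarD`). The vertices of this simplicial complex, the
intervals with at least two and fewer than `n` letters, are the diagonals of an `(n + 1)`-gon, and
nested or disjoint means noncrossing. It is the boundary of the dual associahedron, a sphere of
dimension `n - 3`, so its reduced cohomology is concentrated at the simplices with `n - 2` vertices.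
This is proved by vertex decomposition: the claim for a complex follows from the claims for the
deletion and for the link of a vertex (`exactOff_step`), and for a diagonal cutting off an ear the
link belongs to a smaller polygon, while the deletion is contractible (`sphereLike_chords`). The
labels play no role, so the argument is uniform in `m ≥ 1`.

Self-duality: the operations `⋆ᵢ` and their opposites form a basis of the generators. In the
resulting coordinates of the ternary operations, the relations say that the coordinates, suitably
matched in pairs, have sum zero in each pair. If `⋆ᵢ` is identified with its dual basis vector and
its opposite with minus the dual basis vector, the pairing becomes a diagonal form with opposite
signs on each pair, and the space of relations is its own orthogonal (`mem_asRel_iff_dualForm`).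

Algebras: what has to be checked is `a ⋆ᵢ (b ⋆ⱼ c) = (a ⋆ᵢ b) ⋆ⱼ c`. For `⊢`, `⊣` and `∪` both sides
are composites of the same maps, up to interchanging two maps that act on different components
(`CochainMor.exchange`). The components are different because the middle cochain has at least two
arguments and at least two values. The identities for `∨` follow by bilinearity. -/

/-! ### Simplicial cochains of flag complexes and vertex decompositions. -/

section FlagComplex

variable {α β k : Type*} [Field k] [LinearOrder β]

/-- The sign of `U` in the finite set `T` ordered by `key`. -/
def keySign (k : Type*) [Field k] (key : α → β) (T : Finset α) (U : α) : k :=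
  (-1) ^ (T.filter (fun V => key V < key U)).card

theorem keySign_mul_self (key : α → β) (T : Finset α) (U : α) :
    keySign k key T U * keySign k key T U = 1 := by
  rw [keySign, ← mul_pow]; simp

variable [DecidableEq α]

/-- The simplicial coboundary, on functions on finite sets. -/
def coboundary (key : α → β) (F : Finset α → k) (T : Finset α) : k :=
  ∑ U ∈ T, keySign k key T U * F (T.erase U)

theorem coboundary_add (key : α → β) (F G : Finset α → k) (T : Finset α) :
    coboundary key (F + G) T = coboundary key F T + coboundary key G T := by
  simp [coboundary, mul_add, Finset.sum_add_distrib]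

theorem coboundary_sub (key : α → β) (F G : Finset α → k) (T : Finset α) :
    coboundary key (F - G) T = coboundary key F T - coboundary key G T := by
  simp [coboundary, mul_sub, Finset.sum_sub_distrib]

theorem keySign_insert (key : α → β) {T : Finset α} {v U : α} (hv : v ∉ T) :
    keySign k key (insert v T) U = (if key v < key U then -1 else 1) * keySign k key T U := by
  unfold keySign
  rw [Finset.filter_insert]
  split_ifs with h
  · rw [Finset.card_insert_of_notMem (by simp [hv]), pow_succ]; ring
  · simp

theorem keySign_erase (key : α → β) {T : Finset α} {U v : α} (hU : U ∈ T) :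
    keySign k key (T.erase U) v = (if key U < key v then -1 else 1) * keySign k key T v := by
  conv_rhs => rw [← Finset.insert_erase hU]
  rw [keySign_insert key (Finset.notMem_erase U T), ← mul_assoc]
  split_ifs <;> simp

/-- Signs of a vertex `v` and of a vertex `U` anticommute. -/
theorem keySign_insert_mul_erase {key : α → β} (hk : Function.Injective key) {T : Finset α}
    {v U : α} (hv : v ∉ T) (hU : U ∈ T) :
    keySign k key (insert v T) U * keySign k key (T.erase U) v =
      -(keySign k key T U * keySign k key T v) := by
  have hne : key v ≠ key U := fun h => hv (hk h ▸ hU)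
  rw [keySign_insert key hv, keySign_erase key hU]
  rcases lt_or_gt_of_ne hne with h | h
  · rw [if_pos h, if_neg h.not_gt]; ring
  · rw [if_pos h, if_neg (not_lt_of_gt h)]; ring

/-- The face opposite to `v` is separated from the faces containing `v`; this is how cones and links
enter the computations. -/
theorem coboundary_insert (key : α → β) (F : Finset α → k) {T : Finset α} {v : α} (hv : v ∉ T) :
    coboundary key F (insert v T) = keySign k key T v * F T +
      ∑ U ∈ T, keySign k key (insert v T) U * F (insert v (T.erase U)) := by
  rw [coboundary, Finset.sum_insert hv, Finset.erase_insert hv, keySign_insert key hv]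
  simp only [lt_self_iff_false, if_false, one_mul]
  congr 1
  refine Finset.sum_congr rfl fun U hU => ?_
  rw [Finset.erase_insert_of_ne (by rintro rfl; exact hv hU)]

/-- Among the faces of codimension two of `insert v T`, those without `v` cancel because the signs
of `v` and `U` anticommute. The others add up, up to sign, to the double coboundary on `T` of `W ↦
-sign(W, v) F(insert v W)`, which vanishes by induction. -/
theorem coboundary_coboundary {key : α → β} (hk : Function.Injective key) (F : Finset α → k)
    (T : Finset α) : coboundary key (coboundary key F) T = 0 := by
  induction T using Finset.induction_on generalizing F with
  | empty => simp [coboundary]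
  | insert v T hv ih =>
    have key1 : ∀ U ∈ T, coboundary key F (insert v (T.erase U)) =
        keySign k key (T.erase U) v * F (T.erase U) +
        ∑ W ∈ T.erase U, keySign k key (insert v (T.erase U)) W *
          F (insert v ((T.erase U).erase W)) := fun U hU =>
      coboundary_insert key F (fun h => hv (Finset.mem_of_mem_erase h))
    rw [coboundary_insert key _ hv]
    have h2 : ∀ U ∈ T, keySign k key (insert v T) U * coboundary key F (insert v (T.erase U)) =
        -(keySign k key T v) * (keySign k key T U * F (T.erase U)) +
        keySign k key T v * (-keySign k key T U * ∑ W ∈ T.erase U, keySign k key (T.erase U) W *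
          (-(keySign k key ((T.erase U).erase W) v) * F (insert v ((T.erase U).erase W)))) := by
      intro U hU
      rw [key1 U hU, mul_add, ← mul_assoc, keySign_insert_mul_erase hk hv hU]
      congr 1
      · ring
      · rw [Finset.mul_sum, Finset.mul_sum, Finset.mul_sum]
        refine Finset.sum_congr rfl fun W hW => ?_
        have hv' : v ∉ T.erase U := fun h => hv (Finset.mem_of_mem_erase h)
        have e1 : keySign k key (insert v (T.erase U)) W =
            -(keySign k key (T.erase U) W * keySign k key (T.erase U) v *
              keySign k key ((T.erase U).erase W) v) := by
          have := keySign_insert_mul_erase (k := k) hk hv' hW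
          have h1 := keySign_mul_self (k := k) key ((T.erase U).erase W) v
          linear_combination (keySign k key ((T.erase U).erase W) v) * this -
            (keySign k key (insert v (T.erase U)) W) * h1
        have e2 : keySign k key (insert v T) U =
            -(keySign k key T U * keySign k key T v * keySign k key (T.erase U) v) := by
          have := keySign_insert_mul_erase (k := k) hk hv hU
          have h1 := keySign_mul_self (k := k) key (T.erase U) v
          linear_combination (keySign k key (T.erase U) v) * this -
            (keySign k key (insert v T) U) * h1
        have h1 := keySign_mul_self (k := k) key (T.erase U) v
        rw [e1, e2]
        linear_combination (keySign k key T U * keySign k key T v * keySign k key (T.erase U) W *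
          keySign k key ((T.erase U).erase W) v * F (insert v ((T.erase U).erase W))) * h1
    rw [Finset.sum_congr rfl h2, Finset.sum_add_distrib, ← Finset.mul_sum, ← Finset.mul_sum]
    have h3 := ih (fun W => -(keySign k key W v) * F (insert v W))
    have h4 : ∑ U ∈ T, -keySign k key T U * ∑ W ∈ T.erase U, keySign k key (T.erase U) W *
          (-(keySign k key ((T.erase U).erase W) v) * F (insert v ((T.erase U).erase W))) = 0 := by
      rw [← neg_eq_zero, ← h3, coboundary, ← Finset.sum_neg_distrib]
      refine Finset.sum_congr rfl fun U _ => ?_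
      rw [coboundary]; ring
    rw [h4, coboundary]
    ring

/-- A finite set `T` is a simplex of the flag complex of `adj` on `S`. -/
def IsSimplex (adj : α → α → Prop) (S T : Finset α) : Prop :=
  T ⊆ S ∧ (T : Set α).Pairwise adj

/-- The reduced simplicial cochain complex of the flag complex of `adj` on `S` is exact at the
simplices with a number of vertices different from `d`. -/
def ExactOff (k : Type*) [Field k] (key : α → β) (adj : α → α → Prop) (S : Finset α) (d : ℕ) :
    Prop :=
  ∀ i ≠ d, ∀ F : Finset α → k,
    (∀ T, IsSimplex adj S T → T.card = i + 1 → coboundary key F T = 0) →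
    ∃ G : Finset α → k, ∀ T, IsSimplex adj S T → T.card = i → F T = coboundary key G T

/-- The iterated vertex decompositions which show that a flag complex has the cohomology of a
sphere of dimension `d - 1` or of a point. -/
inductive SphereLike (adj : α → α → Prop) : Finset α → ℕ → Prop
  | empty : SphereLike adj ∅ 0
  | cone {S : Finset α} {d : ℕ} (v : α) (hv : v ∈ S) (h : ∀ u ∈ S, u ≠ v → adj u v) :
      SphereLike adj S d
  | step {S L : Finset α} {d : ℕ} (v : α) (hv : v ∈ S)
      (hL : ∀ u, u ∈ L ↔ u ∈ S ∧ u ≠ v ∧ adj u v)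
      (h : SphereLike adj (S.erase v) (d + 1)) (h' : SphereLike adj L d) :
      SphereLike adj S (d + 1)

theorem IsSimplex.insert {adj : α → α → Prop} (hs : ∀ ⦃u v⦄, adj u v → adj v u) {S L T : Finset α} {v : α}
    (hv : v ∈ S) (hL : ∀ u, u ∈ L ↔ u ∈ S ∧ u ≠ v ∧ adj u v) (h : IsSimplex adj L T) :
    IsSimplex adj S (insert v T) := by
  constructor
  · intro u hu
    rcases Finset.mem_insert.1 hu with rfl | hu
    · exact hv
    · exact ((hL u).1 (h.1 hu)).1
  · rw [Finset.coe_insert]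
    refine h.2.insert fun u hu _ => ?_
    have := ((hL u).1 (h.1 hu)).2.2
    exact ⟨hs this, this⟩

theorem IsSimplex.link {adj : α → α → Prop} {S L T : Finset α} {v : α}
    (hL : ∀ u, u ∈ L ↔ u ∈ S ∧ u ≠ v ∧ adj u v) (hvT : v ∉ T)
    (h : IsSimplex adj S (Insert.insert v T)) : IsSimplex adj L T := by
  refine ⟨fun u hu => (hL u).2 ⟨h.1 (Finset.mem_insert_of_mem hu), fun h => hvT (h ▸ hu), ?_⟩,
    h.2.mono (by simp)⟩
  exact h.2 (by simp [hu]) (by simp) (fun h => hvT (h ▸ hu))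

/-- The contracting homotopy adds the apex: the primitive is `± F (insert v T)`, and zero if `v ∈
T`. On a simplex containing `v` only the face opposite to `v` contributes; on the others the cocycle
condition for `insert v T` gives the result. -/
theorem exactOff_cone {key : α → β} (hk : Function.Injective key) {adj : α → α → Prop}
    (hs : ∀ ⦃u v⦄, adj u v → adj v u)
    {S : Finset α} (d : ℕ) {v : α} (hv : v ∈ S)
    (h : ∀ u ∈ S, u ≠ v → adj u v) : ExactOff k key adj S d := by
  intro i _ F hF
  refine ⟨fun T => if v ∈ T then 0 else keySign k key T v * F (insert v T), fun T hT hi => ?_⟩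
  by_cases hvT : v ∈ T
  · obtain ⟨T', hvT', rfl⟩ : ∃ T', v ∉ T' ∧ insert v T' = T :=
      ⟨T.erase v, Finset.notMem_erase v T, Finset.insert_erase hvT⟩
    rw [coboundary_insert key _ hvT', Finset.sum_eq_zero (fun U _ => by simp), if_neg hvT',
      add_zero, ← mul_assoc, keySign_mul_self, one_mul]
  · have hT' : IsSimplex adj S (insert v T) :=
      IsSimplex.insert (L := S.filter (fun u => u ≠ v)) hs hv
        (fun u => by
          simp only [Finset.mem_filter]
          exact ⟨fun hu => ⟨hu.1, hu.2, h u hu.1 hu.2⟩, fun hu => ⟨hu.1, hu.2.1⟩⟩)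
        ⟨fun u hu => Finset.mem_filter.2 ⟨hT.1 hu, fun h => hvT (h ▸ hu)⟩, hT.2⟩
    have h0 := hF _ hT' (by rw [Finset.card_insert_of_notMem hvT, hi])
    rw [coboundary_insert key _ hvT] at h0
    have h1 : ∑ U ∈ T, keySign k key (insert v T) U * F (insert v (T.erase U)) =
        -keySign k key T v * coboundary key
          (fun T => if v ∈ T then 0 else keySign k key T v * F (insert v T)) T := by
      rw [coboundary, Finset.mul_sum]
      refine Finset.sum_congr rfl fun U hU => ?_
      rw [if_neg (fun h => hvT (Finset.mem_of_mem_erase h))]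
      have := keySign_insert_mul_erase (k := k) hk hvT hU
      have h1 := keySign_mul_self (k := k) key (T.erase U) v
      linear_combination (keySign k key (T.erase U) v * F (insert v (T.erase U))) * this -
        (keySign k key (insert v T) U * F (insert v (T.erase U))) * h1
    rw [h1] at h0
    have h2 := keySign_mul_self (k := k) key T v
    linear_combination (keySign k key T v) * h0 - (F T - coboundary key
          (fun T => if v ∈ T then 0 else keySign k key T v * F (insert v T)) T) * h2

/-- This is the long exact sequence of the pair consisting of the complex and the deletion of `v`. A
primitive on the deletion is extended by zero and its coboundary subtracted; what remains lives on
the simplices containing `v`, that is, on the link with degrees lowered by one. -/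
theorem exactOff_step {key : α → β} (hk : Function.Injective key) {adj : α → α → Prop}
    (hs : ∀ ⦃u v⦄, adj u v → adj v u)
    {S L : Finset α} {d : ℕ} {v : α} (hv : v ∈ S)
    (hL : ∀ u, u ∈ L ↔ u ∈ S ∧ u ≠ v ∧ adj u v)
    (h : ExactOff k key adj (S.erase v) (d + 1)) (h' : ExactOff k key adj L d) :
    ExactOff k key adj S (d + 1) := by
  intro i hi F hF
  obtain ⟨G₀, hG₀⟩ := h i hi F
    (fun T hT => hF T ⟨hT.1.trans (Finset.erase_subset v S), hT.2⟩)
  set G₁ : Finset α → k := fun T => if v ∈ T then 0 else G₀ T with hG₁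
  set F₁ : Finset α → k := F - coboundary key G₁ with hF₁
  have hsub : ∀ {T}, v ∉ T → IsSimplex adj S T → IsSimplex adj (S.erase v) T := fun hvT hT =>
    ⟨fun u hu => Finset.mem_erase.2 ⟨fun h => hvT (h ▸ hu), hT.1 hu⟩, hT.2⟩
  have hF₁0 : ∀ T, v ∉ T → IsSimplex adj S T → T.card = i → F₁ T = 0 := by
    intro T hvT hT hc
    rw [hF₁, Pi.sub_apply, hG₀ T (hsub hvT hT) hc, sub_eq_zero, coboundary, coboundary]
    refine Finset.sum_congr rfl fun U hU => ?_
    simp only [hG₁]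
    rw [if_neg (fun h => hvT (Finset.mem_of_mem_erase h))]
  have hdF₁ : ∀ T, IsSimplex adj S T → T.card = i + 1 → coboundary key F₁ T = 0 := by
    intro T hT hc
    rw [hF₁, coboundary_sub, hF T hT hc, coboundary_coboundary hk, sub_zero]
  suffices H : ∃ G : Finset α → k, ∀ T, IsSimplex adj S T → T.card = i →
      F₁ T = coboundary key G T by
    obtain ⟨G, hG⟩ := H
    refine ⟨G₁ + G, fun T hT hc => ?_⟩
    rw [coboundary_add, ← hG T hT hc, hF₁, Pi.sub_apply]
    ring
  rcases i with _ | j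
  -- The empty simplex does not contain `v`, so in degree zero nothing remains.
  · refine ⟨0, fun T hT hc => ?_⟩
    rw [Finset.card_eq_zero] at hc
    subst hc
    rw [hF₁0 ∅ (by simp) hT rfl, coboundary, Finset.sum_empty]
  -- The cochain on the link corresponding to `F₁`; the sign is what makes it a cocycle.
  set χ : Finset α → k := fun T => keySign k key T v * F₁ (insert v T) with hχ
  have hF₁χ : ∀ T, v ∉ T → F₁ (insert v T) = keySign k key T v * χ T := fun T _ => by
    rw [hχ]
    linear_combination (-F₁ (insert v T)) * keySign_mul_self (k := k) key T v
  have hcob : ∀ (η : Finset α → k) (T : Finset α), v ∉ T →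
      ∑ U ∈ T, keySign k key (insert v T) U * (keySign k key (T.erase U) v * η (T.erase U)) =
        -keySign k key T v * coboundary key η T := by
    intro η T hvT
    rw [coboundary, Finset.mul_sum]
    refine Finset.sum_congr rfl fun U hU => ?_
    linear_combination (η (T.erase U)) * keySign_insert_mul_erase (k := k) hk hvT hU
  have hvL : ∀ {T}, IsSimplex adj L T → v ∉ T := fun hT hvT => ((hL v).1 (hT.1 hvT)).2.1 rfl
  have hLS : ∀ {T}, IsSimplex adj L T → IsSimplex adj S T := fun hT =>
    ⟨fun u hu => ((hL u).1 (hT.1 hu)).1, hT.2⟩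
  obtain ⟨η, hη⟩ := h' j (fun h => hi (by rw [h])) χ (by
    intro T hT hc
    have hvT := hvL hT
    have h0 := hdF₁ _ (hT.insert hs hv hL) (by rw [Finset.card_insert_of_notMem hvT, hc])
    rw [coboundary_insert key _ hvT, hF₁0 T hvT (hLS hT) hc, mul_zero, zero_add,
      Finset.sum_congr rfl (fun U _ => by
        rw [hF₁χ _ (fun h => hvT (Finset.mem_of_mem_erase h))]), hcob χ T hvT] at h0
    linear_combination (-keySign k key T v) * h0 -
      (coboundary key χ T) * keySign_mul_self (k := k) key T v)
  -- The minus sign compensates for the one in `hcob`.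
  refine ⟨fun T => if v ∈ T then -(keySign k key (T.erase v) v * η (T.erase v)) else 0,
    fun T hT hc => ?_⟩
  by_cases hvT : v ∈ T
  · obtain ⟨T', hvT', rfl⟩ : ∃ T', v ∉ T' ∧ insert v T' = T :=
      ⟨T.erase v, Finset.notMem_erase v T, Finset.insert_erase hvT⟩
    have hT' := hT.link hL hvT'
    rw [Finset.card_insert_of_notMem hvT', add_left_inj] at hc
    rw [coboundary_insert key _ hvT', if_neg hvT', hF₁χ T' hvT', hη T' hT' hc]
    rw [Finset.sum_congr rfl (g := fun U => -(keySign k key (insert v T') U *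
      (keySign k key (T'.erase U) v * η (T'.erase U)))) (fun U _ => by
        rw [if_pos (Finset.mem_insert_self _ _), Finset.erase_insert
          (fun h => hvT' (Finset.mem_of_mem_erase h)), mul_neg]),
      Finset.sum_neg_distrib, hcob η T' hvT']
    ring
  · rw [hF₁0 T hvT hT hc, coboundary]
    symm
    refine Finset.sum_eq_zero fun U _ => ?_
    rw [if_neg (fun h => hvT (Finset.mem_of_mem_erase h)), mul_zero]

theorem SphereLike.exactOff {key : α → β} (hk : Function.Injective key) {adj : α → α → Prop}
    (hs : ∀ ⦃u v⦄, adj u v → adj v u)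
    {S : Finset α} {d : ℕ} (h : SphereLike adj S d) :
    ExactOff k key adj S d := by
  induction h with
  | empty =>
    intro i hi F _
    refine ⟨0, fun T hT hc => absurd ?_ hi⟩
    rw [← hc, Finset.subset_empty.1 hT.1, Finset.card_empty]
  | cone v hv h => exact exactOff_cone hk hs _ hv h
  | step v hv hL _ _ ih ih' => exact exactOff_step hk hs hv hL ih ih'

/-- Allows the combinatorics to be done with pairs of natural numbers and carried over to sets of
leaves. -/
theorem SphereLike.image {γ : Type*} [DecidableEq γ] {adj : α → α → Prop} {adj' : γ → γ → Prop}
    {S : Finset α} {d : ℕ} (h : SphereLike adj S d) (f : α → γ) (hf : Set.InjOn f S)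
    (hadj : ∀ u ∈ S, ∀ v ∈ S, adj u v ↔ adj' (f u) (f v)) : SphereLike adj' (S.image f) d := by
  induction h with
  | empty => exact .empty
  | cone v hv h =>
    refine .cone (f v) (Finset.mem_image_of_mem f hv) fun u hu hne => ?_
    obtain ⟨w, hw, rfl⟩ := Finset.mem_image.1 hu
    exact (hadj w hw v hv).1 (h w hw (fun h => hne (h ▸ rfl)))
  | @step S L d v hv hL _ _ ih ih' =>
    have hLS : L ⊆ S := fun u hu => ((hL u).1 hu).1
    refine .step (L := L.image f) (f v) (Finset.mem_image_of_mem f hv) (fun u => ?_) ?_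
      (ih' (hf.mono (by exact_mod_cast hLS)) fun u hu w hw => hadj u (hLS hu) w (hLS hw))
    · simp only [Finset.mem_image]
      constructor
      · rintro ⟨w, hw, rfl⟩
        obtain ⟨h1, h2, h3⟩ := (hL w).1 hw
        exact ⟨⟨w, h1, rfl⟩, fun h => h2 (hf h1 hv h), (hadj w h1 v hv).1 h3⟩
      · rintro ⟨⟨w, hw, rfl⟩, h2, h3⟩
        exact ⟨w, (hL w).2 ⟨hw, fun h => h2 (h ▸ rfl), (hadj w hw v hv).2 h3⟩, rfl⟩
    · have he : (S.image f).erase (f v) = (S.erase v).image f := by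
        ext u
        simp only [Finset.mem_image, Finset.mem_erase]
        constructor
        · rintro ⟨h1, w, hw, rfl⟩
          exact ⟨w, ⟨fun h => h1 (h ▸ rfl), hw⟩, rfl⟩
        · rintro ⟨w, ⟨h1, hw⟩, rfl⟩
          exact ⟨fun h => h1 (hf hw hv h), w, hw, rfl⟩
      rw [he]
      exact ih (hf.mono (by simp)) fun u hu w hw =>
        hadj u (Finset.mem_of_mem_erase hu) w (Finset.mem_of_mem_erase hw)

end FlagComplex

/-! ### Noncrossing diagonals of a polygon. -/

section Chords

/-- The chords `p` and `q` of a polygon with vertices in `ℕ` do not cross. -/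
def NonCrossing (p q : ℕ × ℕ) : Prop :=
  ¬ (p.1 < q.1 ∧ q.1 < p.2 ∧ p.2 < q.2) ∧ ¬ (q.1 < p.1 ∧ p.1 < q.2 ∧ q.2 < p.2)

open Classical in
/-- The diagonals of the polygon with vertices `C`. -/
noncomputable def chords (C : Finset ℕ) : Finset (ℕ × ℕ) :=
  (C ×ˢ C).filter fun p => p.1 < p.2 ∧ (∃ c ∈ C, p.1 < c ∧ c < p.2) ∧ ∃ c ∈ C, c < p.1 ∨ p.2 < c

theorem mem_chords {C : Finset ℕ} {p : ℕ × ℕ} : p ∈ chords C ↔ p.1 ∈ C ∧ p.2 ∈ C ∧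
    (∃ c ∈ C, p.1 < c ∧ c < p.2) ∧ ∃ c ∈ C, c < p.1 ∨ p.2 < c := by
  simp only [chords, Finset.mem_filter, Finset.mem_product, and_assoc]
  constructor
  · rintro ⟨h1, h2, -, h3⟩; exact ⟨h1, h2, h3⟩
  · rintro ⟨h1, h2, ⟨c, hc, h3, h4⟩, h5⟩; exact ⟨h1, h2, h3.trans h4, ⟨c, hc, h3, h4⟩, h5⟩

/-- Induction on the number of vertices, cutting off the ear at the third smallest vertex `c₂`. The
link of the diagonal `(c₁, c₃)` is the complex of the polygon without `c₂`. Once this diagonal is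
deleted, the other diagonals from `c₁` to later vertices are deleted one at a time, in increasing
order. Each of them has a cone as its link, and what remains is a cone with apex `(c₀, c₂)`. -/
theorem sphereLike_chords (n : ℕ) : ∀ C : Finset ℕ, C.card = n + 3 →
    SphereLike NonCrossing (chords C) n := by
  induction n with
  | zero =>
    intro C hC
    have : chords C = ∅ := by
      rw [Finset.eq_empty_iff_forall_notMem]
      rintro ⟨a, b⟩ h
      obtain ⟨ha, hb, ⟨c, hc, h1, h2⟩, d, hd, h3⟩ := mem_chords.1 h
      simp only at ha hb h1 h2 h3
      -- The two ends, a vertex between them and a vertex outside would be four elements of a set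
      -- with three.
      have : ({a, b, c, d} : Finset ℕ) ⊆ C := by
        intro x hx
        simp only [Finset.mem_insert, Finset.mem_singleton] at hx
        rcases hx with rfl | rfl | rfl | rfl <;> assumption
      have h4 := Finset.card_le_card this
      rw [Finset.card_insert_of_notMem (by simp; omega),
        Finset.card_insert_of_notMem (by simp; omega),
        Finset.card_insert_of_notMem (by simp; omega), Finset.card_singleton] at h4
      omega
    rw [this]
    exact .empty
  | succ n ih =>
    intro C hC
    -- There are `n + 4` vertices, of which the four smallest are split off one by one.
    obtain ⟨c₀, D₀, hc₀, rfl, hm₀⟩ : ∃ c D, c ∉ D ∧ insert c D = C ∧ ∀ x ∈ D, c < x := by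
      have hne : C.Nonempty := Finset.card_pos.1 (by omega)
      exact ⟨C.min' hne, C.erase (C.min' hne), Finset.notMem_erase _ _,
        Finset.insert_erase (C.min'_mem hne), fun x hx => C.min'_lt_of_mem_erase_min' hne hx⟩
    rw [Finset.card_insert_of_notMem hc₀] at hC
    obtain ⟨c₁, D₁, hc₁, rfl, hm₁⟩ : ∃ c D, c ∉ D ∧ insert c D = D₀ ∧ ∀ x ∈ D, c < x := by
      have hne : D₀.Nonempty := Finset.card_pos.1 (by omega)
      exact ⟨D₀.min' hne, D₀.erase (D₀.min' hne), Finset.notMem_erase _ _,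
        Finset.insert_erase (D₀.min'_mem hne), fun x hx => D₀.min'_lt_of_mem_erase_min' hne hx⟩
    rw [Finset.card_insert_of_notMem hc₁] at hC
    obtain ⟨c₂, D₂, hc₂, rfl, hm₂⟩ : ∃ c D, c ∉ D ∧ insert c D = D₁ ∧ ∀ x ∈ D, c < x := by
      have hne : D₁.Nonempty := Finset.card_pos.1 (by omega)
      exact ⟨D₁.min' hne, D₁.erase (D₁.min' hne), Finset.notMem_erase _ _,
        Finset.insert_erase (D₁.min'_mem hne), fun x hx => D₁.min'_lt_of_mem_erase_min' hne hx⟩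
    rw [Finset.card_insert_of_notMem hc₂] at hC
    obtain ⟨c₃, D₃, hc₃, rfl, hm₃⟩ : ∃ c D, c ∉ D ∧ insert c D = D₂ ∧ ∀ x ∈ D, c < x := by
      have hne : D₂.Nonempty := Finset.card_pos.1 (by omega)
      exact ⟨D₂.min' hne, D₂.erase (D₂.min' hne), Finset.notMem_erase _ _,
        Finset.insert_erase (D₂.min'_mem hne), fun x hx => D₂.min'_lt_of_mem_erase_min' hne hx⟩
    have h01 : c₀ < c₁ := hm₀ _ (by simp)
    have h12 : c₁ < c₂ := hm₁ _ (by simp)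
    have h23 : c₂ < c₃ := hm₂ _ (by simp)
    have h3 : ∀ x ∈ D₃, c₃ < x := hm₃
    set C := insert c₀ (insert c₁ (insert c₂ (insert c₃ D₃))) with hCdef
    have hmem : ∀ x, x ∈ C ↔ x = c₀ ∨ x = c₁ ∨ x = c₂ ∨ x = c₃ ∨ x ∈ D₃ := by
      intro x; simp [hCdef]
    have hCdef' : C.card = n + 4 := by
      rw [hCdef, Finset.card_insert_of_notMem hc₀, Finset.card_insert_of_notMem hc₁,
        Finset.card_insert_of_notMem hc₂]
      omega
    clear_value C
    have m0 : c₀ ∈ C := (hmem _).2 (by simp)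
    have m1 : c₁ ∈ C := (hmem _).2 (by simp)
    have m2 : c₂ ∈ C := (hmem _).2 (by simp)
    have m3 : c₃ ∈ C := (hmem _).2 (by simp)
    have mD : ∀ x ∈ D₃, x ∈ C := fun x hx => (hmem _).2 (by simp [hx])
    have hge : ∀ x ∈ C, x = c₀ ∨ x = c₁ ∨ x = c₂ ∨ x = c₃ ∨ (x ∈ D₃ ∧ c₃ < x) := by
      intro x hx
      rcases (hmem x).1 hx with h | h | h | h | h
      · exact Or.inl h
      · exact Or.inr (Or.inl h)
      · exact Or.inr (Or.inr (Or.inl h))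
      · exact Or.inr (Or.inr (Or.inr (Or.inl h)))
      · exact Or.inr (Or.inr (Or.inr (Or.inr ⟨h, h3 x h⟩)))
    classical
    -- These complexes are contractible, so the parameter `d` can be arbitrary.
    have claim : ∀ (D : Finset ℕ), D ⊆ D₃ → (∀ x ∈ D₃, ∀ y ∈ D, y < x → x ∈ D) → ∀ d,
        SphereLike NonCrossing ((chords C).filter fun p => p.1 = c₁ → p.2 ∈ D) (d + 1) := by
      intro D
      induction D using Finset.induction_on_min with
      | empty =>
        intro _ _ d
        -- Only diagonals with an end at `c₁` cross `(c₀, c₂)`, and none of them are left.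
        refine .cone (c₀, c₂) ?_ ?_
        · refine Finset.mem_filter.2 ⟨mem_chords.2 ⟨m0, m2, ⟨c₁, m1, h01, h12⟩, c₃, m3,
            Or.inr h23⟩, fun h => absurd h h01.ne⟩
        · rintro ⟨a, b⟩ hu _
          obtain ⟨h, h'⟩ := Finset.mem_filter.1 hu
          obtain ⟨ha, hb, ⟨c, hc, h1, h2⟩, -⟩ := mem_chords.1 h
          simp only [Finset.notMem_empty, imp_false] at h' ha hb h1 h2 ⊢
          have := hge a ha
          have := hge b hb
          constructor <;> simp only <;> omega
      | insert c D hD ihD =>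
        intro hsub hup d
        have hcD : c ∉ D := fun h => lt_irrefl _ (hD c h)
        have hc : c ∈ D₃ := hsub (Finset.mem_insert_self _ _)
        have hc3 := h3 c hc
        refine .step (L := (chords C).filter fun p => (p.1 = c₁ → p.2 ∈ D) ∧
          NonCrossing p (c₁, c)) (c₁, c) ?_ ?_ ?_ ?_
        · exact Finset.mem_filter.2 ⟨mem_chords.2 ⟨m1, mD c hc, ⟨c₂, m2, h12, by simp; omega⟩, c₀,
            m0, Or.inl h01⟩, fun _ => Finset.mem_insert_self _ _⟩
        · rintro ⟨a, b⟩
          simp only [Finset.mem_filter, Finset.mem_insert, ne_eq, Prod.mk.injEq]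
          constructor
          · rintro ⟨h1, h2, h4⟩
            refine ⟨⟨h1, fun h => Or.inr (h2 h)⟩, ?_, h4⟩
            rintro ⟨rfl, rfl⟩
            exact hcD (h2 rfl)
          · rintro ⟨⟨h1, h2⟩, h4, h5⟩
            exact ⟨h1, fun h => (h2 h).resolve_left (fun h' => h4 ⟨h, h'⟩), h5⟩
        · have he : ((chords C).filter fun p => p.1 = c₁ → p.2 ∈ insert c D).erase (c₁, c) =
              (chords C).filter fun p => p.1 = c₁ → p.2 ∈ D := by
            ext ⟨a, b⟩
            simp only [Finset.mem_erase, Finset.mem_filter, Finset.mem_insert, ne_eq,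
              Prod.mk.injEq]
            constructor
            · rintro ⟨h4, h1, h2⟩
              exact ⟨h1, fun h => (h2 h).resolve_left (fun h' => h4 ⟨h, h'⟩)⟩
            · rintro ⟨h1, h2⟩
              refine ⟨?_, h1, fun h => Or.inr (h2 h)⟩
              rintro ⟨rfl, rfl⟩
              exact hcD (h2 rfl)
          rw [he]
          refine ihD ((Finset.subset_insert _ _).trans hsub) (fun x hx y hy hxy => ?_) d
          refine (Finset.mem_insert.1 (hup x hx y (Finset.mem_insert_of_mem hy) hxy)).resolve_left ?_
          rintro rfl
          exact absurd (hD y hy) hxy.not_gt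
        -- A diagonal which crosses `(c₂, c)` but not `(c₁, c)` runs from `c₁` to a vertex strictly
        -- between `c₂` and `c`, whereas the elements of `D` exceed `c`.
        · refine .cone (c₂, c) ?_ ?_
          · exact Finset.mem_filter.2 ⟨mem_chords.2 ⟨m2, mD c hc, ⟨c₃, m3, h23, hc3⟩, c₀, m0,
              Or.inl (h01.trans h12)⟩, fun h => absurd h h12.ne', by
                constructor <;> simp⟩
          · rintro ⟨a, b⟩ hu _
            obtain ⟨h, h', h6, h7⟩ := Finset.mem_filter.1 hu
            obtain ⟨ha, hb, ⟨e, he, h1, h2⟩, -⟩ := mem_chords.1 h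
            have h8 : a = c₁ → c < b := fun h => hD b (h' h)
            simp only at ha hb h1 h2 h6 h7
            have := hge a ha
            constructor <;> simp only <;> omega
    -- When `c₂` is removed, `(c₁, c₃)` becomes a side; and every diagonal with an end at `c₂`
    -- crosses `(c₁, c₃)`.
    refine .step (L := chords (C.erase c₂)) (c₁, c₃) ?_ ?_ ?_ (ih _ ?_)
    · exact mem_chords.2 ⟨m1, m3, ⟨c₂, m2, h12, h23⟩, c₀, m0, Or.inl h01⟩
    · rintro ⟨a, b⟩
      simp only [mem_chords, Finset.mem_erase, ne_eq, Prod.mk.injEq]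
      constructor
      · rintro ⟨⟨h1, h2⟩, ⟨h4, h5⟩, ⟨e, ⟨h6, h7⟩, h8, h9⟩, f, ⟨h10, h11⟩, h12⟩
        have := hge a h2
        have := hge b h5
        have := hge e h7
        refine ⟨⟨h2, h5, ⟨e, h7, h8, h9⟩, f, h11, h12⟩, ?_, ?_, ?_⟩
        · omega
        · simp only; omega
        · simp only; omega
      · rintro ⟨⟨h2, h5, ⟨e, h7, h8, h9⟩, f, h11, h12'⟩, h4, h13, h14⟩
        simp only at h13 h14
        have := hge a h2
        have := hge b h5
        have := hge e h7
        refine ⟨⟨by omega, h2⟩, ⟨by omega, h5⟩, ?_, ?_⟩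
        -- A witness equal to `c₂` has to be replaced by another vertex on the same side of the
        -- diagonal.
        · by_cases he : e = c₂
          · by_cases ha : a = c₁
            · exact ⟨c₃, ⟨by omega, m3⟩, by omega, by omega⟩
            · exact ⟨c₁, ⟨by omega, m1⟩, by omega, by omega⟩
          · exact ⟨e, ⟨he, h7⟩, h8, h9⟩
        · by_cases hf : f = c₂
          · rcases h12' with h | h
            · exact ⟨c₀, ⟨by omega, m0⟩, Or.inl (by omega)⟩
            · exact ⟨c₃, ⟨by omega, m3⟩, Or.inr (by omega)⟩
          · exact ⟨f, ⟨hf, h11⟩, h12'⟩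
    · have he : (chords C).erase (c₁, c₃) = (chords C).filter fun p => p.1 = c₁ → p.2 ∈ D₃ := by
        ext ⟨a, b⟩
        simp only [Finset.mem_erase, Finset.mem_filter, ne_eq, Prod.mk.injEq]
        constructor
        · rintro ⟨h1, h2⟩
          refine ⟨h2, ?_⟩
          rintro rfl
          obtain ⟨ha, hb, ⟨e, he, h1, h2⟩, -⟩ := mem_chords.1 h2
          simp only at ha hb h1 h2
          have := hge e he
          rcases hge b hb with h | h | h | h | h <;> first | exact h.1 | (exfalso; omega)
        · rintro ⟨h1, h2⟩
          refine ⟨?_, h1⟩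
          rintro ⟨rfl, rfl⟩
          exact lt_irrefl _ (h3 _ (h2 rfl))
      rw [he]
      exact claim D₃ subset_rfl (fun x hx _ _ _ => hx) n
    · rw [Finset.card_erase_of_mem m2, hCdef']
      omega

end Chords

/-! ### Morphisms from presented operads to endomorphism operads. -/

namespace SymOperad

variable {k : Type u} [Field k]

/-- A morphism which kills a family of elements factors through the quotient by the ideal
which the family spans. -/
def Hom.lift {P : SymOperad.{u, v} k} {Q : SymOperad.{u, w} k} (φ : Hom P Q)
    (S : (X : Type) → [Finite X] → Set (P.obj X))
    (hS : ∀ (X : Type) [Finite X], ∀ p ∈ S X, φ.app X p = 0) :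
    Hom (P.quotient (P.idealSpan S)) Q where
  app X _ := Submodule.liftQ _ (φ.app X) (by
    -- The kernel of a morphism is an operadic ideal, so it contains the ideal spanned by `S`.
    let I : OpIdeal P :=
      { carrier := fun X _ => LinearMap.ker (φ.app X)
        map_mem := by
          intro X Y _ _ e p hp
          rw [LinearMap.mem_ker] at hp ⊢
          rw [φ.app_map, hp, map_zero]
        comp_mem_left := by
          intro X Y _ _ p q hp
          rw [LinearMap.mem_ker] at hp ⊢
          rw [φ.app_comp, hp, map_zero, LinearMap.zero_apply]
        comp_mem_right := by
          intro X Y _ _ p q hq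
          rw [LinearMap.mem_ker] at hq ⊢
          rw [φ.app_comp, hq, map_zero] }
    exact sInf_le ⟨I, fun Y _ p hp => hS Y p hp, rfl⟩)
  app_map := by
    rintro X Y _ _ e ⟨p⟩
    exact φ.app_map e p
  app_one := φ.app_one
  app_comp := by
    rintro X Y _ _ ⟨p⟩ ⟨q⟩
    exact φ.app_comp p q

end SymOperad

section TreeEval

variable {k : Type u} [Field k] {G : Type u} {V : Type v} [AddCommGroup V] [Module k V]

namespace BinTree

variable {X Y : Type}

/-- The value of a tree of binary operations. -/
def eval (op : G → V →ₗ[k] V →ₗ[k] V) : BinTree G X → (X → V) → V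
  | leaf x, a => a x
  | node g l r, a => op g (l.eval op a) (r.eval op a)

theorem eval_bind (op : G → V →ₗ[k] V →ₗ[k] V) (f : X → BinTree G Y) (t : BinTree G X)
    (a : Y → V) : (t.bind f).eval op a = t.eval op (fun x => (f x).eval op a) := by
  induction t with
  | leaf x => rfl
  | node g l r hl hr => simp only [bind, eval, hl, hr]

theorem eval_update_of_count_eq_zero [DecidableEq X] (op : G → V →ₗ[k] V →ₗ[k] V)
    (t : BinTree G X) (a : X → V) {x : X} (hx : t.count x = 0) (z : V) :
    t.eval op (Function.update a x z) = t.eval op a := by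
  induction t with
  | leaf y =>
    have : y ≠ x := by rintro rfl; simp [count] at hx
    simp [eval, Function.update_of_ne this]
  | node g l r hl hr =>
    simp only [count, Nat.add_eq_zero_iff] at hx
    simp only [eval, hl hx.1, hr hx.2]

/-- A leaf that occurs once lies in exactly one branch, on which the value depends linearly by
induction, while the other branch is constant. This makes the operation of a tree multilinear. -/
theorem eval_update [DecidableEq X] (op : G → V →ₗ[k] V →ₗ[k] V)
    (t : BinTree G X) (a : X → V) {x : X} (hx : t.count x = 1) :
    ∃ f : V →ₗ[k] V, ∀ z, t.eval op (Function.update a x z) = f z := by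
  induction t with
  | leaf y =>
    have : y = x := by
      by_contra h
      simp [count, h] at hx
    subst this
    exact ⟨LinearMap.id, fun z => by simp [eval]⟩
  | node g l r hl hr =>
    simp only [count, Nat.add_eq_one_iff] at hx
    rcases hx with ⟨h0, h1⟩ | ⟨h1, h0⟩
    · obtain ⟨f, hf⟩ := hr h1
      exact ⟨op g (l.eval op a) ∘ₗ f, fun z => by
        simp only [eval, hf, eval_update_of_count_eq_zero op l a h0, LinearMap.comp_apply]⟩
    · obtain ⟨f, hf⟩ := hl h1
      exact ⟨(op g).flip (r.eval op a) ∘ₗ f, fun z => by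
        simp only [eval, hf, eval_update_of_count_eq_zero op r a h0, LinearMap.comp_apply,
          LinearMap.flip_apply]⟩

end BinTree

/-- The multilinear operation which a tree of binary operations defines. -/
def MonoTree.eval {X : Type} (op : G → V →ₗ[k] V →ₗ[k] V) (t : MonoTree G X) :
    MultilinearMap k (fun _ : X => V) V where
  toFun := t.1.eval op
  map_update_add' := by
    intro _ a x z z'
    obtain ⟨f, hf⟩ := t.1.eval_update op a (t.2 x)
    simp only [hf, map_add]
  map_update_smul' := by
    intro _ a x c z
    obtain ⟨f, hf⟩ := t.1.eval_update op a (t.2 x)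
    simp only [hf, map_smul]

variable (k V) in
/-- The binary operation on `V` with value `op a b` at `a, b`. -/
def endBinary : (V →ₗ[k] V →ₗ[k] V) →ₗ[k] (endOperad k V).obj (Fin 2) where
  toFun op := MonoTree.eval (fun _ : PUnit.{u + 1} => op) (MonoTree.corolla PUnit.unit)
  map_add' _ _ := rfl
  map_smul' _ _ := rfl

variable (k) in
/-- The evaluation of multilinear operations at fixed arguments. -/
def endEvalAt {X : Type} [Finite X] (x : X → V) : (endOperad k V).obj X →ₗ[k] V where
  toFun p := endEval k V p x
  map_add' _ _ := rfl
  map_smul' _ _ := rfl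

theorem end_ext {X : Type} [Finite X] {p q : (endOperad k V).obj X}
    (h : ∀ x, endEvalAt k x p = endEvalAt k x q) : p = q :=
  MultilinearMap.ext h

theorem endEvalAt_map {X Y : Type} [Finite X] [Finite Y] (e : X ≃ Y) (p : (endOperad k V).obj X)
    (y : Y → V) : endEvalAt k y ((endOperad k V).map e p) = endEvalAt k (fun x => y (e x)) p := rfl

theorem endEvalAt_comp {X Y : Type} [Finite X] [Finite Y] (p : (endOperad k V).obj (Option X))
    (q : (endOperad k V).obj Y) (x : X ⊕ Y → V) :
    endEvalAt k x ((endOperad k V).comp p q) =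
      endEvalAt k (fun o : Option X => o.elim (endEvalAt k (fun y => x (Sum.inr y)) q)
        (fun a => x (Sum.inl a))) p := by
  change endEval k V p _ = endEval k V p _
  congr 1
  funext o
  rcases o with _ | a <;> rfl

variable (k) in
/-- A tree, as an element of the free operad. -/
noncomputable def MonoTree.toFree {X : Type} [Finite X] (t : MonoTree G X) :
    (freeOperad k G).obj X := Finsupp.single t (1 : k)

theorem MonoTree.map_toFree {X Y : Type} [Finite X] [Finite Y] (e : X ≃ Y) (t : MonoTree G X) :
    (freeOperad k G).map e (t.toFree k) = (t.relabel e).toFree k :=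
  Finsupp.mapDomain_single

theorem MonoTree.comp_toFree {X Y : Type} [Finite X] [Finite Y] (t : MonoTree G (Option X))
    (s : MonoTree G Y) :
    (freeOperad k G).comp (t.toFree k) (s.toFree k) = (t.graft s).toFree k :=
  (finsupp_comp_single k MonoTree.graft t s 1 1).trans (by rw [mul_one]; rfl)

theorem freeOperad_hom_ext {X : Type} [Finite X] {M : Type*} [AddCommMonoid M] [Module k M]
    {f g : (freeOperad k G).obj X →ₗ[k] M} (h : ∀ t : MonoTree G X, f (t.toFree k) = g (t.toFree k)) :
    f = g :=
  Finsupp.lhom_ext' fun t => LinearMap.ext_ring (h t)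

/-- The operation which a tree defines, as an element of the endomorphism operad. -/
def MonoTree.toEnd {X : Type} [Finite X] (op : G → V →ₗ[k] V →ₗ[k] V) (t : MonoTree G X) :
    (endOperad k V).obj X := t.eval op

theorem MonoTree.endEvalAt_toEnd {X : Type} [Finite X] (op : G → V →ₗ[k] V →ₗ[k] V)
    (t : MonoTree G X) (x : X → V) : endEvalAt k x (t.toEnd op) = t.1.eval op x := rfl

/-- The linear extension of the evaluation of trees. -/
noncomputable def freeOperadApp (op : G → V →ₗ[k] V →ₗ[k] V) (X : Type) [Finite X] :
    (freeOperad k G).obj X →ₗ[k] (endOperad k V).obj X :=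
  Finsupp.linearCombination k (MonoTree.toEnd op)

theorem freeOperadApp_toFree (op : G → V →ₗ[k] V →ₗ[k] V) {X : Type} [Finite X]
    (t : MonoTree G X) : freeOperadApp op X (t.toFree k) = t.toEnd op :=
  (Finsupp.linearCombination_single _ _ _).trans (one_smul _ _)

/-- Binary operations on `V` labelled by `G` define a morphism from the free operad on `G` to
the endomorphism operad of `V`. -/
noncomputable def freeOperadHom (op : G → V →ₗ[k] V →ₗ[k] V) :
    SymOperad.Hom (freeOperad k G) (endOperad k V) where
  app := freeOperadApp op
  app_map := by
    intro X Y _ _ e p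
    refine LinearMap.congr_fun (f := freeOperadApp op Y ∘ₗ (freeOperad k G).map e)
      (g := (endOperad k V).map e ∘ₗ freeOperadApp op X) (freeOperad_hom_ext fun t => ?_) p
    rw [LinearMap.comp_apply, LinearMap.comp_apply, MonoTree.map_toFree, freeOperadApp_toFree,
      freeOperadApp_toFree]
    exact end_ext fun x => BinTree.eval_bind op _ t.1 x
  app_one := (freeOperadApp_toFree op MonoTree.unit).trans rfl
  app_comp := by
    intro X Y _ _ p q
    refine LinearMap.congr_fun₂ (f := (freeOperad k G).comp.compr₂ (freeOperadApp op (X ⊕ Y)))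
      (g := (endOperad k V).comp.compl₁₂ (freeOperadApp op _) (freeOperadApp op Y))
      (freeOperad_hom_ext fun t => freeOperad_hom_ext fun s => ?_) p q
    rw [LinearMap.compr₂_apply, LinearMap.compl₁₂_apply, MonoTree.comp_toFree,
      freeOperadApp_toFree, freeOperadApp_toFree, freeOperadApp_toFree]
    refine end_ext fun x => ?_
    rw [endEvalAt_comp, MonoTree.endEvalAt_toEnd, MonoTree.endEvalAt_toEnd]
    refine (BinTree.eval_bind op _ t.1 x).trans ?_
    congr 1
    funext o
    rcases o with _ | a
    · exact BinTree.eval_bind op _ s.1 x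
    · rfl

theorem endEvalAt_freeOperadHom_gen (op : G → V →ₗ[k] V →ₗ[k] V) (g : G) (x : Fin 2 → V) :
    endEvalAt k x ((freeOperadHom op).app (Fin 2) (freeOperadGen k g)) = op g (x 0) (x 1) :=
  congrArg (endEvalAt k x) (freeOperadApp_toFree op (MonoTree.corolla g))

end TreeEval

section Quadratic

variable {k : Type u} [Field k]

theorem cubicEval_apply (P : SymOperad.{u, v} k) {E : Type u} [AddCommGroup E] [Module k E]
    (g : E →ₗ[k] P.obj (Fin 2)) (r : Fin 3 → E ⊗[k] E) :
    cubicEval P g r = ∑ u : Fin 3, P.map (cubicLabel u)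
      (TensorProduct.lift ((P.comp ∘ₗ P.map firstInput).compl₁₂ g g) (r u)) := by
  simp [cubicEval, LinearMap.sum_apply]

theorem cubicEval_hom {P : SymOperad.{u, v} k} {Q : SymOperad.{u, w} k} (φ : SymOperad.Hom P Q)
    {E : Type u} [AddCommGroup E] [Module k E] (g : E →ₗ[k] P.obj (Fin 2))
    (r : Fin 3 → E ⊗[k] E) :
    φ.app (Fin 3) (cubicEval P g r) = cubicEval Q (φ.app (Fin 2) ∘ₗ g) r := by
  rw [cubicEval_apply, cubicEval_apply, map_sum]
  refine Finset.sum_congr rfl fun u _ => ?_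
  rw [φ.app_map]
  congr 1
  induction r u using TensorProduct.induction_on with
  | zero => simp
  | add a b ha hb => simp only [map_add, ha, hb]
  | tmul a b =>
    simp only [TensorProduct.lift.tmul, LinearMap.compl₁₂_apply, LinearMap.comp_apply,
      φ.app_comp, φ.app_map]

/-- A shift of the summation index turns the rotation of the coefficients into a relabelling of the
inputs; hence the relations satisfied by given operations are stable under `cubicRot`. -/
theorem cubicEval_rot (P : SymOperad.{u, v} k) {E : Type u} [AddCommGroup E] [Module k E]
    (g : E →ₗ[k] P.obj (Fin 2)) (r : Fin 3 → E ⊗[k] E) :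
    cubicEval P g (cubicRot k E r) = P.map (Equiv.addRight (-1)) (cubicEval P g r) := by
  rw [cubicEval_apply, cubicEval_apply, map_sum]
  refine Fintype.sum_equiv (Equiv.addRight (1 : Fin 3)) _ _ fun u => ?_
  rw [← P.map_trans]
  congr 2
  ext s
  simp [cubicLabel]

variable {V : Type v} [AddCommGroup V] [Module k V] {E : Type u} [AddCommGroup E] [Module k E]

/-- The operation `(a, b, c) ↦ μ(ν(a, b), c)` for `μ ⊗ ν ∈ E ⊗ E`. -/
noncomputable def leftComb (op : E →ₗ[k] V →ₗ[k] V →ₗ[k] V) (a b c : V) : E ⊗[k] E →ₗ[k] V :=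
  TensorProduct.lift (LinearMap.mk₂ k (fun μ ν => op μ (op ν a b) c)
    (by simp) (by simp) (by simp) (by simp))

@[simp]
theorem leftComb_tmul (op : E →ₗ[k] V →ₗ[k] V →ₗ[k] V) (a b c : V) (μ ν : E) :
    leftComb op a b c (μ ⊗ₜ ν) = op μ (op ν a b) c := rfl

theorem endEvalAt_cubicEval (op : E →ₗ[k] V →ₗ[k] V →ₗ[k] V) (r : Fin 3 → E ⊗[k] E)
    (x : Fin 3 → V) : endEvalAt k x (cubicEval (endOperad k V) (endBinary k V ∘ₗ op) r) =
      ∑ u : Fin 3, leftComb op (x u) (x (u + 1)) (x (u + 2)) (r u) := by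
  rw [cubicEval_apply, map_sum]
  refine Finset.sum_congr rfl fun u _ => ?_
  induction r u using TensorProduct.induction_on with
  | zero => simp
  | add a b ha hb => simp only [map_add, ha, hb]
  | tmul a b =>
    rw [TensorProduct.lift.tmul, leftComb_tmul, LinearMap.compl₁₂_apply, endEvalAt_map,
      LinearMap.comp_apply, endEvalAt_comp, endEvalAt_map]
    change op a (op b (x (cubicLabel u _)) (x (cubicLabel u _))) (x (cubicLabel u _)) = _
    congr 3
    · congr 2
      simp [cubicLabel]
    · simp [cubicLabel, add_comm]
    · simp [cubicLabel, add_comm]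

/-- Modulo 3 the map `i ↦ 1 - i` exchanges 0 and 1 and fixes 2. It takes the inputs of the term `u`
to those of the term `-u`, with the two arguments of the inner operation exchanged. -/
theorem endEvalAt_cubicEval_swap (op : E →ₗ[k] V →ₗ[k] V →ₗ[k] V) (swap : E →ₗ[k] E)
    (hop : ∀ e a b, op (swap e) a b = op e b a) (r : Fin 3 → E ⊗[k] E)
    (x : Fin 3 → V) :
    endEvalAt k x (cubicEval (endOperad k V) (endBinary k V ∘ₗ op) (cubicSwap swap r)) =
      endEvalAt k (fun i => x (1 - i))
        (cubicEval (endOperad k V) (endBinary k V ∘ₗ op) r) := by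
  rw [endEvalAt_cubicEval, endEvalAt_cubicEval]
  refine Fintype.sum_equiv (Equiv.neg (Fin 3)) _ _ fun u => ?_
  have key : ∀ (a b c : V) (t : E ⊗[k] E),
      leftComb op a b c (TensorProduct.map LinearMap.id swap t) = leftComb op b a c t := by
    intro a b c t
    induction t using TensorProduct.induction_on with
    | zero => simp
    | add a b ha hb => simp only [map_add, ha, hb]
    | tmul μ ν => simp [hop]
  refine (key _ _ _ _).trans ?_
  change leftComb op _ _ _ (r (-u)) = leftComb op _ _ _ (r (-u))
  have h : ∀ u : Fin 3, 1 - -u = u + 1 ∧ 1 - (-u + 1) = u ∧ 1 - (-u + 2) = u + 2 := by decide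
  obtain ⟨h1, h2, h3⟩ := h u
  simp only [Equiv.neg_apply, h1, h2, h3]

namespace BinaryQuadraticData

variable (D : BinaryQuadraticData k)

/-- Binary operations on `V` satisfying the quadratic relations define a morphism from the
quadratic operad to the endomorphism operad of `V`. -/
noncomputable def endHom (op : D.E →ₗ[k] V →ₗ[k] V →ₗ[k] V)
    (hswap : ∀ e a b, op (D.swap e) a b = op e b a)
    (hR : ∀ r ∈ D.R, cubicEval (endOperad k V) (endBinary k V ∘ₗ op) r = 0) :
    SymOperad.Hom D.operad (endOperad k V) :=
  let φ : SymOperad.Hom D.free (endOperad k V) :=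
    (freeOperadHom (fun e => op e)).lift (fun X _ => {p | GenRel D.swap X p}) (by
      rintro X _ p (⟨a, b⟩ | ⟨c, a⟩ | a)
      · refine end_ext fun x => ?_
        simp only [map_sub, map_add, endEvalAt_freeOperadHom_gen, map_zero, LinearMap.add_apply,
          sub_self]
      · refine end_ext fun x => ?_
        simp only [map_sub, map_smul, endEvalAt_freeOperadHom_gen, map_zero, LinearMap.smul_apply,
          sub_self]
      · refine end_ext fun x => ?_
        simp only [map_sub, endEvalAt_freeOperadHom_gen, SymOperad.Hom.app_map, endEvalAt_map,
          map_zero, hswap, Equiv.swap_apply_left, Equiv.swap_apply_right, sub_self])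
  φ.lift (fun X _ => {p | D.Rel X p}) (by
    rintro X _ p ⟨r, hr⟩
    rw [cubicEval_hom]
    refine Eq.trans (congrArg (fun f => cubicEval (endOperad k V) f r) ?_) (hR r hr)
    refine LinearMap.ext fun e => ?_
    exact end_ext fun x => endEvalAt_freeOperadHom_gen (fun e => op e) e x)

theorem endEvalAt_endHom_gen (op : D.E →ₗ[k] V →ₗ[k] V →ₗ[k] V)
    (hswap : ∀ e a b, op (D.swap e) a b = op e b a)
    (hR : ∀ r ∈ D.R, cubicEval (endOperad k V) (endBinary k V ∘ₗ op) r = 0) (e : D.E)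
    (x : Fin 2 → V) :
    endEvalAt k x ((D.endHom op hswap hR).app (Fin 2) (D.gen e)) = op e (x 0) (x 1) :=
  endEvalAt_freeOperadHom_gen _ e x

end BinaryQuadraticData

end Quadratic

/-! ### Algebras over `As^(m)`. -/

section MutuallyAssociative

variable {k : Type u} [Field k] {m : ℕ} {V : Type v} [AddCommGroup V] [Module k V]

/-- The action of the generating operations of `As^(m)` on an algebra. -/
noncomputable def asOp (op : Fin m → V →ₗ[k] V →ₗ[k] V) :
    (Fin m → k) × (Fin m → k) →ₗ[k] V →ₗ[k] V →ₗ[k] V :=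
  (LinearMap.lsum k (fun _ : Fin m => k) k fun i => LinearMap.toSpanSingleton k _ (op i)).coprod
    (LinearMap.lsum k (fun _ : Fin m => k) k fun i => LinearMap.toSpanSingleton k _ (op i).flip)

theorem asOp_apply (op : Fin m → V →ₗ[k] V →ₗ[k] V) (e : (Fin m → k) × (Fin m → k)) (a b : V) :
    asOp op e a b = ∑ i, e.1 i • op i a b + ∑ i, e.2 i • op i b a := by
  simp [asOp, LinearMap.coprod_apply, LinearMap.sum_apply]

theorem asOp_starOp (op : Fin m → V →ₗ[k] V →ₗ[k] V) (i : Fin m) (a b : V) :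
    asOp op (starOp k m i) a b = op i a b := by
  simp [asOp_apply, starOp, Pi.single_apply]

theorem asOp_swap (op : Fin m → V →ₗ[k] V →ₗ[k] V) (e : (Fin m → k) × (Fin m → k)) (a b : V) :
    asOp op (starSwap k m e) a b = asOp op e b a := by
  refine (asOp_apply op _ a b).trans (Eq.trans ?_ (asOp_apply op _ b a).symm)
  exact add_comm _ _

variable (k m) in
/-- The relations of `As^(m)`. -/
noncomputable def asRel :
    Submodule k (Fin 3 → ((Fin m → k) × (Fin m → k)) ⊗[k] ((Fin m → k) × (Fin m → k))) :=
  (asData k m).R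

theorem asRel_le
    {M : Submodule k (Fin 3 → ((Fin m → k) × (Fin m → k)) ⊗[k] ((Fin m → k) × (Fin m → k)))}
    (h : ∀ i j, starRel k m i j ∈ M) (hrot : ∀ r ∈ M, cubicRot k _ r ∈ M)
    (hswap : ∀ r ∈ M, cubicSwap (starSwap k m) r ∈ M) : asRel k m ≤ M :=
  sInf_le ⟨h, hrot, hswap⟩

theorem starRel_mem (i j : Fin m) : starRel k m i j ∈ asRel k m :=
  Submodule.mem_sInf.2 fun _ hM => hM.1 i j

/-- The relations that hold in `V` form a subspace stable under rotation and swap, so only the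
generating relations `starRel i j` need to be evaluated. -/
theorem cubicEval_asOp (op : Fin m → V →ₗ[k] V →ₗ[k] V)
    (hop : ∀ i j a b c, op i a (op j b c) = op j (op i a b) c) :
    ∀ r ∈ asRel k m, cubicEval (endOperad k V) (endBinary k V ∘ₗ asOp op) r = 0 := by
  let M := LinearMap.ker (cubicEval (endOperad k V) (endBinary k V ∘ₗ asOp (k := k) op))
  refine asRel_le (M := M) ?_ ?_ ?_
  · intro i j
    rw [LinearMap.mem_ker]
    refine end_ext fun x => ?_
    rw [endEvalAt_cubicEval, Fin.sum_univ_three, map_zero]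
    have h1 := leftComb_tmul (asOp op) (x 0) (x (0 + 1)) (x (0 + 2)) (starOp k m j) (starOp k m i)
    have h2 := leftComb_tmul (asOp op) (x 1) (x (1 + 1)) (x (1 + 2))
      (starSwap k m (starOp k m i)) (starOp k m j)
    rw [asOp_swap] at h2
    rw [asOp_starOp, asOp_starOp] at h1 h2
    have h3 : leftComb (asOp op) (x 0) (x (0 + 1)) (x (0 + 2)) (starRel k m i j 0) = 
      - op j (op i (x 0) (x 1)) (x 2) := (map_neg _ _).trans (congrArg Neg.neg h1)
    have h4 : leftComb (asOp op) (x 1) (x (1 + 1)) (x (1 + 2)) (starRel k m i j 1) = 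
      op i (x 0) (op j (x 1) (x 2)) := h2
    have h5 : leftComb (asOp op) (x 2) (x (2 + 1)) (x (2 + 2)) (starRel k m i j 2) = 0 :=
      map_zero _
    rw [h3, h4, h5, hop]
    simp
  · intro r hr
    rw [LinearMap.mem_ker] at hr ⊢
    exact (cubicEval_rot _ _ _).trans (by rw [hr, map_zero])
  · intro r hr
    rw [LinearMap.mem_ker] at hr ⊢
    refine end_ext fun x => ?_
    refine (endEvalAt_cubicEval_swap (asOp op) _ (asOp_swap op) r x).trans ?_
    rw [hr, map_zero, map_zero]

/-- Mutually associative operations on `V` define a morphism from `As^(m)` to the endomorphism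
operad of `V`. -/
noncomputable def asHom (op : Fin m → V →ₗ[k] V →ₗ[k] V)
    (hop : ∀ i j a b c, op i a (op j b c) = op j (op i a b) c) :
    SymOperad.Hom (asData k m).operad (endOperad k V) :=
  (asData k m).endHom (asOp op) (asOp_swap op) (cubicEval_asOp op hop)

theorem endEvalAt_asHom_gen (op : Fin m → V →ₗ[k] V →ₗ[k] V)
    (hop : ∀ i j a b c, op i a (op j b c) = op j (op i a b) c) (i : Fin m) (x : Fin 2 → V) :
    endEvalAt k x ((asHom op hop).app (Fin 2) ((asData k m).gen (starOp k m i))) =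
      op i (x 0) (x 1) :=
  ((asData k m).endEvalAt_endHom_gen _ _ _ _ x).trans (asOp_starOp op i _ _)

theorem isAsAlgebra_of_mutuallyAssociative (op : Fin m → V →ₗ[k] V →ₗ[k] V)
    (hop : ∀ i j a b c, op i a (op j b c) = op j (op i a b) c) : IsAsAlgebra k m V op :=
  ⟨asHom op hop, fun i a b => endEvalAt_asHom_gen op hop i ![a, b]⟩

end MutuallyAssociative

/-! ### Labelled words and the free algebra. -/

/-- The words `x₁ i₁ x₂ i₂ … xₙ` in letters `X`, with a label in `Fin m` between any two adjacent
letters. -/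
abbrev LWord (m : ℕ) (X : Type) : Type := List (X × Fin m) × X

namespace LWord

variable {m : ℕ} {X Y Z : Type}

/-- Concatenation with the label `i` in between. -/
def mul (i : Fin m) (v w : LWord m X) : LWord m X := (v.1 ++ (v.2, i) :: w.1, w.2)

/-- Both sides are the concatenation `u i v j w`. -/
theorem mul_assoc (i j : Fin m) (u v w : LWord m X) :
    mul i u (mul j v w) = mul j (mul i u v) w := by
  simp [mul]

/-- The list of the letters of a word. -/
def letters (w : LWord m X) : List X := w.1.map Prod.fst ++ [w.2]

/-- The value of a word in a set with binary operations. -/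
def eval {S : Type*} (op : Fin m → S → S → S) (x : X → S) : LWord m X → S
  | ([], y) => x y
  | ((a, i) :: L, y) => op i (x a) (eval op x (L, y))
  termination_by w => w.1.length

@[simp] theorem eval_nil {S : Type*} (op : Fin m → S → S → S) (x : X → S) (y : X) :
    eval op x ([], y) = x y := by rw [eval]

@[simp] theorem eval_cons {S : Type*} (op : Fin m → S → S → S) (x : X → S) (a : X) (i : Fin m)
    (L : List (X × Fin m)) (y : X) :
    eval op x ((a, i) :: L, y) = op i (x a) (eval op x (L, y)) := by rw [eval]

theorem induction {motive : LWord m X → Prop} (nil : ∀ y, motive ([], y))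
    (cons : ∀ a i L y, motive (L, y) → motive ((a, i) :: L, y)) (w : LWord m X) : motive w := by
  obtain ⟨L, y⟩ := w
  induction L with
  | nil => exact nil y
  | cons p L ih => exact cons p.1 p.2 L y ih

/-- Substitution of words for the letters of a word. -/
def bind (f : X → LWord m Y) (w : LWord m X) : LWord m Y := eval mul f w

theorem letters_mul (i : Fin m) (v w : LWord m X) :
    (mul i v w).letters = v.letters ++ w.letters := by
  simp [mul, letters]

theorem letters_bind (f : X → LWord m Y) (w : LWord m X) :
    (w.bind f).letters = w.letters.flatMap (fun x => (f x).letters) := by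
  induction w using LWord.induction with
  | nil y => simp [bind, letters]
  | cons a i L y ih =>
    rw [bind, eval_cons, letters_mul, ← bind, ih]
    simp [letters]

/-- A label inside a substituted word stays in its place, and a label after the letter `x` now
follows the last letter of `f x`. For this reason blocks of letters are later ranked by their last
letter. -/
theorem mem_fst_bind (f : X → LWord m Y) (w : LWord m X) (y : Y) (i : Fin m) :
    (y, i) ∈ (w.bind f).1 ↔
      (∃ x ∈ w.letters, (y, i) ∈ (f x).1) ∨ ∃ x, (x, i) ∈ w.1 ∧ y = (f x).2 := by
  induction w using LWord.induction with
  | nil y => simp [bind, letters]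
  | cons a j L z ih =>
    have : ((y, i) ∈ (bind f (((a, j) :: L), z)).1) ↔
        (y, i) ∈ (f a).1 ∨ (y, i) = ((f a).2, j) ∨ (y, i) ∈ (bind f (L, z)).1 := by
      rw [bind, eval_cons, ← bind]
      simp only [mul, List.mem_append, List.mem_cons]
    rw [this, ih]
    simp only [letters, List.map_cons, List.cons_append, List.mem_cons, Prod.mk.injEq]
    constructor
    · rintro (h | ⟨rfl, rfl⟩ | ⟨x, h, h'⟩ | ⟨x, h, h'⟩)
      · exact Or.inl ⟨a, Or.inl rfl, h⟩
      · exact Or.inr ⟨a, Or.inl ⟨rfl, rfl⟩, rfl⟩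
      · exact Or.inl ⟨x, Or.inr h, h'⟩
      · exact Or.inr ⟨x, Or.inr h, h'⟩
    · rintro (⟨x, rfl | h, h'⟩ | ⟨x, ⟨rfl, rfl⟩ | h, h'⟩)
      · exact Or.inl h'
      · exact Or.inr (Or.inr (Or.inl ⟨x, h, h'⟩))
      · exact Or.inr (Or.inl ⟨h', rfl⟩)
      · exact Or.inr (Or.inr (Or.inr ⟨x, h, h'⟩))

/-- Renaming of letters. -/
def map (f : X → Y) (w : LWord m X) : LWord m Y := (w.1.map (fun p => (f p.1, p.2)), f w.2)

theorem letters_map (f : X → Y) (w : LWord m X) : (w.map f).letters = w.letters.map f := by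
  simp [letters, map, Function.comp_def]

theorem bind_letter (f : X → Y) (w : LWord m X) :
    w.bind (fun x => (([], f x) : LWord m Y)) = w.map f := by
  induction w using LWord.induction with
  | nil y => simp [bind, map]
  | cons a i L y ih => rw [bind, eval_cons, ← bind, ih]; simp [mul, map]

section FreeAlgebra

variable (k : Type u) [Field k]

/-- The operations of the free `As^(m)`-algebra, which has the words as a basis. -/
noncomputable def freeOp (i : Fin m) :
    (LWord m X →₀ k) →ₗ[k] (LWord m X →₀ k) →ₗ[k] (LWord m X →₀ k) :=
  Finsupp.linearCombination k (fun t => Finsupp.lmapDomain k k (mul i t))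

theorem freeOp_single (i : Fin m) (v w : LWord m X) :
    freeOp k i (Finsupp.single v 1) (Finsupp.single w 1) = Finsupp.single (mul i v w) 1 := by
  rw [freeOp, finsupp_comp_single, mul_one]

theorem freeOp_assoc (i j : Fin m) (a b c : LWord m X →₀ k) :
    freeOp k i a (freeOp k j b c) = freeOp k j (freeOp k i a b) c := by
  induction a using Finsupp.induction_linear with
  | zero => simp
  | add p p' h h' => simp only [map_add, LinearMap.add_apply, h, h']
  | single t x =>
  induction b using Finsupp.induction_linear with
  | zero => simp
  | add p p' h h' => simp only [map_add, LinearMap.add_apply, h, h']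
  | single s y =>
  induction c using Finsupp.induction_linear with
  | zero => simp
  | add p p' h h' => simp only [map_add, h, h']
  | single r z =>
    simp only [freeOp, finsupp_comp_single, LWord.mul_assoc, _root_.mul_assoc]

theorem eval_freeOp (f : X → LWord m Y) (w : LWord m X) :
    eval (fun i a b => freeOp k i a b) (fun x => Finsupp.single (f x) (1 : k)) w =
      Finsupp.single (w.bind f) 1 := by
  induction w using LWord.induction with
  | nil y => simp [bind]
  | cons a i L y ih => rw [bind, eval_cons, eval_cons, ih, freeOp_single, bind]

end FreeAlgebra

section Trees

variable (k : Type u) [Field k]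

/-- The right comb with leaves the letters of a word. -/
noncomputable def tree : LWord m X → BinTree ((Fin m → k) × (Fin m → k)) X :=
  eval (fun i => BinTree.node (starOp k m i)) BinTree.leaf

theorem tree_nil (y : X) : tree k (([], y) : LWord m X) = BinTree.leaf y := eval_nil _ _ _

theorem tree_cons (a : X) (i : Fin m) (L : List (X × Fin m)) (y : X) :
    tree k ((a, i) :: L, y) = BinTree.node (starOp k m i) (BinTree.leaf a) (tree k (L, y)) :=
  eval_cons _ _ _ _ _ _

theorem tree_map (f : X → Y) (w : LWord m X) : tree k (w.map f) = (tree k w).relabel f := by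
  induction w using LWord.induction with
  | nil y => simp [map, tree_nil, BinTree.relabel, BinTree.bind]
  | cons a i L y ih =>
    rw [tree_cons]
    simp only [map, List.map_cons, tree_cons, BinTree.relabel, BinTree.bind] at *
    rw [ih]

open Classical in
theorem count_tree (w : LWord m X) (x : X) : (tree k w).count x = w.letters.count x := by
  induction w using LWord.induction with
  | nil y => simp [tree_nil, BinTree.count, letters, List.count_cons]
  | cons a i L y ih =>
    rw [tree_cons, BinTree.count, ih]
    simp only [letters, BinTree.count, List.map_cons, List.cons_append, List.count_cons, beq_iff_eq]
    ring

/-- Every letter occurs exactly once in the word. -/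
def IsMono (w : LWord m X) : Prop := w.letters.Nodup ∧ ∀ x, x ∈ w.letters

theorem isMono_iff (w : LWord m X) : w.IsMono ↔ ∀ x, (tree k w).count x = 1 := by
  classical
  simp only [count_tree, IsMono]
  constructor
  · rintro ⟨h, h'⟩ x
    convert List.count_eq_one_of_mem h (h' x)
  · intro h
    refine ⟨List.nodup_iff_count_le_one.2 fun x => ?_, fun x => List.count_pos_iff.1 ?_⟩
    · convert (h x).le
    · have := h x
      rw [List.count] at *
      convert Nat.one_pos

theorem eval_tree {V : Type v} [AddCommGroup V] [Module k V] (op : Fin m → V →ₗ[k] V →ₗ[k] V)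
    (w : LWord m X) (x : X → V) :
    (tree k w).eval (fun e => asOp op e) x = eval (fun i a b => op i a b) x w := by
  induction w using LWord.induction with
  | nil y => simp [tree_nil, BinTree.eval]
  | cons a i L y ih => rw [tree_cons, BinTree.eval, ih, eval_cons, asOp_starOp]; rfl

end Trees

end LWord

/-! ### Branches of trees as relabelled trees. -/

namespace BinTree

variable {G : Type u} {X Y : Type}

theorem exists_of_count_relabel_ne_zero (f : X → Y) (t : BinTree G X) {y : Y}
    (h : (t.relabel f).count y ≠ 0) : ∃ x, f x = y := by
  induction t with
  | leaf x =>
    refine ⟨x, ?_⟩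
    by_contra hne
    exact h (by simp [relabel, bind, count, hne])
  | node g l r hl hr =>
    simp only [relabel, bind, count] at h hl hr
    by_cases h0 : (l.relabel f).count y = 0
    · exact hr fun h1 => h (by simp only [relabel] at h0; rw [h0, h1])
    · exact hl h0

theorem count_add_count_le (f : X → Y) (t : BinTree G X) {x x' : X} (hne : x ≠ x')
    (h : f x = f x') : t.count x + t.count x' ≤ (t.relabel f).count (f x) := by
  induction t with
  | leaf z =>
    by_cases h1 : z = x
    · subst h1; simp [relabel, bind, count, hne]
    · by_cases h2 : z = x'
      · subst h2; simp [relabel, bind, count, h, h1]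
      · simp [count, h1, h2]
  | node g l r hl hr => simp only [relabel, bind, count] at *; omega

theorem relabel_relabel {Z : Type} (f : X → Y) (g : Y → Z) (t : BinTree G X) :
    (t.relabel f).relabel g = t.relabel (fun x => g (f x)) := bind_bind _ _ _

theorem relabel_node (f : X → Y) (g : G) (l r : BinTree G X) :
    (node g l r).relabel f = node g (l.relabel f) (r.relabel f) := rfl

theorem relabel_id (t : BinTree G X) : t.relabel (fun x => x) = t := bind_leaf t

end BinTree

namespace MonoTree

variable {G : Type u} {X Y Z : Type}

/-- All labels are counted once on both sides: two inputs with the same image would be counted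
twice, and a label outside the image not at all. -/
theorem bijective_of_relabel (t : MonoTree G X) (s : MonoTree G Y) (f : X → Y)
    (h : t.1.relabel f = s.1) : Function.Bijective f := by
  constructor
  · intro x x' hx
    by_contra hne
    have := t.1.count_add_count_le f hne hx
    rw [t.2, t.2, h, s.2] at this
    omega
  · intro y
    refine t.1.exists_of_count_relabel_ne_zero f ?_
    rw [h, s.2]
    exact one_ne_zero

theorem eq_relabel (t : MonoTree G X) (s : MonoTree G Y) (f : X → Y) (hf : Function.Bijective f)
    (h : t.1.relabel f = s.1) : s = t.relabel (Equiv.ofBijective f hf) :=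
  Subtype.ext h.symm

/-- The tree with root `g`, left branch `l` and right branch `r`. -/
def node (g : G) (l : MonoTree G X) (r : MonoTree G Y) : MonoTree G (X ⊕ Y) :=
  ⟨BinTree.node g (l.1.relabel Sum.inl) (r.1.relabel Sum.inr), by
    rintro (x | y)
    · have h := (l.1.relabel (Sum.inl : X → X ⊕ Y)).count_relabel (Equiv.sumComm X Y) (Sum.inr x)
      rw [BinTree.relabel_relabel] at h
      change _ = (l.1.relabel Sum.inl).count (Sum.inl x) at h
      rw [BinTree.count, ← h, BinTree.count_relabel_inl]
      exact ((l.1.count_relabel_inr x).trans (l.2 x))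
    · have h := (l.1.relabel (Sum.inl : X → X ⊕ Y)).count_relabel (Equiv.sumComm X Y) (Sum.inl y)
      rw [BinTree.relabel_relabel] at h
      change _ = (l.1.relabel Sum.inl).count (Sum.inr y) at h
      rw [BinTree.count, ← h, BinTree.count_relabel_inr, r.2]
      exact congrArg (· + 1) (l.1.count_relabel_inl y)⟩

/-- The branches of a tree with bijectively labelled leaves use only some of the labels. Inductions
over trees therefore give each branch its own set of leaves, together with a relabelling. -/
theorem exists_relabel_eq (t : BinTree G X) :
    ∃ (Y : Type) (_ : Finite Y) (s : MonoTree G Y) (f : Y → X), s.1.relabel f = t := by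
  induction t with
  | leaf x => exact ⟨Unit, inferInstance, MonoTree.unit, fun _ => x, rfl⟩
  | node g l r hl hr =>
    obtain ⟨Y, _, s, f, rfl⟩ := hl
    obtain ⟨Y', _, s', f', rfl⟩ := hr
    refine ⟨Y ⊕ Y', inferInstance, s.node g s', Sum.elim f f', ?_⟩
    change BinTree.node g ((s.1.relabel Sum.inl).relabel _) ((s'.1.relabel Sum.inr).relabel _) = _
    rw [BinTree.relabel_relabel, BinTree.relabel_relabel]
    rfl

end MonoTree

/-! ### The basis of words of the operad `As^(m)`. -/

section AsOperad

variable (k : Type u) [Field k] (m : ℕ)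

/-- The labels of the vertices of the trees which present `As^(m)`. -/
abbrev AsLabel : Type u := (Fin m → k) × (Fin m → k)

/-- The operad `As^(m)`. -/
noncomputable abbrev asOperad : SymOperad.{u, u} k := (asData k m).operad

variable {k m} {X Y Z : Type}

/-- The class of a tree in the operad `As^(m)`. -/
noncomputable def treeClass [Finite X] (t : MonoTree (AsLabel k m) X) : (asOperad k m).obj X :=
  (asData k m).free.quotientMk (asData k m).relIdeal X
    ((freeOperad k (asData k m).E).quotientMk (asData k m).genIdeal X (t.toFree k))

theorem map_treeClass [Finite X] [Finite Y] (e : X ≃ Y) (t : MonoTree (AsLabel k m) X) :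
    (asOperad k m).map e (treeClass t) = treeClass (t.relabel e) :=
  congrArg (fun z => (asData k m).free.quotientMk (asData k m).relIdeal Y
    ((freeOperad k (asData k m).E).quotientMk (asData k m).genIdeal Y z)) (t.map_toFree e)

theorem comp_treeClass [Finite X] [Finite Y] (t : MonoTree (AsLabel k m) (Option X))
    (s : MonoTree (AsLabel k m) Y) :
    (asOperad k m).comp (treeClass t) (treeClass s) = treeClass (t.graft s) :=
  congrArg (fun z => (asData k m).free.quotientMk (asData k m).relIdeal (X ⊕ Y)
    ((freeOperad k (asData k m).E).quotientMk (asData k m).genIdeal (X ⊕ Y) z)) (t.comp_toFree s)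

theorem gen_eq_treeClass (e : AsLabel k m) :
    (asData k m).gen e = treeClass (MonoTree.corolla e) := rfl

theorem endEvalAt_asHom_treeClass {V : Type v} [AddCommGroup V] [Module k V]
    (op : Fin m → V →ₗ[k] V →ₗ[k] V)
    (hop : ∀ i j a b c, op i a (op j b c) = op j (op i a b) c) [Finite X]
    (t : MonoTree (AsLabel k m) X) (x : X → V) :
    endEvalAt k x ((asHom op hop).app X (treeClass t)) = t.1.eval (fun e => asOp op e) x :=
  congrArg (endEvalAt k x) (freeOperadApp_toFree (fun e => asOp op e) t)

theorem span_treeClass [Finite X] :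
    Submodule.span k (Set.range (treeClass : MonoTree (AsLabel k m) X → _)) = ⊤ := by
  rw [eq_top_iff]
  intro p _
  obtain ⟨p, rfl⟩ := Submodule.mkQ_surjective _ p
  obtain ⟨p, rfl⟩ := Submodule.mkQ_surjective _ p
  let q : (freeOperad k (asData k m).E).obj X →ₗ[k] (asOperad k m).obj X :=
    (asData k m).free.quotientMk (asData k m).relIdeal X ∘ₗ
      (freeOperad k (asData k m).E).quotientMk (asData k m).genIdeal X
  change q p ∈ _
  have : (Submodule.mkQ (Submodule.span k (Set.range
      (treeClass : MonoTree (AsLabel k m) X → (asOperad k m).obj X)))) ∘ₗ q = 0 := by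
    refine freeOperad_hom_ext fun t => ?_
    exact (Submodule.Quotient.mk_eq_zero _).2 (Submodule.subset_span ⟨t, rfl⟩)
  exact (Submodule.Quotient.mk_eq_zero _).1 (LinearMap.congr_fun this p)

/-- The binary composite `g(p, q)`. -/
noncomputable def binComp [Finite X] [Finite Y] (g : (asOperad k m).obj (Fin 2))
    (p : (asOperad k m).obj X) (q : (asOperad k m).obj Y) : (asOperad k m).obj (X ⊕ Y) :=
  (asOperad k m).comp ((asOperad k m).map
    ((Equiv.sumComm Unit X).trans (Equiv.optionEquivSumPUnit X).symm)
      ((asOperad k m).comp ((asOperad k m).map firstInput g) p)) q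

theorem binComp_treeClass [Finite X] [Finite Y] (e : AsLabel k m) (s : MonoTree (AsLabel k m) X)
    (t : MonoTree (AsLabel k m) Y) :
    binComp ((asData k m).gen e) (treeClass s) (treeClass t) = treeClass (s.node e t) := by
  rw [binComp, gen_eq_treeClass, map_treeClass, comp_treeClass, map_treeClass, comp_treeClass]
  congr 1
  apply Subtype.ext
  change BinTree.node e (((s.1.relabel Sum.inr).relabel _).bind _) _ = 
    BinTree.node e (s.1.relabel Sum.inl) (t.1.relabel Sum.inr)
  congr 1
  rw [BinTree.relabel_relabel, BinTree.relabel, BinTree.bind_bind]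
  rfl

theorem binComp_add₁ [Finite X] [Finite Y] (g g' : (asOperad k m).obj (Fin 2))
    (p : (asOperad k m).obj X) (q : (asOperad k m).obj Y) :
    binComp (g + g') p q = binComp g p q + binComp g' p q := by
  simp only [binComp, map_add, LinearMap.add_apply]

theorem binComp_smul₁ [Finite X] [Finite Y] (c : k) (g : (asOperad k m).obj (Fin 2))
    (p : (asOperad k m).obj X) (q : (asOperad k m).obj Y) :
    binComp (c • g) p q = c • binComp g p q := by
  simp only [binComp, map_smul, LinearMap.smul_apply]

theorem binComp_add₂ [Finite X] [Finite Y] (g : (asOperad k m).obj (Fin 2))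
    (p p' : (asOperad k m).obj X) (q : (asOperad k m).obj Y) :
    binComp g (p + p') q = binComp g p q + binComp g p' q := by
  simp only [binComp, map_add, LinearMap.add_apply]

theorem binComp_smul₂ [Finite X] [Finite Y] (c : k) (g : (asOperad k m).obj (Fin 2))
    (p : (asOperad k m).obj X) (q : (asOperad k m).obj Y) :
    binComp g (c • p) q = c • binComp g p q := by
  simp only [binComp, map_smul, LinearMap.smul_apply]

variable (k m X Y) in
/-- The binary composite, as a trilinear map. -/
noncomputable def binCompL [Finite X] [Finite Y] : AsLabel k m →ₗ[k] (asOperad k m).obj X →ₗ[k]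
    (asOperad k m).obj Y →ₗ[k] (asOperad k m).obj (X ⊕ Y) where
  toFun e := LinearMap.mk₂ k (binComp ((asData k m).gen e))
    (binComp_add₂ _) (fun c p q => binComp_smul₂ c _ p q) (fun _ _ _ => map_add _ _ _)
    (fun _ _ _ => map_smul _ _ _)
  map_add' e e' := LinearMap.ext₂ fun p q =>
    (congrArg (fun g => binComp g p q) (map_add (asData k m).gen e e')).trans (binComp_add₁ _ _ p q)
  map_smul' c e := LinearMap.ext₂ fun p q =>
    (congrArg (fun g => binComp g p q) (map_smul (asData k m).gen c e)).trans
      (binComp_smul₁ c _ p q)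

theorem binCompL_treeClass [Finite X] [Finite Y] (e : AsLabel k m) (s : MonoTree (AsLabel k m) X)
    (t : MonoTree (AsLabel k m) Y) :
    binCompL k m X Y e (treeClass s) (treeClass t) = treeClass (s.node e t) :=
  binComp_treeClass e s t

theorem cubicEval_gen (D : BinaryQuadraticData k) {r : Fin 3 → D.E ⊗[k] D.E} (hr : r ∈ D.R) :
    cubicEval D.operad D.gen r = 0 := by
  let φ : SymOperad.Hom D.free D.operad :=
    { app := fun X _ => D.free.quotientMk D.relIdeal X
      app_map := fun _ _ => rfl
      app_one := rfl
      app_comp := fun _ _ => rfl }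
  refine (cubicEval_hom φ D.freeGen r).symm.trans ?_
  exact (Submodule.Quotient.mk_eq_zero _).2
    (D.free.subset_idealSpan (fun X _ => {p | D.Rel X p}) (Fin 3) (BinaryQuadraticData.Rel.mk r hr))

theorem gen_swap (D : BinaryQuadraticData k) (e : D.E) :
    D.gen (D.swap e) = D.operad.map (Equiv.swap 0 1) (D.gen e) :=
  congrArg (D.free.quotientMk D.relIdeal (Fin 2)) ((Submodule.Quotient.eq _).2
      ((freeOperad k D.E).subset_idealSpan _ (Fin 2) (GenRel.swap e)))

/-- The tree `(x₀ ⋆ᵢ x₁) ⋆ⱼ x₂`. -/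
def leftTree {G : Type u} (a b : G) : MonoTree G (Fin 3) :=
  ⟨.node b (.node a (.leaf 0) (.leaf 1)) (.leaf 2), fun x => by
    fin_cases x <;> simp [BinTree.count]⟩

/-- The tree `x₀ ⋆ᵢ (x₁ ⋆ⱼ x₂)`. -/
def rightTree {G : Type u} (a b : G) : MonoTree G (Fin 3) :=
  ⟨.node a (.leaf 0) (.node b (.leaf 1) (.leaf 2)), fun x => by
    fin_cases x <;> simp [BinTree.count]⟩

/-- The two nonzero components of `starRel i j` evaluate to the two bracketings, the second one by
way of the transposition of `⋆ᵢ`. -/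
theorem treeClass_leftTree (i j : Fin m) :
    treeClass (leftTree (starOp k m i) (starOp k m j)) =
      treeClass (rightTree (starOp k m i) (starOp k m j)) := by
  have h := (cubicEval_apply (asData k m).operad (asData k m).gen (starRel k m i j)).symm.trans
    (cubicEval_gen (asData k m) (starRel_mem i j))
  rw [Fin.sum_univ_three] at h
  have h0 : (asOperad k m).map (cubicLabel 0) (TensorProduct.lift
      (((asOperad k m).comp ∘ₗ (asOperad k m).map firstInput).compl₁₂ (asData k m).gen
        (asData k m).gen) (starRel k m i j 0)) =
      -treeClass (leftTree (starOp k m i) (starOp k m j)) := by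
    have : (asOperad k m).map (cubicLabel 0) ((asOperad k m).comp ((asOperad k m).map firstInput
        ((asData k m).gen (starOp k m j))) ((asData k m).gen (starOp k m i))) =
        treeClass (leftTree (starOp k m i) (starOp k m j)) := by
      rw [gen_eq_treeClass, gen_eq_treeClass, map_treeClass, comp_treeClass, map_treeClass]
      rfl
    rw [← this]
    refine (congrArg _ (map_neg _ _)).trans ?_
    rw [map_neg]
    rfl
  have h1 : (asOperad k m).map (cubicLabel 1) (TensorProduct.lift
      (((asOperad k m).comp ∘ₗ (asOperad k m).map firstInput).compl₁₂ (asData k m).gen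
        (asData k m).gen) (starRel k m i j 1)) =
      treeClass (rightTree (starOp k m i) (starOp k m j)) := by
    have : (asOperad k m).map (cubicLabel 1) ((asOperad k m).comp ((asOperad k m).map firstInput
        ((asData k m).gen ((asData k m).swap (starOp k m i)))) ((asData k m).gen (starOp k m j))) =
        treeClass (rightTree (starOp k m i) (starOp k m j)) := by
      refine (congrArg (fun g => (asOperad k m).map (cubicLabel 1) ((asOperad k m).comp
        ((asOperad k m).map firstInput g) ((asData k m).gen (starOp k m j))))
          (gen_swap (asData k m) (starOp k m i))).trans ?_
      rw [gen_eq_treeClass, gen_eq_treeClass, map_treeClass, map_treeClass,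
        comp_treeClass, map_treeClass]
      rfl
    rw [← this]
    rfl
  have h2 : (asOperad k m).map (cubicLabel 2) (TensorProduct.lift
      (((asOperad k m).comp ∘ₗ (asOperad k m).map firstInput).compl₁₂ (asData k m).gen
        (asData k m).gen) (starRel k m i j 2)) = 0 := by
    refine (congrArg _ (map_zero _)).trans (map_zero _)
  have h3 := congrArg₂ (· + ·) (congrArg₂ (· + ·) h0 h1) h2
  have h4 := h3.symm.trans h
  simp only [add_zero] at h4
  exact (neg_add_eq_zero.1 h4)

/-- The labelling of the inputs of a ternary operation in which the inputs `0` and `1` are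
plugged first. -/
def ternaryInput : Fin 3 ≃ Option (Option Unit) where
  toFun := ![none, some none, some (some ())]
  invFun
    | none => 0
    | some none => 1
    | some (some _) => 2
  left_inv := by intro i; fin_cases i <;> rfl
  right_inv := by rintro (_ | _ | _) <;> rfl

/-- The ternary composite. -/
noncomputable def ternComp [Finite X] [Finite Y] [Finite Z] (g : (asOperad k m).obj (Fin 3))
    (p : (asOperad k m).obj X) (q : (asOperad k m).obj Y) (r : (asOperad k m).obj Z) :
    (asOperad k m).obj ((X ⊕ Y) ⊕ Z) :=
  (asOperad k m).comp ((asOperad k m).map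
    ((Equiv.sumAssoc Unit X Y).trans
      ((Equiv.sumComm Unit (X ⊕ Y)).trans (Equiv.optionEquivSumPUnit (X ⊕ Y)).symm))
    ((asOperad k m).comp ((asOperad k m).map (optionSumEquiv Unit X)
      ((asOperad k m).comp ((asOperad k m).map ternaryInput g) p)) q)) r

theorem ternComp_leftTree [Finite X] [Finite Y] [Finite Z] (a b : AsLabel k m)
    (p : MonoTree (AsLabel k m) X) (q : MonoTree (AsLabel k m) Y) (r : MonoTree (AsLabel k m) Z) :
    ternComp (treeClass (leftTree a b)) (treeClass p) (treeClass q) (treeClass r) =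
      treeClass ((p.node a q).node b r) := by
  simp only [ternComp, map_treeClass, comp_treeClass]
  congr 1
  apply Subtype.ext
  change BinTree.node b (.node a
      (((((p.1.relabel Sum.inr).relabel _).bind _).relabel _).bind _)
      (((q.1.relabel Sum.inr).relabel _).bind _)) (r.1.relabel Sum.inr) =
    BinTree.node b (.node a ((p.1.relabel Sum.inl).relabel Sum.inl)
      ((q.1.relabel Sum.inr).relabel Sum.inl)) (r.1.relabel Sum.inr)
  simp only [BinTree.relabel, BinTree.bind_bind]
  rfl

theorem ternComp_rightTree [Finite X] [Finite Y] [Finite Z] (a b : AsLabel k m)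
    (p : MonoTree (AsLabel k m) X) (q : MonoTree (AsLabel k m) Y) (r : MonoTree (AsLabel k m) Z) :
    ternComp (treeClass (rightTree a b)) (treeClass p) (treeClass q) (treeClass r) =
      treeClass ((p.node a (q.node b r)).relabel (Equiv.sumAssoc X Y Z).symm) := by
  simp only [ternComp, map_treeClass, comp_treeClass]
  congr 1
  apply Subtype.ext
  change BinTree.node a (((((p.1.relabel Sum.inr).relabel _).bind _).relabel _).bind _)
      (.node b (((q.1.relabel Sum.inr).relabel _).bind _) (r.1.relabel Sum.inr)) =
    BinTree.node a ((p.1.relabel Sum.inl).relabel _)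
      (.node b (((q.1.relabel Sum.inl).relabel Sum.inr).relabel _)
        (((r.1.relabel Sum.inr).relabel Sum.inr).relabel _))
  simp only [BinTree.relabel, BinTree.bind_bind]
  rfl

/-- Plugging trees into the three inputs carries the relation in arity three over to arbitrary
branches. -/
theorem treeClass_assoc [Finite X] [Finite Y] [Finite Z] (i j : Fin m)
    (p : MonoTree (AsLabel k m) X) (q : MonoTree (AsLabel k m) Y) (r : MonoTree (AsLabel k m) Z) :
    treeClass ((p.node (starOp k m i) q).node (starOp k m j) r) =
      treeClass ((p.node (starOp k m i) (q.node (starOp k m j) r)).relabel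
        (Equiv.sumAssoc X Y Z).symm) := by
  rw [← ternComp_leftTree, ← ternComp_rightTree, treeClass_leftTree]

/-- The tree `s` represents the same operation as the tree `t`, whatever the labels of the
leaves. -/
def TreeRel (t s : BinTree (AsLabel k m) X) : Prop :=
  ∀ (Y : Type) [Finite Y] (t' : MonoTree (AsLabel k m) Y) (f : Y → X), t'.1.relabel f = t →
    ∃ s' : MonoTree (AsLabel k m) Y, s'.1.relabel f = s ∧ treeClass t' = treeClass s'

theorem TreeRel.refl (t : BinTree (AsLabel k m) X) : TreeRel t t := fun _ _ t' _ h => ⟨t', h, rfl⟩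

theorem TreeRel.trans {t s r : BinTree (AsLabel k m) X} (h : TreeRel t s) (h' : TreeRel s r) :
    TreeRel t r := by
  intro Y _ t' f ht
  obtain ⟨s', hs, h1⟩ := h Y t' f ht
  obtain ⟨r', hr, h2⟩ := h' Y s' f hs
  exact ⟨r', hr, h1.trans h2⟩

theorem TreeRel.treeClass_eq [Finite X] {t s : MonoTree (AsLabel k m) X} (h : TreeRel t.1 s.1) :
    treeClass t = treeClass s := by
  obtain ⟨s', hs, h'⟩ := h X t (fun x => x) (BinTree.relabel_id _)
  rw [h']
  congr 1
  exact Subtype.ext ((BinTree.relabel_id _).symm.trans hs)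

theorem exists_relabel_eq_node {G : Type u} {g : G} {l r : BinTree G X} {t' : BinTree G Y}
    {f : Y → X} (h : t'.relabel f = .node g l r) :
    ∃ l' r', t' = .node g l' r' ∧ l'.relabel f = l ∧ r'.relabel f = r := by
  rcases t' with y | ⟨g', l', r'⟩
  · exact absurd h (by simp [BinTree.relabel, BinTree.bind])
  · rw [BinTree.relabel_node, BinTree.node.injEq] at h
    obtain ⟨rfl, h1, h2⟩ := h
    exact ⟨l', r', rfl, h1, h2⟩

theorem treeRel_assoc (i j : Fin m) (a b c : BinTree (AsLabel k m) X) :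
    TreeRel (.node (starOp k m j) (.node (starOp k m i) a b) c)
      (.node (starOp k m i) a (.node (starOp k m j) b c)) := by
  intro Y _ t' f ht
  obtain ⟨d, c, h1, h2, rfl⟩ := exists_relabel_eq_node ht
  obtain ⟨a, b, rfl, rfl, rfl⟩ := exists_relabel_eq_node h2
  obtain ⟨Ya, _, a, fa, rfl⟩ := MonoTree.exists_relabel_eq a
  obtain ⟨Yb, _, b, fb, rfl⟩ := MonoTree.exists_relabel_eq b
  obtain ⟨Yc, _, c, fc, rfl⟩ := MonoTree.exists_relabel_eq c
  have h3 : ((a.node (starOp k m i) b).node (starOp k m j) c).1.relabel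
      (Sum.elim (Sum.elim fa fb) fc) = t'.1 := by
    rw [h1]
    simp only [MonoTree.node, BinTree.relabel_node, BinTree.relabel_relabel, Sum.elim_inl,
      Sum.elim_inr]
  -- The leaves of the three branches are together the leaves of `t'`, each one once.
  have hF := MonoTree.bijective_of_relabel _ _ _ h3
  refine ⟨((a.node (starOp k m i) (b.node (starOp k m j) c)).relabel
        (Equiv.sumAssoc Ya Yb Yc).symm).relabel (Equiv.ofBijective _ hF), ?_, ?_⟩
  · simp only [MonoTree.node, MonoTree.relabel, BinTree.relabel_node, BinTree.relabel_relabel]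
    rfl
  · rw [MonoTree.eq_relabel _ _ _ hF h3, ← map_treeClass, treeClass_assoc, map_treeClass]

theorem TreeRel.node_right {e : AsLabel k m} (l : BinTree (AsLabel k m) X)
    {r r' : BinTree (AsLabel k m) X} (h : TreeRel r r') : TreeRel (.node e l r) (.node e l r') := by
  intro Y _ t' f ht
  obtain ⟨l, r, h1, rfl, rfl⟩ := exists_relabel_eq_node ht
  obtain ⟨Yl, _, l, fl, rfl⟩ := MonoTree.exists_relabel_eq l
  obtain ⟨Yr, _, r, fr, rfl⟩ := MonoTree.exists_relabel_eq r
  have h3 : (l.node e r).1.relabel (Sum.elim fl fr) = t'.1 := by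
    rw [h1]
    simp only [MonoTree.node, BinTree.relabel_node, BinTree.relabel_relabel, Sum.elim_inl,
      Sum.elim_inr]
  have hF := MonoTree.bijective_of_relabel _ _ _ h3
  obtain ⟨s, hs, h4⟩ := h Yr r (fun y => f (fr y)) (BinTree.relabel_relabel _ _ _).symm
  refine ⟨(l.node e s).relabel (Equiv.ofBijective _ hF), ?_, ?_⟩
  · rw [← hs]
    simp only [MonoTree.node, MonoTree.relabel, BinTree.relabel_node, BinTree.relabel_relabel]
    rfl
  · rw [MonoTree.eq_relabel _ _ _ hF h3, ← map_treeClass, ← map_treeClass, ← binComp_treeClass,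
      ← binComp_treeClass, h4]

/-- Induction on the left word: at each letter associativity moves the bracket to the right, until
the product of two combs is the comb of the concatenated word. -/
theorem treeRel_mul (i : Fin m) (v w : LWord m X) :
    TreeRel (.node (starOp k m i) (v.tree k) (w.tree k)) ((LWord.mul i v w).tree k) := by
  induction v using LWord.induction with
  | nil y =>
    rw [LWord.tree_nil]
    simp only [LWord.mul, List.nil_append, LWord.tree_cons]
    exact .refl _
  | cons a j L y ih =>
    rw [LWord.tree_cons]
    have : LWord.mul i ((a, j) :: L, y) w =
      ((a, j) :: (LWord.mul i (L, y) w).1, (LWord.mul i (L, y) w).2) := rfl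
    rw [this, LWord.tree_cons]
    exact (treeRel_assoc _ _ _ _ _).trans (ih.node_right _)

/-- The right comb of a word in which every letter occurs exactly once. -/
noncomputable def LWord.IsMono.tree {w : LWord m X} (hw : w.IsMono) : MonoTree (AsLabel k m) X :=
  ⟨w.tree k, (LWord.isMono_iff k w).1 hw⟩

variable (k m X) in
/-- The words in which every letter occurs exactly once. -/
abbrev MWord : Type := {w : LWord m X // w.IsMono}

variable (k) in
/-- The operation of `As^(m)` which a word defines. -/
noncomputable def wordElem [Finite X] (w : MWord m X) : (asOperad k m).obj X :=
  treeClass w.2.tree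

theorem LWord.IsMono.map {w : LWord m X} (hw : w.IsMono) (f : X ≃ Y) : (w.map f).IsMono := by
  constructor
  · rw [LWord.letters_map]; exact hw.1.map f.injective
  · intro y
    rw [LWord.letters_map, List.mem_map]
    exact ⟨f.symm y, hw.2 _, by simp⟩

theorem map_wordElem [Finite X] [Finite Y] (f : X ≃ Y) (w : MWord m X) :
    (asOperad k m).map f (wordElem k w) = wordElem k ⟨w.1.map f, w.2.map f⟩ := by
  rw [wordElem, map_treeClass]
  exact congrArg treeClass (Subtype.ext (LWord.tree_map k f w.1).symm)

theorem LWord.IsMono.mul {v : LWord m X} {w : LWord m Y} (hv : v.IsMono) (hw : w.IsMono)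
    (i : Fin m) : (LWord.mul i (v.map (Sum.inl : X → X ⊕ Y)) (w.map Sum.inr)).IsMono := by
  constructor
  · rw [LWord.letters_mul, LWord.letters_map, LWord.letters_map]
    refine List.Nodup.append (hv.1.map Sum.inl_injective) (hw.1.map Sum.inr_injective) ?_
    intro z hz hz'
    obtain ⟨x, -, rfl⟩ := List.mem_map.1 hz
    obtain ⟨y, -, h⟩ := List.mem_map.1 hz'
    exact Sum.inr_ne_inl h
  · intro z
    rw [LWord.letters_mul, LWord.letters_map, LWord.letters_map, List.mem_append]
    rcases z with x | y
    · exact Or.inl (List.mem_map_of_mem (hv.2 x))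
    · exact Or.inr (List.mem_map_of_mem (hw.2 y))

theorem binCompL_wordElem [Finite X] [Finite Y] (i : Fin m) (v : MWord m X) (w : MWord m Y) :
    binCompL k m X Y (starOp k m i) (wordElem k v) (wordElem k w) =
      wordElem k ⟨_, v.2.mul w.2 i⟩ := by
  rw [wordElem, wordElem, binCompL_treeClass]
  refine TreeRel.treeClass_eq ?_
  change TreeRel (.node (starOp k m i) ((v.1.tree k).relabel Sum.inl)
    ((w.1.tree k).relabel Sum.inr)) _
  rw [← LWord.tree_map, ← LWord.tree_map]
  exact treeRel_mul i _ _

/-- An opposite operation is a `⋆ᵢ` with exchanged arguments, so that the normal form needs no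
labels for the opposites. -/
theorem binCompL_swap [Finite X] [Finite Y] (e : AsLabel k m) (p : (asOperad k m).obj X)
    (q : (asOperad k m).obj Y) :
    binCompL k m X Y (starSwap k m e) p q =
      (asOperad k m).map (Equiv.sumComm Y X) (binCompL k m Y X e q p) := by
  let B : (asOperad k m).obj X →ₗ[k] (asOperad k m).obj Y →ₗ[k] (asOperad k m).obj (X ⊕ Y) :=
    (binCompL k m Y X e).flip.compr₂ ((asOperad k m).map (Equiv.sumComm Y X))
  have hB : ∀ (s : MonoTree (AsLabel k m) X) (t : MonoTree (AsLabel k m) Y),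
      binCompL k m X Y (starSwap k m e) (treeClass s) (treeClass t) =
        B (treeClass s) (treeClass t) := by
    intro s t
    change _ = (asOperad k m).map (Equiv.sumComm Y X)
      (binCompL k m Y X e (treeClass t) (treeClass s))
    rw [binCompL_treeClass e t s, map_treeClass]
    change binComp ((asData k m).gen ((asData k m).swap e)) _ _ = _
    refine (congrArg (fun g => binComp g (treeClass s) (treeClass t))
      (gen_swap (asData k m) e)).trans ?_
    simp only [binComp]
    rw [gen_eq_treeClass, map_treeClass, map_treeClass, comp_treeClass, map_treeClass,
      comp_treeClass]
    congr 1
    apply Subtype.ext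
    change BinTree.node e (t.1.relabel Sum.inr) (((s.1.relabel Sum.inr).relabel _).bind _) =
      BinTree.node e ((t.1.relabel Sum.inl).relabel _) ((s.1.relabel Sum.inr).relabel _)
    simp only [BinTree.relabel, BinTree.bind_bind]
    rfl
  have : binCompL k m X Y (starSwap k m e) = B :=
    LinearMap.ext_on_range span_treeClass fun s => LinearMap.ext_on_range span_treeClass (hB s)
  exact LinearMap.congr_fun₂ this p q

/-- The `⋆ᵢ` concatenate words, their opposites concatenate them in the other order, and these
operations span the labels of the vertices. -/
theorem binCompL_mem_span [Finite X] [Finite Y] (e : AsLabel k m) {p : (asOperad k m).obj X}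
    {q : (asOperad k m).obj Y}
    (hp : p ∈ Submodule.span k (Set.range (wordElem (m := m) k (X := X))))
    (hq : q ∈ Submodule.span k (Set.range (wordElem (m := m) k (X := Y)))) :
    binCompL k m X Y e p q ∈ Submodule.span k (Set.range (wordElem (m := m) k (X := X ⊕ Y))) := by
  have key : ∀ {X Y : Type} [Finite X] [Finite Y] (i : Fin m) {p : (asOperad k m).obj X}
      {q : (asOperad k m).obj Y}
      (_ : p ∈ Submodule.span k (Set.range (wordElem (m := m) k (X := X))))
      (_ : q ∈ Submodule.span k (Set.range (wordElem (m := m) k (X := Y)))),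
      binCompL k m X Y (starOp k m i) p q ∈
        Submodule.span k (Set.range (wordElem (m := m) k (X := X ⊕ Y))) := by
    intro X Y _ _ i p q hp hq
    have := Submodule.apply_mem_map₂ (binCompL k m X Y (starOp k m i)) hp hq
    rw [Submodule.map₂_span_span] at this
    refine Submodule.span_mono ?_ this
    rintro _ ⟨_, ⟨v, rfl⟩, _, ⟨w, rfl⟩, rfl⟩
    exact ⟨_, (binCompL_wordElem i v w).symm⟩
  have he : e = ∑ i, e.1 i • starOp k m i + ∑ i, e.2 i • starSwap k m (starOp k m i) := by
    refine Prod.ext ?_ ?_ <;> funext j <;>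
      simp [starOp, starSwap, Prod.fst_sum, Prod.snd_sum, Finset.sum_apply, Pi.single_apply]
  rw [he, map_add, map_sum, map_sum, LinearMap.add_apply, LinearMap.add_apply, LinearMap.sum_apply,
    LinearMap.sum_apply, LinearMap.sum_apply, LinearMap.sum_apply]
  refine add_mem (sum_mem fun i _ => ?_) (sum_mem fun i _ => ?_)
  · rw [map_smul, LinearMap.smul_apply, LinearMap.smul_apply]
    exact Submodule.smul_mem _ _ (key i hp hq)
  · rw [map_smul, LinearMap.smul_apply, LinearMap.smul_apply]
    refine Submodule.smul_mem _ _ ?_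
    rw [binCompL_swap]
    have := Submodule.mem_map_of_mem (f := (asOperad k m).map (Equiv.sumComm Y X)) (key i hq hp)
    rw [Submodule.map_span] at this
    refine Submodule.span_mono ?_ this
    rintro _ ⟨_, ⟨v, rfl⟩, rfl⟩
    exact ⟨_, (map_wordElem _ v).symm⟩

theorem exists_relabel_mem_span (t : BinTree (AsLabel k m) X) :
    ∃ (Y : Type) (_ : Finite Y) (s : MonoTree (AsLabel k m) Y) (f : Y → X), s.1.relabel f = t ∧
      treeClass s ∈ Submodule.span k (Set.range (wordElem (m := m) k (X := Y))) := by
  induction t with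
  | leaf x =>
    refine ⟨Unit, inferInstance, MonoTree.unit, fun _ => x, rfl, Submodule.subset_span ?_⟩
    refine ⟨⟨([], ()), by simp [LWord.letters, LWord.IsMono]⟩, ?_⟩
    exact congrArg treeClass (Subtype.ext (LWord.tree_nil k ()))
  | node g l r hl hr =>
    obtain ⟨Y, _, s, f, rfl, hs⟩ := hl
    obtain ⟨Y', _, s', f', rfl, hs'⟩ := hr
    refine ⟨Y ⊕ Y', inferInstance, s.node g s', Sum.elim f f', ?_, ?_⟩
    · change BinTree.node g ((s.1.relabel Sum.inl).relabel _)
        ((s'.1.relabel Sum.inr).relabel _) = _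
      rw [BinTree.relabel_relabel, BinTree.relabel_relabel]
      rfl
    · rw [← binCompL_treeClass]
      exact binCompL_mem_span g hs hs'

theorem span_wordElem [Finite X] :
    Submodule.span k (Set.range (wordElem (m := m) k (X := X))) = ⊤ := by
  rw [← top_le_iff, ← span_treeClass, Submodule.span_le]
  rintro _ ⟨t, rfl⟩
  obtain ⟨Y, _, s, f, h, hs⟩ := exists_relabel_mem_span t.1
  have hf := MonoTree.bijective_of_relabel s t f h
  rw [MonoTree.eq_relabel s t f hf h, ← map_treeClass]
  have := Submodule.mem_map_of_mem (f := (asOperad k m).map (Equiv.ofBijective f hf)) hs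
  rw [Submodule.map_span] at this
  refine Submodule.span_mono ?_ this
  rintro _ ⟨_, ⟨v, rfl⟩, rfl⟩
  exact ⟨_, (map_wordElem _ v).symm⟩

variable (k) in
/-- The value of an operation of `As^(m)` at the generators of the free algebra. -/
noncomputable def genericValue [Finite X] : (asOperad k m).obj X →ₗ[k] (LWord m X →₀ k) :=
  endEvalAt k (fun x => Finsupp.single ([], x) 1) ∘ₗ (asHom _ (LWord.freeOp_assoc k)).app X

theorem endEvalAt_asHom_wordElem {V : Type v} [AddCommGroup V] [Module k V]
    (op : Fin m → V →ₗ[k] V →ₗ[k] V)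
    (hop : ∀ i j a b c, op i a (op j b c) = op j (op i a b) c) [Finite X]
    (w : MWord m X) (x : X → V) :
    endEvalAt k x ((asHom op hop).app X (wordElem k w)) = LWord.eval (fun i a b => op i a b) x w.1 := by
  rw [wordElem, endEvalAt_asHom_treeClass, ← LWord.eval_tree]
  rfl

theorem endEvalAt_freeOp_wordElem [Finite X] (w : MWord m X) (f : X → LWord m Y) :
    endEvalAt k (fun x => Finsupp.single (f x) (1 : k))
      ((asHom _ (LWord.freeOp_assoc k)).app X (wordElem k w)) = Finsupp.single (w.1.bind f) 1 := by
  rw [endEvalAt_asHom_wordElem, LWord.eval_freeOp]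

theorem genericValue_wordElem [Finite X] (w : MWord m X) :
    genericValue k (wordElem k w) = Finsupp.single w.1 1 := by
  refine (endEvalAt_freeOp_wordElem w _).trans ?_
  rw [LWord.bind_letter (fun x => x)]
  simp [LWord.map]

variable (k m X) in
/-- The basis of `As^(m)` which consists of words. -/
noncomputable def wordBasis [Finite X] : Module.Basis (MWord m X) k ((asOperad k m).obj X) :=
  Module.Basis.mk (v := wordElem k)
    (by
      -- In the free algebra, different words are different basis vectors.
      refine LinearIndependent.of_comp (genericValue k) ?_
      have : genericValue k ∘ wordElem k =
          (fun w : LWord m X => Finsupp.single w (1 : k)) ∘ (Subtype.val : MWord m X → _) :=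
        funext genericValue_wordElem
      rw [this]
      exact (Finsupp.linearIndependent_single_one k (LWord m X)).comp _ Subtype.val_injective)
    span_wordElem.ge

theorem wordBasis_apply [Finite X] (w : MWord m X) : wordBasis k m X w = wordElem k w := by
  rw [wordBasis, Module.Basis.mk_apply]

theorem genericValue_apply_of_not_isMono [Finite X] (p : (asOperad k m).obj X) {u : LWord m X}
    (hu : ¬ u.IsMono) : genericValue k p u = 0 := by
  refine LinearMap.congr_fun (f := Finsupp.lapply u ∘ₗ genericValue k) (g := 0)
    ((wordBasis k m X).ext fun w => ?_) p
  rw [LinearMap.comp_apply, wordBasis_apply, genericValue_wordElem, Finsupp.lapply_apply,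
    Finsupp.single_eq_of_ne (by rintro rfl; exact hu w.2), LinearMap.zero_apply]

/-- The coordinates in the basis of words are coefficients of the generic value, so identities in
`As^(m)` can be checked at the generators of the free algebra. -/
theorem genericValue_injective [Finite X] :
    Function.Injective (genericValue (m := m) (X := X) k) := by
  have h : ∀ p w, (wordBasis k m X).repr p w = genericValue k p w.1 := by
    intro p w
    classical
    refine LinearMap.congr_fun (f := (wordBasis k m X).coord w)
      (g := Finsupp.lapply w.1 ∘ₗ genericValue k) ((wordBasis k m X).ext fun v => ?_) p
    rw [LinearMap.comp_apply, Module.Basis.coord_apply, Module.Basis.repr_self, wordBasis_apply,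
      genericValue_wordElem, Finsupp.lapply_apply, Finsupp.single_apply, Finsupp.single_apply]
    simp only [Subtype.ext_iff]
  intro p q hpq
  refine (wordBasis k m X).repr.injective (Finsupp.ext fun w => ?_)
  rw [h, h, hpq]

/-- At the generators of the free algebra, composition is substitution. That every letter occurs
once in the substituted word follows from the support of generic values, without counting letters.
-/
theorem comp_wordElem [Finite X] [Finite Y] (v : MWord m (Option X)) (w : MWord m Y) :
    ∃ h, (asOperad k m).comp (wordElem k v) (wordElem k w) = wordElem k
      ⟨v.1.bind fun o => o.elim (w.1.map Sum.inr) fun x => ([], Sum.inl x), h⟩ := by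
  set u : LWord m (X ⊕ Y) :=
    v.1.bind fun o => o.elim (w.1.map Sum.inr) fun x => ([], Sum.inl x) with hu
  have h1 : genericValue k ((asOperad k m).comp (wordElem k v) (wordElem k w)) =
      Finsupp.single u 1 := by
    rw [hu, ← endEvalAt_freeOp_wordElem, genericValue, LinearMap.comp_apply,
      SymOperad.Hom.app_comp, endEvalAt_comp]
    congr 1
    congr 1
    funext o
    rcases o with _ | x
    · refine (endEvalAt_freeOp_wordElem w fun y => ([], Sum.inr y)).trans ?_
      rw [LWord.bind_letter]
      rfl
    · rfl
  have h3 : u.IsMono := by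
    by_contra hn
    have h4 := genericValue_apply_of_not_isMono
      ((asOperad k m).comp (wordElem k v) (wordElem k w)) hn
    rw [h1, Finsupp.single_eq_same] at h4
    exact one_ne_zero h4
  exact ⟨h3, genericValue_injective (by rw [h1, genericValue_wordElem])⟩

end AsOperad

/-! ### Words described by the ranks of their letters. -/

theorem List.Pairwise.forall_or {α : Type*} {R : α → α → Prop} {l : List α} (hl : l.Pairwise R)
    {a b : α} (ha : a ∈ l) (hb : b ∈ l) (hab : a ≠ b) : R a b ∨ R b a := by
  have : Std.Symm fun a b => R a b ∨ R b a := ⟨fun _ _ h => h.symm⟩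
  exact (hl.imp (S := fun a b => R a b ∨ R b a) Or.inl).forall ha hb hab

namespace LWord

variable {m : ℕ} {X Y : Type}

/-- The letters of the word are ordered by the rank `r`, and the label after a letter of rank `j`
is `ℓ j`. -/
def Rep (w : LWord m X) (r : X → ℕ) (ℓ : ℕ → Fin m) : Prop :=
  w.letters.Pairwise (fun a b => r a < r b) ∧ (∀ x, x ∈ w.letters) ∧
    ∀ y i, (y, i) ∈ w.1 → ℓ (r y) = i

theorem Rep.isMono {w : LWord m X} {r : X → ℕ} {ℓ : ℕ → Fin m} (h : w.Rep r ℓ) : w.IsMono :=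
  ⟨h.1.imp fun hab => ne_of_apply_ne r hab.ne, h.2.1⟩

theorem last_mem_letters (w : LWord m X) : w.2 ∈ w.letters := by simp [letters]

theorem Rep.le_last {w : LWord m X} {r : X → ℕ} {ℓ : ℕ → Fin m} (h : w.Rep r ℓ) (x : X) :
    r x ≤ r w.2 := by
  have h1 := List.pairwise_append.1 h.1
  rcases List.mem_append.1 (h.2.1 x) with hx | hx
  · exact (h1.2.2 x hx _ (List.mem_singleton_self _)).le
  · rw [List.mem_singleton.1 hx]

/-- The rank determines the sequence of the letters, and each label is a function of the rank of the
letter before it. -/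
theorem Rep.unique {w w' : LWord m X} {r : X → ℕ} {ℓ : ℕ → Fin m} (h : w.Rep r ℓ)
    (h' : w'.Rep r ℓ) : w = w' := by
  have hl : w.letters = w'.letters := by
    refine List.Perm.eq_of_pairwise (le := fun a b => r a < r b)
      (fun a b _ _ hab hba => absurd hab hba.not_gt) h.1 h'.1 ?_
    exact (List.perm_ext_iff_of_nodup h.isMono.1 h'.isMono.1).2 fun x => by
      simp [h.2.1 x, h'.2.1 x]
  have key : ∀ {w : LWord m X}, w.Rep r ℓ → w.1 = (w.1.map Prod.fst).map fun x => (x, ℓ (r x)) := by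
    intro w hw
    rw [List.map_map]
    conv_lhs => rw [← List.map_id w.1]
    refine List.map_congr_left fun p hp => ?_
    exact Prod.ext rfl (hw.2.2 p.1 p.2 hp).symm
  obtain ⟨h1, h2⟩ := List.append_inj' hl rfl
  refine Prod.ext ?_ (List.cons.inj h2).1
  rw [key h, key h', h1]

theorem exists_rep [Finite X] [Nonempty X] {r : X → ℕ} (hr : Function.Injective r)
    (ℓ : ℕ → Fin m) : ∃ w : LWord m X, w.Rep r ℓ := by
  classical
  have := Fintype.ofFinite X
  have key : ∀ s : Finset X, s.Nonempty → ∃ w : LWord m X,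
      w.letters.Pairwise (fun a b => r a < r b) ∧ (∀ x, x ∈ w.letters ↔ x ∈ s) ∧
        ∀ y i, (y, i) ∈ w.1 → ℓ (r y) = i := by
    intro s
    induction s using Finset.induction_on_max_value r with
    | empty => intro h; exact absurd h (by simp)
    | insert a s ha hmax ih =>
      intro _
      by_cases hs : s.Nonempty
      · obtain ⟨w, h1, h2, h3⟩ := ih hs
        -- The new letter has the largest rank and goes to the end; the label in front of it belongs
        -- to the former last letter.
        refine ⟨mul (ℓ (r w.2)) w ([], a), ?_, ?_, ?_⟩
        · rw [letters_mul, List.pairwise_append]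
          refine ⟨h1, by simp [letters], fun x hx y hy => ?_⟩
          rw [List.mem_singleton.1 hy]
          refine lt_of_le_of_ne (hmax x ((h2 x).1 hx)) fun h => ha ?_
          have h4 : x = a := hr h
          exact h4 ▸ (h2 x).1 hx
        · intro x
          rw [letters_mul, List.mem_append, h2, Finset.mem_insert]
          simp [letters, or_comm]
        · intro y i hy
          simp only [mul, List.mem_append, List.mem_singleton, Prod.mk.injEq] at hy
          rcases hy with hy | ⟨rfl, rfl⟩
          · exact h3 y i hy
          · rfl
      · rw [Finset.not_nonempty_iff_eq_empty] at hs
        subst hs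
        exact ⟨([], a), by simp [letters], by simp [letters], by simp⟩
  obtain ⟨w, h1, h2, h3⟩ := key Finset.univ Finset.univ_nonempty
  exact ⟨w, h1, fun x => (h2 x).2 (Finset.mem_univ x), h3⟩

theorem IsMono.exists_rep [NeZero m] [Finite X] {w : LWord m X} (hw : w.IsMono) :
    ∃ r ℓ, w.Rep r ℓ ∧ Function.Injective r ∧ ∀ x, r x < Nat.card X := by
  classical
  have hlen : w.letters.length = Nat.card X := by
    have := Fintype.ofFinite X
    rw [Nat.card_eq_fintype_card, ← List.toFinset_card_of_nodup hw.1,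
      Finset.card_eq_iff_eq_univ, Finset.eq_univ_iff_forall]
    exact fun x => List.mem_toFinset.2 (hw.2 x)
  -- The rank is the position in the word. The default label 0 is read only beyond the list of
  -- labels, where nothing is required of it.
  refine ⟨fun x => w.letters.idxOf x, fun j => (w.1.map Prod.snd).getD j 0, ⟨?_, hw.2, ?_⟩, ?_,
    fun x => ?_⟩
  · rw [List.pairwise_iff_getElem]
    intro i j hi hj hij
    change w.letters.idxOf _ < w.letters.idxOf _
    rwa [List.Nodup.idxOf_getElem hw.1, List.Nodup.idxOf_getElem hw.1]
  · intro y i hy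
    obtain ⟨j, hj, hj'⟩ := List.mem_iff_getElem.1 hy
    have h1 : w.letters.idxOf y = j := by
      have h2 : w.letters[j]'(by simp [letters]; omega) = y := by
        simp only [letters]
        rw [List.getElem_append_left (by simpa using hj), List.getElem_map, hj']
      rw [← h2, List.Nodup.idxOf_getElem hw.1]
    change (w.1.map Prod.snd).getD (w.letters.idxOf y) 0 = i
    rw [h1, List.getD_eq_getElem _ _ (by simpa using hj), List.getElem_map, hj']
  · intro x y hxy
    exact (List.idxOf_inj (hw.2 x)).1 hxy
  · rw [← hlen]
    exact List.idxOf_lt_length_of_mem (hw.2 x)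

theorem Rep.map {w : LWord m X} (e : X ≃ Y) {r : Y → ℕ} {ℓ : ℕ → Fin m}
    (h : w.Rep (fun x => r (e x)) ℓ) : (w.map e).Rep r ℓ := by
  refine ⟨?_, fun y => ?_, fun y i hy => ?_⟩
  · rw [letters_map, List.pairwise_map]
    exact h.1
  · rw [letters_map, List.mem_map]
    exact ⟨e.symm y, h.2.1 _, by simp⟩
  · simp only [LWord.map, List.mem_map, Prod.mk.injEq] at hy
    obtain ⟨p, hp, rfl, rfl⟩ := hy
    exact h.2.2 p.1 p.2 hp

/-- The blocks `f x` follow one another as the letters `x` do, so comparing their last letters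
recovers this order, and the label after `x` is the one after the last letter of `f x`. -/
theorem Rep.of_bind {w : LWord m X} {f : X → LWord m Y} {t : Y → ℕ} {ℓ : ℕ → Fin m}
    (h : (w.bind f).Rep t ℓ) (hw : w.IsMono) : w.Rep (fun x => t (f x).2) ℓ := by
  refine ⟨?_, hw.2, fun y i hy => ?_⟩
  · have := h.1
    rw [letters_bind, List.pairwise_flatMap] at this
    exact this.2.imp fun hab => hab _ (last_mem_letters _) _ (last_mem_letters _)
  · exact h.2.2 _ i ((mem_fst_bind _ _ _ _).2 (Or.inr ⟨y, hy, rfl⟩))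

/-- The substitution of a word for the letter `none`. -/
def graftArgs (w : LWord m Y) (o : Option X) : LWord m (X ⊕ Y) :=
  o.elim (w.map Sum.inr) fun x => ([], Sum.inl x)

variable {v : LWord m (Option X)} {w : LWord m Y} {t : X ⊕ Y → ℕ} {ℓ : ℕ → Fin m}

theorem Rep.right_of_graft (hv : v.IsMono) (hw : w.IsMono)
    (h : (v.bind (graftArgs w)).Rep t ℓ) : w.Rep (fun y => t (Sum.inr y)) ℓ := by
  refine ⟨?_, hw.2, fun y i hy => ?_⟩
  · have := h.1
    rw [letters_bind, List.pairwise_flatMap] at this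
    have h1 := this.1 none (hv.2 none)
    change (w.map Sum.inr).letters.Pairwise _ at h1
    rwa [letters_map, List.pairwise_map] at h1
  · refine h.2.2 (Sum.inr y) i ((mem_fst_bind _ _ _ _).2 (Or.inl ⟨none, hv.2 none, ?_⟩))
    exact List.mem_map.2 ⟨(y, i), hy, rfl⟩

theorem Rep.block_of_graft (hv : v.IsMono) (hw : w.IsMono)
    (h : (v.bind (graftArgs w)).Rep t ℓ) (x : X) (y y' : Y) (hy : t (Sum.inl x) < t (Sum.inr y)) :
    t (Sum.inl x) < t (Sum.inr y') := by
  have hp := h.1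
  rw [letters_bind, List.pairwise_flatMap] at hp
  have hmem : ∀ y, Sum.inr y ∈ (graftArgs w (none : Option X)).letters := by
    intro y
    change _ ∈ (w.map Sum.inr).letters
    rw [letters_map]
    exact List.mem_map_of_mem (hw.2 y)
  have hx : Sum.inl x ∈ (graftArgs w (some x)).letters := List.mem_singleton_self _
  rcases hp.2.forall_or (hv.2 none) (hv.2 (some x)) (by simp) with h1 | h1
  · exact absurd (h1 _ (hmem y) _ hx) hy.not_gt
  · exact h1 _ hx _ (hmem y')

/-- The letter `none` has the rank of the last letter of the inserted word, since the label after
`none` ends up after that letter. The hypothesis `hblock` keeps the other letters from falling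
inside the inserted word. -/
theorem Rep.graft {ρ : Option X → ℕ} (hρ : ∀ x, ρ (some x) = t (Sum.inl x))
    (hmax : ∀ y, t (Sum.inr y) ≤ ρ none) (hex : ∃ y, t (Sum.inr y) = ρ none)
    (hblock : ∀ x y y', t (Sum.inl x) < t (Sum.inr y) → t (Sum.inl x) < t (Sum.inr y'))
    (hv : v.Rep ρ ℓ) (hw : w.Rep (fun y => t (Sum.inr y)) ℓ) :
    (v.bind (graftArgs w)).Rep t ℓ := by
  obtain ⟨y₀, hy₀⟩ := hex
  have hlast : ρ none = t (Sum.inr w.2) :=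
    le_antisymm (hy₀ ▸ hw.le_last y₀) (hmax _)
  have hmemr : ∀ {z}, z ∈ (graftArgs w (none : Option X)).letters → ∃ y, z = Sum.inr y := by
    intro z hz
    change z ∈ (w.map Sum.inr).letters at hz
    rw [letters_map] at hz
    obtain ⟨y, -, rfl⟩ := List.mem_map.1 hz
    exact ⟨y, rfl⟩
  have hmeml : ∀ {x : X} {z}, z ∈ (graftArgs w (some x)).letters → z = Sum.inl x := fun hz =>
    List.mem_singleton.1 hz
  refine ⟨?_, ?_, ?_⟩
  · rw [letters_bind, List.pairwise_flatMap]
    constructor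
    · rintro (_ | x) _
      · change (w.map Sum.inr).letters.Pairwise _
        rw [letters_map, List.pairwise_map]
        exact hw.1
      · exact List.pairwise_singleton _ _
    · refine hv.1.imp ?_
      rintro (_ | x) (_ | x') h z hz z' hz'
      · exact absurd h (lt_irrefl _)
      · obtain ⟨y, rfl⟩ := hmemr hz
        rw [hmeml hz']
        rw [hρ] at h
        exact (hmax y).trans_lt h
      · obtain ⟨y, rfl⟩ := hmemr hz'
        rw [hmeml hz]
        rw [hρ, hlast] at h
        exact hblock _ _ _ h
      · rw [hmeml hz, hmeml hz', ← hρ, ← hρ]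
        exact h
  · intro z
    rw [letters_bind, List.mem_flatMap]
    rcases z with x | y
    · exact ⟨some x, hv.2.1 _, List.mem_singleton_self _⟩
    · refine ⟨none, hv.2.1 _, ?_⟩
      change _ ∈ (w.map Sum.inr).letters
      rw [letters_map]
      exact List.mem_map_of_mem (hw.2.1 y)
  · intro z i hz
    rcases (mem_fst_bind _ _ _ _).1 hz with ⟨_ | x, -, h⟩ | ⟨_ | x, h, rfl⟩
    · obtain ⟨⟨y, j⟩, hp, h'⟩ := List.mem_map.1 h
      obtain ⟨rfl, rfl⟩ := Prod.mk.inj h'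
      exact hw.2.2 y j hp
    · exact absurd h List.not_mem_nil
    · have := hv.2.2 none i h
      rw [hlast] at this
      exact this
    · have := hv.2.2 (some x) i h
      rw [hρ] at this
      exact this

end LWord

section Represents

variable {k : Type u} [Field k] {m : ℕ} {X Y : Type}

/-- The element `p` of the operad `As^(m)` is a word, with its letters ordered by the rank `r` and
the label `ℓ j` after a letter of rank `j`. -/
def Represents [Finite X] (p : (asOperad k m).obj X) (r : X → ℕ) (ℓ : ℕ → Fin m) : Prop :=
  ∃ w : MWord m X, w.1.Rep r ℓ ∧ p = wordElem k w

theorem wordElem_injective [Finite X] : Function.Injective (wordElem (m := m) (X := X) k) := by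
  intro v w h
  rw [← wordBasis_apply, ← wordBasis_apply] at h
  exact (wordBasis k m X).injective h

theorem Represents.unique [Finite X] {p q : (asOperad k m).obj X} {r : X → ℕ} {ℓ : ℕ → Fin m}
    (hp : Represents p r ℓ) (hq : Represents q r ℓ) : p = q := by
  obtain ⟨v, hv, rfl⟩ := hp
  obtain ⟨w, hw, rfl⟩ := hq
  exact congrArg (wordElem k) (Subtype.ext (hv.unique hw))

theorem exists_represents [Finite X] [Nonempty X] {r : X → ℕ} (hr : Function.Injective r)
    (ℓ : ℕ → Fin m) : ∃ p : (asOperad k m).obj X, Represents p r ℓ := by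
  obtain ⟨w, hw⟩ := LWord.exists_rep hr ℓ
  exact ⟨wordElem k ⟨w, hw.isMono⟩, ⟨w, hw.isMono⟩, hw, rfl⟩

theorem Represents.map [Finite X] [Finite Y] (e : X ≃ Y) {p : (asOperad k m).obj X} {r : Y → ℕ}
    {ℓ : ℕ → Fin m} (h : Represents p (fun x => r (e x)) ℓ) :
    Represents ((asOperad k m).map e p) r ℓ := by
  obtain ⟨w, hw, rfl⟩ := h
  exact ⟨⟨w.1.map e, w.2.map e⟩, hw.map e, map_wordElem e w⟩

theorem Represents.of_map [Finite X] [Finite Y] (e : X ≃ Y) {p : (asOperad k m).obj X} {r : Y → ℕ}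
    {ℓ : ℕ → Fin m} (h : Represents ((asOperad k m).map e p) r ℓ) :
    Represents p (fun x => r (e x)) ℓ := by
  have := Represents.map e.symm (r := fun x => r (e x)) (p := (asOperad k m).map e p)
    (by simpa using h)
  rwa [← SymOperad.map_trans, Equiv.self_trans_symm, SymOperad.map_refl] at this

theorem Represents.comp [Finite X] [Finite Y] {p : (asOperad k m).obj (Option X)}
    {q : (asOperad k m).obj Y} {t : X ⊕ Y → ℕ} {ℓ : ℕ → Fin m} {ρ : Option X → ℕ}
    (hρ : ∀ x, ρ (some x) = t (Sum.inl x))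
    (hmax : ∀ y, t (Sum.inr y) ≤ ρ none) (hex : ∃ y, t (Sum.inr y) = ρ none)
    (hblock : ∀ x y y', t (Sum.inl x) < t (Sum.inr y) → t (Sum.inl x) < t (Sum.inr y'))
    (hp : Represents p ρ ℓ) (hq : Represents q (fun y => t (Sum.inr y)) ℓ) :
    Represents ((asOperad k m).comp p q) t ℓ := by
  obtain ⟨v, hv, rfl⟩ := hp
  obtain ⟨w, hw, rfl⟩ := hq
  obtain ⟨h, h'⟩ := comp_wordElem (k := k) v w
  exact ⟨_, LWord.Rep.graft hρ hmax hex hblock hv hw, h'⟩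

/-- The converse of `Represents.comp`. -/
theorem Represents.of_comp [Finite X] [Finite Y] (v : MWord m (Option X)) (w : MWord m Y)
    {t : X ⊕ Y → ℕ} {ℓ : ℕ → Fin m} {ρ : Option X → ℕ}
    (hρ : ∀ x, ρ (some x) = t (Sum.inl x))
    (hmax : ∀ y, t (Sum.inr y) ≤ ρ none) (hex : ∃ y, t (Sum.inr y) = ρ none)
    (h : Represents ((asOperad k m).comp (wordElem k v) (wordElem k w)) t ℓ) :
    Represents (wordElem k v) ρ ℓ ∧ Represents (wordElem k w) (fun y => t (Sum.inr y)) ℓ ∧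
      ∀ x y y', t (Sum.inl x) < t (Sum.inr y) → t (Sum.inl x) < t (Sum.inr y') := by
  obtain ⟨u, hu, h'⟩ := h
  obtain ⟨h1, h2⟩ := comp_wordElem (k := k) v w
  rw [h2] at h'
  have h3 := wordElem_injective h'
  rw [← h3] at hu
  change (v.1.bind (LWord.graftArgs w.1)).Rep t ℓ at hu
  have hw := hu.right_of_graft v.2 w.2
  refine ⟨⟨v, ?_, rfl⟩, ⟨w, hw, rfl⟩, hu.block_of_graft v.2 w.2⟩
  have h4 := hu.of_bind v.2
  have h5 : ρ = fun o => t (LWord.graftArgs w.1 o).2 := by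
    funext o
    rcases o with _ | x
    · obtain ⟨y, hy⟩ := hex
      exact le_antisymm (hy ▸ hw.le_last y) (hmax _)
    · exact hρ x
  rw [h5]
  exact h4

end Represents

/-! ### Inputs of the vertices of a reduced tree. -/

section ReducedTrees

variable {n : ℕ} {T : Finset (Finset (Fin n))} {U v W : Finset (Fin n)}

theorem IsReducedTree.two_le_card (hT : IsReducedTree T) (hn : 2 ≤ n)
    (hv : v = Finset.univ ∨ v ∈ T) : 2 ≤ v.card := by
  rcases hv with rfl | hv
  · simpa using hn
  · exact (hT.1 v hv).1

theorem IsChild.nonempty (hT : IsReducedTree T) (hW : IsChild T v W) : W.Nonempty := by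
  rcases hW.1 with h | h
  · exact Finset.card_pos.1 (by have := (hT.1 W h).1; omega)
  · exact Finset.card_pos.1 (by omega)

/-- The child is a largest member of `T` which contains `a` and lies properly inside `v`, or the
leaf `{a}` if there is none. -/
theorem exists_child_mem {a : Fin n} (hv : 2 ≤ v.card) (ha : a ∈ v) : ∃ W, IsChild T v W ∧ a ∈ W := by
  classical
  obtain ⟨W, hW, hmax⟩ := Finset.exists_max_image
    (insert {a} (T.filter fun V => a ∈ V ∧ V ⊂ v)) Finset.card ⟨_, Finset.mem_insert_self _ _⟩
  have haW : a ∈ W ∧ W ⊂ v ∧ (W ∈ T ∨ W.card = 1) := by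
    rcases Finset.mem_insert.1 hW with rfl | hW
    · refine ⟨by simp, ?_, by simp⟩
      refine (Finset.ssubset_iff_subset_ne).2 ⟨by simpa using ha, ?_⟩
      rintro rfl
      simp at hv
    · obtain ⟨h1, h2, h3⟩ := Finset.mem_filter.1 hW
      exact ⟨h2, h3, Or.inl h1⟩
  refine ⟨W, ⟨haW.2.2, haW.2.1, fun W' hW' h1 h2 => ?_⟩, haW.1⟩
  exact absurd (Finset.card_lt_card h1) (not_lt.2 (hmax W' (Finset.mem_insert_of_mem
    (Finset.mem_filter.2 ⟨hW', h1.1 haW.1, h2⟩))))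

/-- Members of `T` are nested or disjoint, and nested children would contradict the maximality in
`IsChild`; a leaf is treated in the same way. -/
theorem IsChild.disjoint (hT : IsReducedTree T) {W W' : Finset (Fin n)} (hW : IsChild T v W)
    (hW' : IsChild T v W') (hne : W ≠ W') : Disjoint W W' := by
  have key : ∀ {W W' : Finset (Fin n)}, IsChild T v W → IsChild T v W' → W ≠ W' → W.card = 1 →
      Disjoint W W' := by
    intro W W' hW hW' hne h
    obtain ⟨a, rfl⟩ := Finset.card_eq_one.1 h
    rw [Finset.disjoint_singleton_left]
    intro ha
    rcases hW'.1 with h' | h'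
    · exact hW.2.2 W' h' (Finset.ssubset_iff_subset_ne.2 ⟨by simpa using ha, hne⟩) hW'.2.1
    · obtain ⟨b, rfl⟩ := Finset.card_eq_one.1 h'
      rw [Finset.mem_singleton] at ha
      exact hne (by rw [ha])
  rcases hW.1 with h | h
  · rcases hW'.1 with h' | h'
    · rcases hT.2 W h W' h' with h1 | h1 | h1
      · exact absurd hW'.2.1 (hW.2.2 W' h' (Finset.ssubset_iff_subset_ne.2 ⟨h1, hne⟩))
      · exact absurd hW.2.1 (hW'.2.2 W h (Finset.ssubset_iff_subset_ne.2 ⟨h1, hne.symm⟩))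
      · exact h1
    · exact (key hW' hW hne.symm h').symm
  · exact key hW hW' hne h

/-- The set `U` is an interval for the order given by the rank `r`. -/
def IsIntervalFor (r : Fin n → ℕ) (U : Finset (Fin n)) : Prop :=
  ∀ a ∈ U, ∀ b ∈ U, ∀ c, r a < r c → r c < r b → c ∈ U

theorem exists_mem_sup_eq {r : Fin n → ℕ} (hW : W.Nonempty) : ∃ a ∈ W, W.sup r = r a :=
  Finset.exists_mem_eq_sup W hW r

theorem IsReducedTree.sup_injective (hT : IsReducedTree T) {r : Fin n → ℕ}
    (hr : Function.Injective r) :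
    Function.Injective fun W : TreeIn T v => W.1.sup r := by
  intro W W' h
  by_contra hne
  obtain ⟨a, ha, h1⟩ := exists_mem_sup_eq (r := r) (W.2.nonempty hT)
  obtain ⟨b, hb, h2⟩ := exists_mem_sup_eq (r := r) (W'.2.nonempty hT)
  have hab : a = b := hr (by rw [← h1, ← h2]; exact h)
  subst hab
  exact Finset.disjoint_left.1 (W.2.disjoint hT W'.2 fun h => hne (Subtype.ext h)) ha hb

/-- The children of a vertex which is an interval are not separated by disjoint sets. -/
theorem sup_lt_sup_of_isIntervalFor {r : Fin n → ℕ} (hr : Function.Injective r)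
    (hU : IsIntervalFor r U) {A B C : Finset (Fin n)} (hA : A.Nonempty) (hB : B.Nonempty)
    (hC : C.Nonempty) (hAU : A ⊆ U) (hBU : B ⊆ U) (hCU : Disjoint C U)
    (h : C.sup r < A.sup r) : C.sup r < B.sup r := by
  obtain ⟨a, ha, h1⟩ := exists_mem_sup_eq (r := r) hA
  obtain ⟨b, hb, h2⟩ := exists_mem_sup_eq (r := r) hB
  obtain ⟨c, hc, h3⟩ := exists_mem_sup_eq (r := r) hC
  rw [h1, h3] at h
  rw [h2, h3]
  by_contra hbc
  have hcU := Finset.disjoint_left.1 hCU hc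
  have hne : r b ≠ r c := fun h => hcU (hr h ▸ hBU hb)
  exact hcU (hU b (hBU hb) a (hAU ha) c (by omega) h)

/-- If the sets `A`, `B` inside `U` and the set `C` are disjoint intervals, and `C` is not
separated by `A` and `B`, then no element of `C` is between `A` and `B`. -/
theorem not_between_of_sup {r : Fin n → ℕ} (hr : Function.Injective r) {A B C : Finset (Fin n)}
    (hA : IsIntervalFor r A) (hC : IsIntervalFor r C) (hAC : Disjoint A C) (hBC : Disjoint B C)
    (h : C.sup r < B.sup r → C.sup r < A.sup r) {a b c : Fin n} (ha : a ∈ A) (hb : b ∈ B)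
    (hc : c ∈ C) (h1 : r a < r c) (h2 : r c < r b) : False := by
  obtain ⟨a', ha', e1⟩ := exists_mem_sup_eq (r := r) ⟨a, ha⟩
  obtain ⟨c', hc', e3⟩ := exists_mem_sup_eq (r := r) ⟨c, hc⟩
  have hb' : r b ≤ B.sup r := Finset.le_sup hb
  have hc'' : r c ≤ C.sup r := Finset.le_sup hc
  have h3 : C.sup r < B.sup r := by
    refine lt_of_lt_of_le ?_ hb'
    rw [e3]
    by_contra h4
    have hne : r b ≠ r c' := fun h => Finset.disjoint_left.1 hBC hb (hr h ▸ hc')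
    exact Finset.disjoint_left.1 hBC hb (hC c hc c' hc' b h2 (by omega))
  have h4 := h h3
  have h5 : ¬ r c < r a' := fun h5 =>
    Finset.disjoint_left.1 hAC (hA a ha a' ha' c h1 h5) hc
  omega

theorem isIntervalFor_of_card_eq_one {r : Fin n → ℕ} (hW : W.card = 1) : IsIntervalFor r W := by
  obtain ⟨x, rfl⟩ := Finset.card_eq_one.1 hW
  intro a ha b hb c h1 h2
  rw [Finset.mem_singleton] at ha hb
  subst ha hb
  omega

theorem isIntervalFor_univ {r : Fin n → ℕ} : IsIntervalFor r (Finset.univ : Finset (Fin n)) :=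
  fun _ _ _ _ c _ _ => Finset.mem_univ c

end ReducedTrees

/-! ### Trees decorated by words, as words with intervals. -/

section Decorations

variable {k : Type u} [Field k] {m n : ℕ} {T : Finset (Finset (Fin n))} {U : Finset (Fin n)}

/-- The operations at the vertices of the tree `T` are the words which are induced by the word on
the leaves given by the rank `r` and the labels `ℓ`. -/
def DecRep (x : TreeDec (asOperad k m) T) (r : Fin n → ℕ) (ℓ : ℕ → Fin m) : Prop :=
  ∀ v : TreeVert T, Represents (x v) (fun W => W.1.sup r) ℓ

theorem DecRep.unique {x y : TreeDec (asOperad k m) T} {r : Fin n → ℕ} {ℓ : ℕ → Fin m}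
    (hx : DecRep x r ℓ) (hy : DecRep y r ℓ) : x = y :=
  funext fun v => (hx v).unique (hy v)

theorem exists_wordElem_map {X Y : Type} [Finite X] [Finite Y] (f : X ≃ Y)
    {p : (asOperad k m).obj X} (hp : ∃ w, p = wordElem k w) :
    ∃ w, (asOperad k m).map f p = wordElem k w := by
  obtain ⟨w, rfl⟩ := hp
  exact ⟨_, map_wordElem f w⟩

theorem exists_wordElem_comp {X Y : Type} [Finite X] [Finite Y]
    {p : (asOperad k m).obj (Option X)} {q : (asOperad k m).obj Y}
    (hp : ∃ w, p = wordElem k w) (hq : ∃ w, q = wordElem k w) :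
    ∃ w, (asOperad k m).comp p q = wordElem k w := by
  obtain ⟨w, rfl⟩ := hp
  obtain ⟨w', rfl⟩ := hq
  obtain ⟨h, h'⟩ := comp_wordElem (k := k) w w'
  exact ⟨_, h'⟩

theorem exists_decRep (hn : 2 ≤ n) (hT : IsReducedTree T) {r : Fin n → ℕ}
    (hr : Function.Injective r) (ℓ : ℕ → Fin m) :
    ∃ x : TreeDec (asOperad k m) T, DecRep x r ℓ := by
  have : ∀ v : TreeVert T, ∃ p : (asOperad k m).obj (TreeIn T v.1),
      Represents p (fun W => W.1.sup r) ℓ := by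
    intro v
    have h2 := hT.two_le_card hn v.2
    obtain ⟨a, ha⟩ := Finset.card_pos.1 (by omega : 0 < v.1.card)
    obtain ⟨W, hW, -⟩ := exists_child_mem (T := T) h2 ha
    have : Nonempty (TreeIn T v.1) := ⟨⟨W, hW⟩⟩
    exact exists_represents (hT.sup_injective hr) ℓ
  choose x hx using this
  exact ⟨x, hx⟩

open Classical in
theorem contract_of_isChild (hT : IsReducedTree T) (hU : U ∈ T) (x : TreeDec (asOperad k m) T)
    (v : TreeVert (T.erase U)) (h : IsChild T v.1 U) :
    contract (asOperad k m) hT hU x v = (asOperad k m).map (contractEquiv hT hU h)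
      ((asOperad k m).comp
        ((asOperad k m).map (Equiv.optionSubtypeNe (⟨U, h⟩ : TreeIn T v.1)).symm (x v.ofErase))
        (x ⟨U, Or.inr hU⟩)) := by
  rw [contract, dif_pos h]

theorem contract_of_not_isChild (hT : IsReducedTree T) (hU : U ∈ T)
    (x : TreeDec (asOperad k m) T) (v : TreeVert (T.erase U)) (h : ¬ IsChild T v.1 U) :
    contract (asOperad k m) hT hU x v =
      (asOperad k m).map (Equiv.subtypeEquivRight (isChild_erase_of_not hU h)) (x v.ofErase) := by
  rw [contract, dif_neg h]

/-- The ranks of the inputs of `v`, with the input `U` in the place of `none`. -/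
def parentRank (r : Fin n → ℕ) {v : Finset (Fin n)} (h : IsChild T v U) :
    Option {W : TreeIn T v // W ≠ ⟨U, h⟩} → ℕ := fun o => o.elim (U.sup r) fun W => W.1.1.sup r

open Classical in
theorem parentRank_symm (r : Fin n → ℕ) {v : Finset (Fin n)} (h : IsChild T v U)
    (W : TreeIn T v) :
    parentRank r h ((Equiv.optionSubtypeNe (⟨U, h⟩ : TreeIn T v)).symm W) = W.1.sup r := by
  by_cases hW : W = ⟨U, h⟩
  · subst hW
    rw [Equiv.optionSubtypeNe_symm_self]
    rfl
  · rw [Equiv.optionSubtypeNe_symm_of_ne hW]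
    rfl

theorem child_sup_le (r : Fin n → ℕ) (W : TreeIn T U) : W.1.sup r ≤ U.sup r :=
  Finset.sup_mono W.2.2.1.1

theorem exists_child_sup_eq (r : Fin n → ℕ) (hU : 2 ≤ U.card) :
    ∃ W : TreeIn T U, W.1.sup r = U.sup r := by
  obtain ⟨a, ha, h1⟩ := exists_mem_sup_eq (r := r) (Finset.card_pos.1 (by omega : 0 < U.card))
  obtain ⟨W, hW, haW⟩ := exists_child_mem (T := T) hU ha
  refine ⟨⟨W, hW⟩, le_antisymm (child_sup_le r _) ?_⟩
  rw [h1]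
  exact Finset.le_sup haW

/-- The word at `U` is inserted into the word at its parent in the place of the input `U`, whose
rank is that of its last child. Since `U` is an interval, no other input of the parent falls between
the children of `U`. -/
theorem DecRep.contract (hT : IsReducedTree T) (hU : U ∈ T) {x : TreeDec (asOperad k m) T}
    {r : Fin n → ℕ} (hr : Function.Injective r) {ℓ : ℕ → Fin m} (hx : DecRep x r ℓ)
    (hUr : IsIntervalFor r U) : DecRep (contract (asOperad k m) hT hU x) r ℓ := by
  classical
  intro v
  by_cases h : IsChild T v.1 U
  · rw [contract_of_isChild hT hU x v h]
    refine Represents.map _ (Represents.comp (ρ := parentRank r h) (fun _ => rfl)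
      (fun W => child_sup_le r W) (exists_child_sup_eq r (hT.1 U hU).1) ?_ ?_ (hx ⟨U, Or.inr hU⟩))
    · intro W Y Y'
      exact sup_lt_sup_of_isIntervalFor hr hUr (Y.2.nonempty hT) (Y'.2.nonempty hT)
        (W.1.2.nonempty hT) Y.2.2.1.1 Y'.2.2.1.1
        (W.1.2.disjoint hT h fun h' => W.2 (Subtype.ext h'))
    · refine Represents.map _ ?_
      simp only [parentRank_symm]
      exact hx v.ofErase
  · rw [contract_of_not_isChild hT hU x v h]
    exact Represents.map _ (hx v.ofErase)

/-- If the contraction of an edge is induced by a word, then so is the original decoration. -/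
theorem DecRep.of_contract (hT : IsReducedTree T) (hU : U ∈ T) (x : TreeDec (asOperad k m) T)
    (hxw : ∀ v, ∃ w, x v = wordElem k w)
    {r : Fin n → ℕ} (hr : Function.Injective r) {ℓ : ℕ → Fin m}
    (hx : DecRep (_root_.contract (asOperad k m) hT hU x) r ℓ)
    (hTr : ∀ W ∈ T.erase U, IsIntervalFor r W) :
    DecRep x r ℓ ∧ IsIntervalFor r U := by
  classical
  obtain ⟨v₀, hv₀⟩ := exists_parent hT hU
  have h1 := hx v₀
  rw [contract_of_isChild hT hU x v₀ hv₀] at h1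
  have h2 := h1.of_map
  obtain ⟨w₁, hw₁⟩ : ∃ w : MWord m (TreeIn T v₀.1),
    (x v₀.ofErase : (asOperad k m).obj (TreeIn T v₀.1)) = wordElem k w := hxw v₀.ofErase
  obtain ⟨w₂, hw₂⟩ : ∃ w : MWord m (TreeIn T U),
    (x ⟨U, Or.inr hU⟩ : (asOperad k m).obj (TreeIn T U)) = wordElem k w := hxw ⟨U, Or.inr hU⟩
  rw [hw₁, hw₂, map_wordElem] at h2
  obtain ⟨h3, h4, h5⟩ := h2.of_comp _ w₂ (ρ := parentRank r hv₀) (fun _ => rfl)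
      (fun W => child_sup_le r W) (exists_child_sup_eq r (hT.1 U hU).1)
  rw [← map_wordElem, ← hw₁] at h3
  rw [← hw₂] at h4
  have h6 := h3.of_map
  simp only [parentRank_symm] at h6
  constructor
  · intro v
    by_cases hvU : v.1 = U
    · obtain ⟨v, hv⟩ := v
      subst hvU
      exact h4
    · let v' : TreeVert (T.erase U) := ⟨v.1, v.2.imp_right fun h => Finset.mem_erase.2 ⟨hvU, h⟩⟩
      by_cases h : IsChild T v'.1 U
      · have : v' = v₀ := parent_unique hT hU h hv₀
        have h' : v = v₀.ofErase := Subtype.ext (show v.1 = v₀.1 by rw [← this])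
        rw [h']
        exact h6
      · have h7 := hx v'
        rw [contract_of_not_isChild hT hU x v' h] at h7
        exact h7.of_map
  -- A leaf `c` outside `U`, but between the leaves `a` and `b` of `U`, lies in the parent of `U`,
  -- which is an interval, hence in another child of the parent. By the block property `h5` this
  -- child does not separate the children of `U`.
  · intro a ha b hb c hac hcb
    by_contra hcU
    have hUc := (hT.1 U hU).1
    have hint : ∀ W, (W ∈ T ∨ W.card = 1) → W ≠ U → IsIntervalFor r W := by
      intro W hW hWU
      rcases hW with hW | hW
      · exact hTr W (Finset.mem_erase.2 ⟨hWU, hW⟩)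
      · exact isIntervalFor_of_card_eq_one hW
    have hv : IsIntervalFor r v₀.1 := by
      rcases v₀.2 with h | h
      · rw [h]; exact isIntervalFor_univ
      · exact hTr _ h
    have hcv := hv a (hv₀.2.1.1 ha) b (hv₀.2.1.1 hb) c hac hcb
    have hv2 : 2 ≤ v₀.1.card := hUc.trans (Finset.card_le_card hv₀.2.1.1)
    obtain ⟨C, hC, hcC⟩ := exists_child_mem (T := T) hv2 hcv
    obtain ⟨A, hA, haA⟩ := exists_child_mem (T := T) hUc ha
    obtain ⟨B, hB, hbB⟩ := exists_child_mem (T := T) hUc hb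
    have hCne : C ≠ U := by rintro rfl; exact hcU hcC
    have hCU : Disjoint U C := (hC.disjoint hT hv₀ hCne).symm
    exact not_between_of_sup hr (hint A hA.1 hA.2.1.ne) (hint C hC.1 hCne)
      (hCU.mono_left hA.2.1.1) (hCU.mono_left hB.2.1.1)
      (h5 ⟨⟨C, hC⟩, fun h => hCne (congrArg Subtype.val h)⟩ ⟨B, hB⟩ ⟨A, hA⟩) haA hbB hcC hac hcb

/-- The inputs of the root of the corolla. -/
noncomputable def corollaEquiv (hn : 2 ≤ n) :
    TreeIn (∅ : Finset (Finset (Fin n))) Finset.univ ≃ Fin n :=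
  (Equiv.ofBijective (fun a : Fin n =>
    (⟨{a}, Or.inr (Finset.card_singleton a), by
      rw [Finset.ssubset_univ_iff]
      intro h
      have := congrArg Finset.card h
      simp at this
      omega, fun _ h => absurd h (Finset.notMem_empty _)⟩ :
      TreeIn (∅ : Finset (Finset (Fin n))) Finset.univ))
    ⟨fun a b h => Finset.singleton_injective (congrArg Subtype.val h), fun W => by
      rcases W.2.1 with h | h
      · exact absurd h (Finset.notMem_empty _)
      · obtain ⟨a, ha⟩ := Finset.card_eq_one.1 h
        exact ⟨a, Subtype.ext ha.symm⟩⟩).symm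

theorem corollaEquiv_rank (hn : 2 ≤ n) (r : Fin n → ℕ)
    (W : TreeIn (∅ : Finset (Finset (Fin n))) Finset.univ) :
    r (corollaEquiv hn W) = W.1.sup r := by
  obtain ⟨a, rfl⟩ := (corollaEquiv hn).symm.surjective W
  rw [Equiv.apply_symm_apply]
  exact (Finset.sup_singleton).symm

theorem treeVert_empty (v : TreeVert (∅ : Finset (Finset (Fin n)))) :
    v = ⟨Finset.univ, Or.inl rfl⟩ :=
  Subtype.ext (v.2.resolve_right (Finset.notMem_empty _))

/-- The rank of the letters of a word. -/
noncomputable def MWord.rank [NeZero m] (w : MWord m (Fin n)) : Fin n → ℕ := w.2.exists_rep.choose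

/-- The labels of a word. -/
noncomputable def MWord.label [NeZero m] (w : MWord m (Fin n)) : ℕ → Fin m :=
  w.2.exists_rep.choose_spec.choose

theorem MWord.rep [NeZero m] (w : MWord m (Fin n)) : w.1.Rep (MWord.rank w) (MWord.label w) :=
  w.2.exists_rep.choose_spec.choose_spec.1

theorem MWord.rank_injective [NeZero m] (w : MWord m (Fin n)) :
    Function.Injective (MWord.rank w) :=
  w.2.exists_rep.choose_spec.choose_spec.2.1

theorem MWord.rank_lt [NeZero m] (w : MWord m (Fin n)) (x : Fin n) : MWord.rank w x < n := by
  exact lt_of_lt_of_eq (w.2.exists_rep.choose_spec.choose_spec.2.2 x) (Nat.card_fin n)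

/-- The tree `T` with the words `x` at its vertices is the tree `T` with the words induced by
`w`. -/
def Induced [NeZero m] (T : Finset (Finset (Fin n))) (x : TreeDec (asOperad k m) T)
    (w : MWord m (Fin n)) : Prop :=
  (∀ U ∈ T, IsIntervalFor (MWord.rank w) U) ∧ DecRep x (MWord.rank w) (MWord.label w)

/-- Contracting the internal edges one by one leaves a corolla decorated by a single word `w`. On
the way back, each contracted edge turns out to be an interval for `w`, and the decoration to be
induced by `w`. -/
theorem exists_induced [NeZero m] (hn : 2 ≤ n) : ∀ (i : ℕ) (T : Finset (Finset (Fin n))),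
    T.card = i → IsReducedTree T → ∀ (x : TreeDec (asOperad k m) T),
    (∀ v, ∃ w, x v = wordElem k w) → ∃ w, Induced T x w := by
  classical
  intro i
  induction i with
  | zero =>
    intro T hi hT x hx
    obtain rfl := Finset.card_eq_zero.1 hi
    obtain ⟨w₀, hw₀⟩ := hx ⟨Finset.univ, Or.inl rfl⟩
    refine ⟨⟨w₀.1.map (corollaEquiv hn), w₀.2.map _⟩, fun U hU => absurd hU (by simp), ?_⟩
    intro v
    obtain rfl := treeVert_empty v
    simp only [← corollaEquiv_rank hn]
    refine Represents.of_map (corollaEquiv hn) ?_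
    rw [hw₀, map_wordElem]
    exact ⟨_, MWord.rep _, rfl⟩
  | succ i ih =>
    intro T hi hT x hx
    obtain ⟨U, hU⟩ : T.Nonempty := Finset.card_pos.1 (by omega)
    obtain ⟨w, hw, hw'⟩ := ih (T.erase U) (by rw [Finset.card_erase_of_mem hU, hi]; rfl)
      (hT.erase U) (contract (asOperad k m) hT hU x) (by
        intro v
        by_cases h : IsChild T v.1 U
        · rw [contract_of_isChild hT hU x v h]
          exact exists_wordElem_map _ (exists_wordElem_comp
            (exists_wordElem_map _ (hx v.ofErase)) (hx ⟨U, Or.inr hU⟩))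
        · rw [contract_of_not_isChild hT hU x v h]
          exact exists_wordElem_map _ (hx v.ofErase))
    obtain ⟨h1, h2⟩ := DecRep.of_contract hT hU x hx (MWord.rank_injective w) hw' hw
    refine ⟨w, fun W hW => ?_, h1⟩
    by_cases h : W = U
    · rw [h]; exact h2
    · exact hw W (Finset.mem_erase.2 ⟨h, hW⟩)

/-- Contraction preserves induced decorations, and on a corolla the decoration is the word itself.
-/
theorem Induced.unique [NeZero m] (hn : 2 ≤ n) : ∀ (i : ℕ) (T : Finset (Finset (Fin n))),
    T.card = i → IsReducedTree T → ∀ (x : TreeDec (asOperad k m) T) (w w' : MWord m (Fin n)),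
    Induced T x w → Induced T x w' → w = w' := by
  intro i
  induction i with
  | zero =>
    intro T hi hT x w w' hw hw'
    obtain rfl := Finset.card_eq_zero.1 hi
    have key : ∀ w, Induced ∅ x w → wordElem k w = (asOperad k m).map (corollaEquiv hn)
        (x ⟨Finset.univ, Or.inl rfl⟩) := by
      intro w hw
      have h := hw.2 ⟨Finset.univ, Or.inl rfl⟩
      simp only [← corollaEquiv_rank hn] at h
      exact Represents.unique ⟨w, MWord.rep w, rfl⟩ (h.map (corollaEquiv hn))
    exact wordElem_injective ((key w hw).trans (key w' hw').symm)
  | succ i ih =>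
    intro T hi hT x w w' hw hw'
    obtain ⟨U, hU⟩ : T.Nonempty := Finset.card_pos.1 (by omega)
    have key : ∀ w, Induced T x w → Induced (T.erase U) (contract (asOperad k m) hT hU x) w :=
      fun w hw => ⟨fun W hW => hw.1 W (Finset.mem_of_mem_erase hW),
        hw.2.contract hT hU (MWord.rank_injective w) (hw.1 U hU)⟩
    exact ih (T.erase U) (by rw [Finset.card_erase_of_mem hU, hi]; rfl)
      (hT.erase U) _ w w' (key w hw) (key w' hw')

end Decorations

/-! ### Intervals of a word as diagonals of a polygon. -/

section Intervals

variable {n : ℕ} {r : Fin n → ℕ}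

/-- The set of elements whose rank is in the interval `[p.1, p.2)`. -/
def rankInterval (r : Fin n → ℕ) (p : ℕ × ℕ) : Finset (Fin n) :=
  Finset.univ.filter fun x => p.1 ≤ r x ∧ r x < p.2

theorem mem_rankInterval {p : ℕ × ℕ} {x : Fin n} :
    x ∈ rankInterval r p ↔ p.1 ≤ r x ∧ r x < p.2 := by
  simp [rankInterval]

theorem exists_rank_eq (hr : Function.Injective r) (hlt : ∀ x, r x < n) {i : ℕ} (hi : i < n) :
    ∃ x, r x = i := by
  have h : Function.Injective fun x => (⟨r x, hlt x⟩ : Fin n) :=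
    fun x y h => hr (congrArg Fin.val h)
  obtain ⟨x, hx⟩ := (Finite.injective_iff_surjective.1 h) ⟨i, hi⟩
  exact ⟨x, congrArg Fin.val hx⟩

theorem chords_range {p : ℕ × ℕ} (hp : p ∈ chords (Finset.range (n + 1))) :
    p.1 + 2 ≤ p.2 ∧ p.2 ≤ n ∧ (0 < p.1 ∨ p.2 < n) := by
  obtain ⟨h1, h2, ⟨c, hc, h3⟩, ⟨d, hd, h4⟩⟩ := mem_chords.1 hp
  rw [Finset.mem_range] at h1 h2 hc hd
  omega

theorem rankInterval_subset_iff (hr : Function.Injective r) (hlt : ∀ x, r x < n) {p q : ℕ × ℕ}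
    (hp : p.1 < p.2) (hp' : p.2 ≤ n) :
    rankInterval r p ⊆ rankInterval r q ↔ q.1 ≤ p.1 ∧ p.2 ≤ q.2 := by
  constructor
  · intro h
    obtain ⟨x, hx⟩ := exists_rank_eq hr hlt (show p.1 < n by omega)
    obtain ⟨y, hy⟩ := exists_rank_eq hr hlt (show p.2 - 1 < n by omega)
    have h1 := mem_rankInterval.1 (h (mem_rankInterval.2 (show p.1 ≤ r x ∧ r x < p.2 by omega)))
    have h2 := mem_rankInterval.1 (h (mem_rankInterval.2 (show p.1 ≤ r y ∧ r y < p.2 by omega)))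
    omega
  · intro h x hx
    rw [mem_rankInterval] at hx ⊢
    omega

theorem disjoint_rankInterval_iff (hr : Function.Injective r) (hlt : ∀ x, r x < n) {p q : ℕ × ℕ}
    (hp : p.1 < p.2) (hp' : p.2 ≤ n) (hq : q.1 < q.2) (hq' : q.2 ≤ n) :
    Disjoint (rankInterval r p) (rankInterval r q) ↔ p.2 ≤ q.1 ∨ q.2 ≤ p.1 := by
  rw [Finset.disjoint_left]
  simp only [mem_rankInterval]
  constructor
  · intro h
    obtain ⟨x, hx⟩ := exists_rank_eq hr hlt (show max p.1 q.1 < n by omega)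
    have := @h x
    omega
  · intro h x hx
    omega

/-- The relation of being nested or disjoint. -/
def Nested {α : Type*} (U V : Finset α) : Prop := U ⊆ V ∨ V ⊆ U ∨ Disjoint U V

theorem Nested.symm {α : Type*} {U V : Finset α} (h : Nested U V) : Nested V U := by
  rcases h with h | h | h
  · exact Or.inr (Or.inl h)
  · exact Or.inl h
  · exact Or.inr (Or.inr h.symm)

open Classical in
/-- The intervals which may be the internal edges of a reduced tree. -/
noncomputable def properIntervals (r : Fin n → ℕ) : Finset (Finset (Fin n)) :=
  (chords (Finset.range (n + 1))).image (rankInterval r)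

/-- A polygon vertex strictly between the ends of a diagonal gives the interval two elements, and a
polygon vertex outside gives an element not in it. -/
theorem mem_properIntervals (hr : Function.Injective r) (hlt : ∀ x, r x < n)
    {U : Finset (Fin n)} :
    U ∈ properIntervals r ↔ (2 ≤ U.card ∧ U ≠ Finset.univ) ∧ IsIntervalFor r U := by
  classical
  rw [properIntervals, Finset.mem_image]
  constructor
  · rintro ⟨p, hp, rfl⟩
    obtain ⟨h1, h2, h3⟩ := chords_range hp
    refine ⟨⟨?_, ?_⟩, ?_⟩
    · obtain ⟨x, hx⟩ := exists_rank_eq hr hlt (show p.1 < n by omega)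
      obtain ⟨y, hy⟩ := exists_rank_eq hr hlt (show p.1 + 1 < n by omega)
      refine Finset.one_lt_card.2 ⟨x, mem_rankInterval.2 (by omega), y,
        mem_rankInterval.2 (by omega), ?_⟩
      rintro rfl
      omega
    · intro h
      have h' : ∀ x, p.1 ≤ r x ∧ r x < p.2 := fun x =>
        mem_rankInterval.1 (h ▸ Finset.mem_univ x)
      rcases h3 with h3 | h3
      · obtain ⟨x, hx⟩ := exists_rank_eq hr hlt (show 0 < n by omega)
        have := h' x
        omega
      · obtain ⟨x, hx⟩ := exists_rank_eq hr hlt h3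
        have := h' x
        omega
    · intro a ha b hb c h1 h2
      rw [mem_rankInterval] at ha hb ⊢
      omega
  · rintro ⟨⟨h1, h2⟩, h3⟩
    have hne : U.Nonempty := Finset.card_pos.1 (by omega)
    obtain ⟨a, ha, hmin⟩ := Finset.exists_min_image U r hne
    obtain ⟨b, hb, hmax⟩ := Finset.exists_max_image U r hne
    have hmem : ∀ x, r a ≤ r x → r x ≤ r b → x ∈ U := by
      intro x hx hx'
      rcases hx.eq_or_lt with h | h
      · exact hr h ▸ ha
      rcases hx'.eq_or_lt with h' | h'
      · exact hr h' ▸ hb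
      exact h3 a ha b hb x h h'
    have hab : r a < r b := by
      obtain ⟨x, hx, y, hy, hxy⟩ := Finset.one_lt_card.1 h1
      have e1 := hmin x hx
      have e2 := hmax x hx
      have e3 := hmin y hy
      have e4 := hmax y hy
      have e5 : r x ≠ r y := fun h => hxy (hr h)
      omega
    -- The intervals are half-open, so the end after the last leaf `b` is `r b + 1`; therefore the
    -- polygon has the `n + 1` vertices `0, …, n`.
    refine ⟨(r a, r b + 1), mem_chords.2 ⟨?_, ?_, ⟨r b, ?_, hab, Nat.lt_succ_self _⟩, ?_⟩, ?_⟩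
    · have := hlt a
      rw [Finset.mem_range]; dsimp only; omega
    · have := hlt b
      rw [Finset.mem_range]; dsimp only; omega
    · have := hlt b
      rw [Finset.mem_range]; omega
    · obtain ⟨x, hx⟩ : ∃ x, x ∉ U := by
        by_contra h
        push Not at h
        exact h2 (Finset.eq_univ_iff_forall.2 h)
      have hx' : r x < r a ∨ r b < r x := by
        by_contra h
        push Not at h
        exact hx (hmem x h.1 h.2)
      have := hlt x
      rcases hx' with h | h
      · exact ⟨r x, Finset.mem_range.2 (by omega), Or.inl h⟩
      · exact ⟨r x + 1, Finset.mem_range.2 (by omega), Or.inr (by dsimp only; omega)⟩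
    · ext x
      rw [mem_rankInterval]
      exact ⟨fun h => hmem x h.1 (by have := h.2; dsimp only at this; omega),
        fun h => ⟨hmin x h, Nat.lt_succ_of_le (hmax x h)⟩⟩

theorem isSimplex_properIntervals_iff (hr : Function.Injective r) (hlt : ∀ x, r x < n)
    {T : Finset (Finset (Fin n))} :
    IsSimplex Nested (properIntervals r) T ↔ IsReducedTree T ∧ ∀ U ∈ T, IsIntervalFor r U := by
  constructor
  · rintro ⟨h1, h2⟩
    refine ⟨⟨fun U hU => ((mem_properIntervals hr hlt).1 (h1 hU)).1, fun U hU V hV => ?_⟩,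
      fun U hU => ((mem_properIntervals hr hlt).1 (h1 hU)).2⟩
    by_cases h : U = V
    · exact Or.inl h.subset
    · exact h2 hU hV h
  · rintro ⟨h1, h2⟩
    exact ⟨fun U hU => (mem_properIntervals hr hlt).2 ⟨h1.1 U hU, h2 U hU⟩,
      fun U hU V hV _ => h1.2 U hU V hV⟩

/-- Intervals are nested or disjoint exactly when the diagonals do not cross, and the polygon has `n
+ 1 = (n - 2) + 3` vertices. -/
theorem exactOff_properIntervals {k : Type*} [Field k] (hn : 2 ≤ n) (hr : Function.Injective r)
    (hlt : ∀ x, r x < n) :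
    ExactOff k (fun U : Finset (Fin n) => toColex U) Nested (properIntervals r) (n - 2) := by
  classical
  have h1 := sphereLike_chords (n - 2) (Finset.range (n + 1)) (by rw [Finset.card_range]; omega)
  refine SphereLike.exactOff (fun U V h => toColex.injective h) (fun U V h => h.symm) ?_
  refine h1.image (rankInterval r) ?_ ?_
  · intro p hp q hq h
    have hp' := chords_range hp
    have hq' := chords_range hq
    have e1 := (rankInterval_subset_iff hr hlt (by omega) hp'.2.1).1 h.subset
    have e2 := (rankInterval_subset_iff hr hlt (by omega) hq'.2.1).1 h.symm.subset
    exact Prod.ext (by omega) (by omega)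
  · intro p hp q hq
    have hp' := chords_range hp
    have hq' := chords_range hq
    rw [Nested, rankInterval_subset_iff hr hlt (by omega) hp'.2.1,
      rankInterval_subset_iff hr hlt (by omega) hq'.2.1,
      disjoint_rankInterval_iff hr hlt (by omega) hp'.2.1 (by omega) hq'.2.1, NonCrossing]
    omega

end Intervals

/-! ### The cobar complex and the Koszul property. -/

section Koszul

variable {k : Type u} [Field k] {m n : ℕ}

theorem cobarD_apply {i : ℕ} (φ : CobarTerm (asOperad k m) n i) (T : TreesWith n (i + 1))
    (x : TreeDec (asOperad k m) T.1) :
    cobarD (asOperad k m) n i φ T x = ∑ U : {U // U ∈ T.1}, edgeSign k T.1 U.1 *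
      φ ⟨T.1.erase U.1, T.2.1.erase U.1, by rw [Finset.card_erase_of_mem U.2, T.2.2]; rfl⟩
        (contract (asOperad k m) T.2.1 U.2 x) := by
  simp only [cobarD, LinearMap.pi_apply, LinearMap.sum_apply, sum_apply]
  rfl

variable [NeZero m]

theorem coboundary_congr {α β : Type*} [LinearOrder β] [DecidableEq α] {key : α → β}
    {F G : Finset α → k} {T : Finset α} (h : ∀ U ∈ T, F (T.erase U) = G (T.erase U)) :
    coboundary key F T = coboundary key G T :=
  Finset.sum_congr rfl fun U hU => by rw [h U hU]

/-- The decoration of the vertices of `T` induced by the word `w`. -/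
noncomputable def inducedDec (hn : 2 ≤ n) {T : Finset (Finset (Fin n))} (hT : IsReducedTree T)
    (w : MWord m (Fin n)) : TreeDec (asOperad k m) T :=
  (exists_decRep hn hT (MWord.rank_injective w) (MWord.label w)).choose

theorem inducedDec_decRep (hn : 2 ≤ n) {T : Finset (Finset (Fin n))} (hT : IsReducedTree T)
    (w : MWord m (Fin n)) :
    DecRep (inducedDec (k := k) hn hT w) (MWord.rank w) (MWord.label w) :=
  (exists_decRep hn hT (MWord.rank_injective w) (MWord.label w)).choose_spec

open Classical in
/-- The values of a cochain of the cobar complex on the decorations induced by `w`. -/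
noncomputable def cobarEval (hn : 2 ≤ n) {i : ℕ} (φ : CobarTerm (asOperad k m) n i)
    (w : MWord m (Fin n)) (T : Finset (Finset (Fin n))) : k :=
  if h : IsReducedTree T ∧ T.card = i then φ ⟨T, h⟩ (inducedDec hn h.1 w) else 0

theorem cobarEval_of (hn : 2 ≤ n) {i : ℕ} (φ : CobarTerm (asOperad k m) n i)
    (w : MWord m (Fin n)) {T : Finset (Finset (Fin n))} (h : IsReducedTree T ∧ T.card = i) :
    cobarEval hn φ w T = φ ⟨T, h⟩ (inducedDec hn h.1 w) := dif_pos h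

open Classical in
theorem edgeSign_eq_keySign (T : Finset (Finset (Fin n))) (U : Finset (Fin n)) :
    edgeSign k T U = keySign k (fun U : Finset (Fin n) => toColex U) T U := by
  rw [edgeSign, keySign]

/-- Contracting an edge erases an interval and keeps the word. So on the trees belonging to one word
the differential is the simplicial coboundary, with the same signs. -/
theorem cobarEval_cobarD (hn : 2 ≤ n) {i : ℕ} (φ : CobarTerm (asOperad k m) n i)
    (w : MWord m (Fin n)) {T : Finset (Finset (Fin n))} (hT : IsReducedTree T)
    (hi : T.card = i + 1) (hTw : ∀ U ∈ T, IsIntervalFor (MWord.rank w) U) :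
    cobarEval hn (cobarD (asOperad k m) n i φ) w T =
      coboundary (fun U : Finset (Fin n) => toColex U) (cobarEval hn φ w) T := by
  classical
  rw [cobarEval_of hn _ w ⟨hT, hi⟩, cobarD_apply, coboundary]
  refine Eq.trans ?_ (Finset.sum_coe_sort T fun U =>
    keySign k (fun U : Finset (Fin n) => toColex U) T U * cobarEval hn φ w (T.erase U))
  refine Finset.sum_congr rfl fun U _ => ?_
  have hi' : (T.erase U.1).card = i := by rw [Finset.card_erase_of_mem U.2, hi]; rfl
  rw [cobarEval_of hn φ w ⟨hT.erase U.1, hi'⟩, edgeSign_eq_keySign]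
  congr 2
  exact DecRep.unique ((inducedDec_decRep hn hT w).contract hT U.2 (MWord.rank_injective w)
    (hTw _ U.2)) (inducedDec_decRep hn _ w)

/-- A multilinear form is determined by its values on tuples of basis words, and every such tuple is
induced by a word on the leaves. -/
theorem cobarTerm_ext (hn : 2 ≤ n) {i : ℕ} {φ ψ : CobarTerm (asOperad k m) n i}
    (h : ∀ (w : MWord m (Fin n)) (T : Finset (Finset (Fin n))), IsReducedTree T → T.card = i →
      (∀ U ∈ T, IsIntervalFor (MWord.rank w) U) → cobarEval hn φ w T = cobarEval hn ψ w T) :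
    φ = ψ := by
  funext T
  refine Module.Basis.ext_multilinear (fun v : TreeVert T.1 => wordBasis k m (TreeIn T.1 v.1)) ?_
  intro p
  obtain ⟨w, h1, h2⟩ := exists_induced hn i T.1 T.2.2 T.2.1
    (fun v => wordBasis k m (TreeIn T.1 v.1) (p v)) (fun v => ⟨p v, wordBasis_apply ..⟩)
  have h3 := h w T.1 T.2.1 T.2.2 h1
  rw [cobarEval_of hn _ w T.2, cobarEval_of hn _ w T.2] at h3
  rwa [DecRep.unique (inducedDec_decRep hn T.2.1 w) h2] at h3

/-- A decoration by basis words determines the word inducing it, so the values for different pairs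
of a word and a compatible tree can be prescribed independently. -/
theorem exists_cobarEval_eq (hn : 2 ≤ n) (i : ℕ)
    (G : MWord m (Fin n) → Finset (Finset (Fin n)) → k) :
    ∃ φ : CobarTerm (asOperad k m) n i, ∀ (w : MWord m (Fin n)) (T : Finset (Finset (Fin n))),
      IsReducedTree T → T.card = i → (∀ U ∈ T, IsIntervalFor (MWord.rank w) U) →
      cobarEval hn φ w T = G w T := by
  classical
  have key : ∀ T : TreesWith n i, ∃ φ : TreeForm (asOperad k m) T.1, ∀ w : MWord m (Fin n),
      (∀ U ∈ T.1, IsIntervalFor (MWord.rank w) U) → φ (inducedDec hn T.2.1 w) = G w T.1 := by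
    intro T
    have hex : ∀ p : (v : TreeVert T.1) → MWord m (TreeIn T.1 v.1), ∃ w,
        Induced T.1 (fun v => wordElem k (p v)) w := fun p =>
      exists_induced hn i T.1 T.2.2 T.2.1 _ (fun v => ⟨p v, rfl⟩)
    choose W hW using hex
    -- The tuples of basis words give a basis of the tensor product over the vertices, on which a
    -- linear form may take any values.
    let B := Basis.piTensorProduct (fun v : TreeVert T.1 => wordBasis k m (TreeIn T.1 v.1))
    refine ⟨(B.constr k fun p => G (W p) T.1).compMultilinearMap (PiTensorProduct.tprod k), ?_⟩
    intro w hw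
    have hp : ∀ v, ∃ p, inducedDec (k := k) hn T.2.1 w v = wordElem k p := by
      intro v
      obtain ⟨p, -, hp⟩ := inducedDec_decRep (k := k) hn T.2.1 w v
      exact ⟨p, hp⟩
    choose p hp using hp
    have hp' : inducedDec (k := k) hn T.2.1 w = fun v => wordElem k (p v) := funext hp
    have e : W p = w := Induced.unique hn i T.1 T.2.2 T.2.1 _ _ _ (hW p)
      ⟨hw, hp' ▸ inducedDec_decRep hn T.2.1 w⟩
    have e2 : PiTensorProduct.tprod k (fun v => wordElem k (p v)) = B p := by
      rw [Basis.piTensorProduct_apply]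
      simp only [wordBasis_apply]
    rw [hp', LinearMap.compMultilinearMap_apply, e2, Module.Basis.constr_basis, e]
  choose φ hφ using key
  refine ⟨φ, fun w T hT hi hw => ?_⟩
  rw [cobarEval_of hn _ w ⟨hT, hi⟩]
  exact hφ ⟨T, hT, hi⟩ w hw

theorem cobarD_cobarD (hn : 2 ≤ n) {i : ℕ} (φ : CobarTerm (asOperad k m) n i) :
    cobarD (asOperad k m) n (i + 1) (cobarD (asOperad k m) n i φ) = 0 := by
  refine cobarTerm_ext hn fun w T hT hi hw => ?_
  rw [cobarEval_cobarD hn _ w hT hi hw]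
  have e : coboundary (fun U : Finset (Fin n) => toColex U)
      (cobarEval hn (cobarD (asOperad k m) n i φ) w) T =
      coboundary (fun U : Finset (Fin n) => toColex U)
        (coboundary (fun U : Finset (Fin n) => toColex U) (cobarEval hn φ w)) T := by
    refine coboundary_congr fun U hU => ?_
    exact cobarEval_cobarD hn _ w (hT.erase U) (by rw [Finset.card_erase_of_mem hU, hi]; rfl)
      fun V hV => hw V (Finset.mem_of_mem_erase hV)
  rw [e, coboundary_coboundary (fun U V h => toColex.injective h), cobarEval_of hn _ w ⟨hT, hi⟩]
  rfl

/-- The cocycles of the cobar complex are coboundaries on the decorations induced by a word. -/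
theorem exists_coboundary_eq (hn : 2 ≤ n) {i : ℕ} (hi : i ≠ n - 2)
    {φ : CobarTerm (asOperad k m) n i} (hφ : cobarD (asOperad k m) n i φ = 0)
    (w : MWord m (Fin n)) : ∃ G : Finset (Finset (Fin n)) → k, ∀ T : Finset (Finset (Fin n)),
      IsReducedTree T → T.card = i → (∀ U ∈ T, IsIntervalFor (MWord.rank w) U) →
      cobarEval hn φ w T = coboundary (fun U : Finset (Fin n) => toColex U) G T := by
  obtain ⟨G, hG⟩ := exactOff_properIntervals (k := k) hn (MWord.rank_injective w)
    (MWord.rank_lt w) i hi (cobarEval hn φ w) (by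
      intro T hT hTi
      obtain ⟨h1, h2⟩ := (isSimplex_properIntervals_iff (MWord.rank_injective w)
        (MWord.rank_lt w)).1 hT
      rw [← cobarEval_cobarD hn φ w h1 hTi h2, hφ, cobarEval_of hn _ w ⟨h1, hTi⟩]
      rfl)
  exact ⟨G, fun T hT hTi hTw => hG T ((isSimplex_properIntervals_iff (MWord.rank_injective w)
    (MWord.rank_lt w)).2 ⟨hT, hTw⟩) hTi⟩

/-- Exactness holds separately on the simplicial complex of each word, and the primitives found word
by word are assembled by `exists_cobarEval_eq`. -/
theorem asOperad_isKoszul : (asOperad k m).IsKoszul := by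
  intro n hn
  refine ⟨fun hn2 => ?_, fun i hi φ => ⟨fun hφ => ?_, ?_⟩⟩
  · rw [injective_iff_map_eq_zero]
    intro φ hφ
    refine cobarTerm_ext hn fun w T hT hi hw => ?_
    obtain ⟨G, hG⟩ := exists_coboundary_eq hn (by omega) hφ w
    rw [hG T hT hi hw, cobarEval_of hn _ w ⟨hT, hi⟩]
    -- In degree zero the tree has no internal edge, and the coboundary is an empty sum.
    obtain rfl := Finset.card_eq_zero.1 hi
    exact Finset.sum_empty
  · have h := exists_coboundary_eq hn hi hφ
    choose G hG using h
    obtain ⟨ψ, hψ⟩ := exists_cobarEval_eq hn i G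
    refine ⟨ψ, cobarTerm_ext hn fun w T hT hTi hw => ?_⟩
    rw [cobarEval_cobarD hn _ w hT hTi hw, hG w T hT hTi hw]
    exact coboundary_congr fun U hU => hψ w _ (hT.erase U)
      (by rw [Finset.card_erase_of_mem hU, hTi]; rfl) fun V hV => hw V (Finset.mem_of_mem_erase hV)
  · rintro ⟨ψ, rfl⟩
    exact cobarD_cobarD hn ψ

end Koszul

/-! ### Functoriality of quadratic operads in the generators. -/

namespace BinTree

variable {G H : Type u} {X Y : Type}

/-- Relabelling of the vertices. -/
def mapNodes (θ : G → H) : BinTree G X → BinTree H X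
  | leaf x => leaf x
  | node g l r => node (θ g) (l.mapNodes θ) (r.mapNodes θ)

theorem count_mapNodes (θ : G → H) (t : BinTree G X) (x : X) :
    (t.mapNodes θ).count x = t.count x := by
  induction t with
  | leaf y => rfl
  | node g l r hl hr => simp only [mapNodes, count, hl, hr]

theorem mapNodes_bind (θ : G → H) (f : X → BinTree G Y) (t : BinTree G X) :
    (t.bind f).mapNodes θ = (t.mapNodes θ).bind fun x => (f x).mapNodes θ := by
  induction t with
  | leaf y => rfl
  | node g l r hl hr => simp only [mapNodes, bind, hl, hr]

theorem mapNodes_mapNodes {K : Type u} (θ : G → H) (η : H → K) (h : G → K)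
    (hh : ∀ g, η (θ g) = h g) (t : BinTree G X) : (t.mapNodes θ).mapNodes η = t.mapNodes h := by
  induction t with
  | leaf y => rfl
  | node g l r hl hr => simp only [mapNodes, hl, hr, hh]

theorem mapNodes_id (t : BinTree G X) : t.mapNodes id = t := by
  induction t with
  | leaf y => rfl
  | node g l r hl hr => simp only [mapNodes, hl, hr, id]

end BinTree

/-- Relabelling of the vertices. -/
def MonoTree.mapNodes {G H : Type u} {X : Type} (θ : G → H) (t : MonoTree G X) : MonoTree H X :=
  ⟨t.1.mapNodes θ, fun x => by rw [BinTree.count_mapNodes, t.2]⟩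

namespace SymOperad

variable {k : Type u} [Field k]

/-- The projection onto a quotient operad. -/
def quotientHom (P : SymOperad.{u, v} k) (I : OpIdeal P) : Hom P (P.quotient I) where
  app X _ := P.quotientMk I X
  app_map _ _ := rfl
  app_one := rfl
  app_comp _ _ := rfl

/-- Composition of morphisms of operads. -/
def Hom.comp {P Q R : SymOperad.{u, v} k} (ψ : Hom Q R) (φ : Hom P Q) : Hom P R where
  app X _ := ψ.app X ∘ₗ φ.app X
  app_map e p := by rw [LinearMap.comp_apply, φ.app_map, ψ.app_map]; rfl
  app_one := by rw [LinearMap.comp_apply, φ.app_one, ψ.app_one]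
  app_comp p q := by rw [LinearMap.comp_apply, φ.app_comp, ψ.app_comp]; rfl

end SymOperad

section Functoriality

variable {k : Type u} [Field k]

/-- The linear extension of the relabelling of the vertices of trees. -/
noncomputable def freeOperadMapApp (k : Type u) [Field k] {G H : Type u} (θ : G → H) (X : Type)
    [Finite X] : (freeOperad k G).obj X →ₗ[k] (freeOperad k H).obj X :=
  Finsupp.lmapDomain k k (MonoTree.mapNodes θ)

theorem freeOperadMapApp_toFree {G H : Type u} (θ : G → H) {X : Type} [Finite X]
    (t : MonoTree G X) : freeOperadMapApp k θ X (t.toFree k) = (t.mapNodes θ).toFree k :=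
  Finsupp.mapDomain_single

/-- The functoriality of the free operad. -/
noncomputable def freeOperadMap (k : Type u) [Field k] {G H : Type u} (θ : G → H) :
    SymOperad.Hom (freeOperad k G) (freeOperad k H) where
  app := freeOperadMapApp k θ
  app_map := by
    intro X Y _ _ e p
    refine LinearMap.congr_fun (f := freeOperadMapApp k θ Y ∘ₗ (freeOperad k G).map e)
      (g := (freeOperad k H).map e ∘ₗ freeOperadMapApp k θ X) (freeOperad_hom_ext fun t => ?_) p
    rw [LinearMap.comp_apply, LinearMap.comp_apply, MonoTree.map_toFree, freeOperadMapApp_toFree,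
      freeOperadMapApp_toFree, MonoTree.map_toFree]
    congr 1
    exact Subtype.ext (BinTree.mapNodes_bind θ _ t.1)
  app_one := freeOperadMapApp_toFree θ MonoTree.unit
  app_comp := by
    intro X Y _ _ p q
    refine LinearMap.congr_fun₂ (f := (freeOperad k G).comp.compr₂ (freeOperadMapApp k θ (X ⊕ Y)))
      (g := (freeOperad k H).comp.compl₁₂ (freeOperadMapApp k θ _) (freeOperadMapApp k θ Y))
      (freeOperad_hom_ext fun t => freeOperad_hom_ext fun s => ?_) p q
    rw [LinearMap.compr₂_apply, LinearMap.compl₁₂_apply, MonoTree.comp_toFree,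
      freeOperadMapApp_toFree, freeOperadMapApp_toFree, freeOperadMapApp_toFree,
      MonoTree.comp_toFree]
    congr 1
    refine Subtype.ext ((BinTree.mapNodes_bind θ _ t.1).trans ?_)
    change BinTree.bind _ _ = BinTree.bind _ _
    congr 1
    funext o
    rcases o with _ | a
    · exact BinTree.mapNodes_bind θ _ s.1
    · rfl

theorem cubicEval_comp (P : SymOperad.{u, v} k) {E E' : Type u} [AddCommGroup E] [Module k E]
    [AddCommGroup E'] [Module k E'] (g : E' →ₗ[k] P.obj (Fin 2)) (θ : E →ₗ[k] E')
    (r : Fin 3 → E ⊗[k] E) : cubicEval P (g ∘ₗ θ) r =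
      cubicEval P g fun u => TensorProduct.map θ θ (r u) := by
  rw [cubicEval_apply, cubicEval_apply]
  refine Finset.sum_congr rfl fun u _ => ?_
  congr 1
  induction r u using TensorProduct.induction_on with
  | zero => simp
  | add a b ha hb => simp only [map_add, ha, hb]
  | tmul a b => simp

namespace BinaryQuadraticData

variable {D D' : BinaryQuadraticData k}

/-- The class of a tree in the quadratic operad. -/
noncomputable def classHom (D : BinaryQuadraticData k) :
    SymOperad.Hom (freeOperad k D.E) D.operad :=
  (D.free.quotientHom D.relIdeal).comp ((freeOperad k D.E).quotientHom D.genIdeal)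

theorem operad_hom_ext (D : BinaryQuadraticData k) {X : Type} [Finite X] {M : Type*}
    [AddCommGroup M] [Module k M] {f g : D.operad.obj X →ₗ[k] M}
    (h : ∀ t : MonoTree D.E X, f (D.classHom.app X (t.toFree k)) =
      g (D.classHom.app X (t.toFree k))) : f = g := by
  have e : f ∘ₗ D.classHom.app X = g ∘ₗ D.classHom.app X := freeOperad_hom_ext h
  refine LinearMap.ext fun p => ?_
  obtain ⟨p, rfl⟩ := Submodule.mkQ_surjective _ p
  obtain ⟨p, rfl⟩ := Submodule.mkQ_surjective _ p
  exact LinearMap.congr_fun e p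

/-- A linear map of the generators which preserves the relations defines a morphism of the
quadratic operads. -/
noncomputable def operadMap (θ : D.E →ₗ[k] D'.E) (hswap : ∀ e, θ (D.swap e) = D'.swap (θ e))
    (hR : ∀ r ∈ D.R, (fun u => TensorProduct.map θ θ (r u)) ∈ D'.R) :
    SymOperad.Hom D.operad D'.operad :=
  have hgen : ∀ e, (D'.classHom.comp (freeOperadMap k θ)).app (Fin 2) (freeOperadGen k e) =
      D'.gen (θ e) := fun e => congrArg (D'.classHom.app (Fin 2))
        (freeOperadMapApp_toFree θ (MonoTree.corolla e))
  let φ : SymOperad.Hom D.free D'.operad :=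
    (D'.classHom.comp (freeOperadMap k θ)).lift (fun X _ => {p | GenRel D.swap X p}) (by
      rintro X _ p (⟨a, b⟩ | ⟨c, a⟩ | a)
      · simp only [map_sub, map_add, hgen, sub_self]
      · simp only [map_sub, map_smul, hgen, sub_self]
      · simp only [map_sub, SymOperad.Hom.app_map, hgen, hswap, gen_swap, sub_self])
  φ.lift (fun X _ => {p | D.Rel X p}) (by
    rintro X _ p ⟨r, hr⟩
    rw [cubicEval_hom]
    refine Eq.trans (congrArg (fun f => cubicEval D'.operad f r)
      (?_ : φ.app (Fin 2) ∘ₗ D.freeGen = D'.gen ∘ₗ θ)) ?_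
    · exact LinearMap.ext hgen
    · rw [cubicEval_comp]
      exact cubicEval_gen D' (hR r hr))

theorem operadMap_classHom (θ : D.E →ₗ[k] D'.E) (hswap : ∀ e, θ (D.swap e) = D'.swap (θ e))
    (hR : ∀ r ∈ D.R, (fun u => TensorProduct.map θ θ (r u)) ∈ D'.R) {X : Type} [Finite X]
    (t : MonoTree D.E X) : (operadMap θ hswap hR).app X (D.classHom.app X (t.toFree k)) =
      D'.classHom.app X ((t.mapNodes θ).toFree k) :=
  congrArg (D'.classHom.app X) (freeOperadMapApp_toFree θ t)

/-- The morphisms induced by `θ` and by its inverse are inverse to each other on the classes of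
trees, and these span. -/
theorem isomorphic_of_equiv (θ : D.E ≃ₗ[k] D'.E) (hswap : ∀ e, θ (D.swap e) = D'.swap (θ e))
    (hR : ∀ r, (fun u => TensorProduct.map θ.toLinearMap θ.toLinearMap (r u)) ∈ D'.R ↔ r ∈ D.R) :
    SymOperad.Isomorphic D.operad D'.operad := by
  have hswap' : ∀ e, θ.symm (D'.swap e) = D.swap (θ.symm e) := fun e => by
    rw [LinearEquiv.symm_apply_eq, hswap, LinearEquiv.apply_symm_apply]
  have hR' : ∀ r ∈ D'.R,
      (fun u => TensorProduct.map θ.symm.toLinearMap θ.symm.toLinearMap (r u)) ∈ D.R := by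
    intro r hr
    rw [← hR]
    convert hr with u
    rw [← LinearMap.comp_apply, ← TensorProduct.map_comp, LinearEquiv.comp_symm,
      TensorProduct.map_id, LinearMap.id_apply]
  let φ := operadMap θ.toLinearMap hswap fun r hr => (hR r).2 hr
  let ψ := operadMap θ.symm.toLinearMap hswap' hR'
  refine ⟨φ, fun X _ => ?_⟩
  have h1 : ψ.app X ∘ₗ φ.app X = LinearMap.id := by
    refine operad_hom_ext D fun t => ?_
    rw [LinearMap.comp_apply]
    refine ((congrArg (ψ.app X) (operadMap_classHom ..)).trans (operadMap_classHom ..)).trans ?_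
    refine congrArg (fun t : MonoTree D.E X => D.classHom.app X (t.toFree k)) (Subtype.ext ?_)
    exact (BinTree.mapNodes_mapNodes _ _ id (fun e => θ.symm_apply_apply e) t.1).trans
      (BinTree.mapNodes_id t.1)
  have h2 : φ.app X ∘ₗ ψ.app X = LinearMap.id := by
    refine operad_hom_ext D' fun t => ?_
    rw [LinearMap.comp_apply]
    refine ((congrArg (φ.app X) (operadMap_classHom ..)).trans (operadMap_classHom ..)).trans ?_
    refine congrArg (fun t : MonoTree D'.E X => D'.classHom.app X (t.toFree k)) (Subtype.ext ?_)
    exact (BinTree.mapNodes_mapNodes _ _ id (fun e => θ.apply_symm_apply e) t.1).trans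
      (BinTree.mapNodes_id t.1)
  exact ⟨Function.LeftInverse.injective (g := ψ.app X) (LinearMap.congr_fun h1),
    Function.RightInverse.surjective (g := ψ.app X) (LinearMap.congr_fun h2)⟩

end BinaryQuadraticData

end Functoriality

/-! ### Self-duality of `As^(m)`. -/

section SelfDual

variable (k : Type u) [Field k] (m : ℕ)

/-- The operations `x ⋆ᵢ y` and `y ⋆ᵢ x`, as a basis of the generators of `As^(m)`. -/
noncomputable def opBasis : Module.Basis (Fin m ⊕ Fin m) k (AsLabel k m) :=
  (Pi.basisFun k (Fin m)).prod (Pi.basisFun k (Fin m))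

/-- The ternary operations of the free operad on the generators of `As^(m)`. -/
abbrev CubicSpace : Type u := Fin 3 → AsLabel k m ⊗[k] AsLabel k m

/-- The coordinates of the ternary operations. -/
noncomputable def cubicCoeff (u : Fin 3) (p q : Fin m ⊕ Fin m) : CubicSpace k m →ₗ[k] k :=
  ((opBasis k m).tensorProduct (opBasis k m)).coord (p, q) ∘ₗ LinearMap.proj u

/-- The basic ternary operations. -/
noncomputable def cubicElem (u : Fin 3) (p q : Fin m ⊕ Fin m) : CubicSpace k m :=
  Pi.single u (opBasis k m p ⊗ₜ opBasis k m q)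

variable {k m}

theorem opBasis_inl (i : Fin m) : opBasis k m (Sum.inl i) = starOp k m i := by
  simp [opBasis, starOp]

theorem opBasis_inr (i : Fin m) : opBasis k m (Sum.inr i) = starSwap k m (starOp k m i) := by
  simp [opBasis, starOp, starSwap]

theorem starSwap_opBasis (p : Fin m ⊕ Fin m) :
    starSwap k m (opBasis k m p) = opBasis k m p.swap := by
  rcases p with i | i
  · rw [opBasis_inl, Sum.swap_inl, opBasis_inr]
  · rw [opBasis_inr, Sum.swap_inr, opBasis_inl]
    rfl

theorem repr_starSwap (e : AsLabel k m) (p : Fin m ⊕ Fin m) :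
    (opBasis k m).repr (starSwap k m e) p = (opBasis k m).repr e p.swap := by
  rcases p with i | i <;> rfl

theorem cubicCoeff_apply (u : Fin 3) (p q : Fin m ⊕ Fin m) (r : CubicSpace k m) :
    cubicCoeff k m u p q r = ((opBasis k m).tensorProduct (opBasis k m)).repr (r u) (p, q) := rfl

theorem cubicCoeff_cubicElem (u v : Fin 3) (p q p' q' : Fin m ⊕ Fin m) :
    cubicCoeff k m u p q (cubicElem k m v p' q') = if u = v ∧ p = p' ∧ q = q' then 1 else 0 := by
  rw [cubicCoeff_apply, cubicElem]
  by_cases h : u = v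
  · subst h
    rw [Pi.single_eq_same, Module.Basis.tensorProduct_repr_tmul_apply]
    simp only [Module.Basis.repr_self, Finsupp.single_apply, smul_eq_mul, true_and, ite_and,
      eq_comm (a := p), eq_comm (a := q)]
    split_ifs <;> simp
  · rw [Pi.single_eq_of_ne h, map_zero, if_neg (fun h' => h h'.1)]
    rfl

theorem cubicCoeff_rot (u : Fin 3) (p q : Fin m ⊕ Fin m) (r : CubicSpace k m) :
    cubicCoeff k m u p q (cubicRot k _ r) = cubicCoeff k m (u + 1) p q r := rfl

theorem cubicCoeff_swap (u : Fin 3) (p q : Fin m ⊕ Fin m) (r : CubicSpace k m) :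
    cubicCoeff k m u p q (cubicSwap (starSwap k m) r) = cubicCoeff k m (-u) p q.swap r := by
  rw [cubicCoeff_apply, cubicCoeff_apply]
  change (Module.Basis.repr _) (TensorProduct.map LinearMap.id (starSwap k m) (r (-u))) _ = _
  induction r (-u) using TensorProduct.induction_on with
  | zero => simp
  | add a b ha hb => simp only [map_add, Finsupp.add_apply, ha, hb]
  | tmul a b =>
    rw [TensorProduct.map_tmul, Module.Basis.tensorProduct_repr_tmul_apply,
      Module.Basis.tensorProduct_repr_tmul_apply, repr_starSwap]
    rfl

theorem sum_cubicElem (r : CubicSpace k m) :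
    ∑ u, ∑ p, ∑ q, cubicCoeff k m u p q r • cubicElem k m u p q = r := by
  funext v
  rw [Finset.sum_apply, Finset.sum_eq_single v]
  · conv_rhs => rw [← ((opBasis k m).tensorProduct (opBasis k m)).sum_repr (r v)]
    rw [Fintype.sum_prod_type, Finset.sum_apply]
    refine Finset.sum_congr rfl fun p _ => ?_
    rw [Finset.sum_apply]
    refine Finset.sum_congr rfl fun q _ => ?_
    rw [Pi.smul_apply, cubicElem, Pi.single_eq_same, Module.Basis.tensorProduct_apply]
    rfl
  · intro u _ hu
    rw [Finset.sum_apply]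
    refine Finset.sum_eq_zero fun p _ => ?_
    rw [Finset.sum_apply]
    refine Finset.sum_eq_zero fun q _ => ?_
    rw [Pi.smul_apply, cubicElem, Pi.single_eq_of_ne hu.symm, smul_zero]
  · simp

theorem cubicRot_cubicElem (u : Fin 3) (p q : Fin m ⊕ Fin m) :
    cubicRot k _ (cubicElem k m (u + 1) p q) = cubicElem k m u p q := by
  funext v
  change cubicElem k m (u + 1) p q (v + 1) = _
  by_cases h : v = u
  · subst h; rw [cubicElem, cubicElem, Pi.single_eq_same, Pi.single_eq_same]
  · rw [cubicElem, cubicElem, Pi.single_eq_of_ne h,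
      Pi.single_eq_of_ne (fun h' => h (add_right_cancel h'))]

theorem cubicSwap_cubicElem (u : Fin 3) (p q : Fin m ⊕ Fin m) :
    cubicSwap (starSwap k m) (cubicElem k m (-u) p q) = cubicElem k m u p q.swap := by
  funext v
  change TensorProduct.map LinearMap.id (starSwap k m) (cubicElem k m (-u) p q (-v)) = _
  by_cases h : v = u
  · subst h
    rw [cubicElem, cubicElem, Pi.single_eq_same, Pi.single_eq_same, TensorProduct.map_tmul,
      starSwap_opBasis]
    rfl
  · rw [cubicElem, cubicElem, Pi.single_eq_of_ne h,
      Pi.single_eq_of_ne (fun h' => h (neg_injective h')), map_zero]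

variable (k m) in
/-- The relations of `As^(m)` in coordinates. -/
def explicitRel : Submodule k (CubicSpace k m) where
  carrier := {r | ∀ (u : Fin 3) (i j : Fin m),
    cubicCoeff k m u (.inl j) (.inl i) r + cubicCoeff k m (u + 1) (.inr i) (.inl j) r = 0 ∧
    cubicCoeff k m (u + 1) (.inl j) (.inr i) r + cubicCoeff k m u (.inr i) (.inr j) r = 0}
  add_mem' := by
    intro r r' h h' u i j
    simp only [map_add]
    constructor
    · linear_combination (h u i j).1 + (h' u i j).1
    · linear_combination (h u i j).2 + (h' u i j).2
  zero_mem' := by simp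
  smul_mem' := by
    intro c r h u i j
    simp only [map_smul, smul_eq_mul]
    constructor
    · linear_combination c * (h u i j).1
    · linear_combination c * (h u i j).2

theorem starRel_eq (i j : Fin m) : starRel k m i j =
    cubicElem k m (0 + 1) (.inr i) (.inl j) - cubicElem k m 0 (.inl j) (.inl i) := by
  funext u
  rw [Pi.sub_apply, cubicElem, cubicElem, opBasis_inl, opBasis_inl, opBasis_inr]
  fin_cases u <;> simp [starRel]

theorem asRel_le_explicitRel : asRel k m ≤ explicitRel k m := by
  refine asRel_le ?_ ?_ ?_
  · intro i j u i' j'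
    rw [starRel_eq]
    simp only [map_sub, cubicCoeff_cubicElem, Sum.inl.injEq, Sum.inr.injEq, reduceCtorEq,
      false_and, and_false, if_false, add_left_inj, sub_zero, add_zero, zero_sub, and_true,
      and_comm (a := i' = i)]
    simp
  · intro r hr u i j
    simp only [cubicCoeff_rot]
    exact hr (u + 1) i j
  · intro r hr u i j
    simp only [cubicCoeff_swap, Sum.swap_inl, Sum.swap_inr]
    -- The swap takes the indices `u` and `u + 1` to `-u` and `-(u + 1)`, and it interchanges the
    -- two families of equations.
    have h := hr (-(u + 1)) i j
    have e : ∀ u : Fin 3, -(u + 1) + 1 = -u := by decide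
    rw [e] at h
    exact ⟨h.2, (add_comm _ _).trans (by rw [add_comm]; exact h.1)⟩

theorem asRel_rot_mem {r : CubicSpace k m} (hr : r ∈ asRel k m) : cubicRot k _ r ∈ asRel k m :=
  (asData k m).rot_mem r hr

theorem asRel_swap_mem {r : CubicSpace k m} (hr : r ∈ asRel k m) :
    cubicSwap (starSwap k m) r ∈ asRel k m :=
  (asData k m).swap_mem r hr

/-- Rotation lowers the index by one, which moves the relation from the index 0 to 2 and then to 1.
-/
theorem sub_mem_asRel (u : Fin 3) (i j : Fin m) :
    cubicElem k m (u + 1) (.inr i) (.inl j) - cubicElem k m u (.inl j) (.inl i) ∈ asRel k m := by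
  have key : ∀ u : Fin 3, cubicElem k m (u + 1 + 1) (.inr i) (.inl j) -
      cubicElem k m (u + 1) (.inl j) (.inl i) ∈ asRel k m →
      cubicElem k m (u + 1) (.inr i) (.inl j) - cubicElem k m u (.inl j) (.inl i) ∈
        asRel k m := by
    intro u h
    have h' := asRel_rot_mem h
    rwa [map_sub, cubicRot_cubicElem, cubicRot_cubicElem] at h'
  have h0 := starRel_eq (k := k) i j ▸ starRel_mem i j
  have h2 := key 2 h0
  have h1 := key 1 h2
  fin_cases u
  · exact h0
  · exact h1
  · exact h2

theorem sub_mem_asRel' (u : Fin 3) (i j : Fin m) :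
    cubicElem k m u (.inr i) (.inr j) - cubicElem k m (u + 1) (.inl j) (.inr i) ∈ asRel k m := by
  have h := asRel_swap_mem (sub_mem_asRel (k := k) (-(u + 1)) i j)
  have e : ∀ u : Fin 3, -(u + 1) + 1 = -u := by decide
  rwa [e, map_sub, cubicSwap_cubicElem, cubicSwap_cubicElem] at h

/-- The coordinates are grouped in the pairs that occur in the equations of `explicitRel`; each
coordinate occurs in exactly one of these. -/
theorem sum_cubic {M : Type*} [AddCommMonoid M] (F : Fin 3 → Fin m ⊕ Fin m → Fin m ⊕ Fin m → M) :
    ∑ u, ∑ p, ∑ q, F u p q = ∑ u, ∑ i, ∑ j,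
      ((F u (.inl j) (.inl i) + F (u + 1) (.inr i) (.inl j)) +
        (F (u + 1) (.inl j) (.inr i) + F u (.inr i) (.inr j))) := by
  simp only [Fintype.sum_sum_type, Finset.sum_add_distrib]
  have h1 := Equiv.sum_comp (Equiv.addRight (1 : Fin 3)) fun u => ∑ i, ∑ j, F u (.inr i) (.inl j)
  have h2 := Equiv.sum_comp (Equiv.addRight (1 : Fin 3)) fun u => ∑ i, ∑ j, F u (.inl j) (.inr i)
  simp only [Equiv.coe_addRight] at h1 h2
  rw [h1, h2]
  have h3 : ∀ G : Fin 3 → Fin m → Fin m → M, ∑ u, ∑ i, ∑ j, G u j i = ∑ u, ∑ i, ∑ j, G u i j :=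
    fun G => Finset.sum_congr rfl fun u _ => Finset.sum_comm
  rw [h3 fun u i j => F u (.inl i) (.inl j), h3 fun u i j => F u (.inl i) (.inr j)]

theorem smul_add_smul_mem_asRel {c d : k} {r s : CubicSpace k m} (h : c + d = 0)
    (hrs : s - r ∈ asRel k m) : c • r + d • s ∈ asRel k m := by
  have e : c • r + d • s = d • (s - r) := by
    have h' : (c + d) • r = 0 := by rw [h, zero_smul]
    rw [add_smul] at h'
    rw [smul_sub, eq_sub_iff_add_eq, add_right_comm, h', zero_add]
  rw [e]
  exact Submodule.smul_mem _ _ hrs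

/-- Once the coordinates are grouped in pairs with sum zero, each pair contributes a multiple of a
relation already known to lie in `asRel`. -/
theorem explicitRel_le_asRel : explicitRel k m ≤ asRel k m := by
  intro r hr
  rw [← sum_cubicElem r, sum_cubic]
  refine Submodule.sum_mem _ fun u _ => Submodule.sum_mem _ fun i _ => Submodule.sum_mem _
    fun j _ => Submodule.add_mem _ ?_ ?_
  · exact smul_add_smul_mem_asRel (hr u i j).1 (sub_mem_asRel u i j)
  · exact smul_add_smul_mem_asRel (hr u i j).2 (sub_mem_asRel' u i j)

theorem asRel_eq : asRel k m = explicitRel k m :=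
  le_antisymm asRel_le_explicitRel explicitRel_le_asRel

/-- The signs of the self-duality of `As^(m)`. -/
def opSign (k : Type u) [Field k] (p : Fin m ⊕ Fin m) : k := Sum.elim (fun _ => 1) (fun _ => -1) p

variable (k m) in
/-- The identification of the generators of `As^(m)` with those of the quadratic dual. -/
noncomputable def toDualGen : AsLabel k m ≃ₗ[k] Module.Dual k (AsLabel k m) :=
  (LinearEquiv.prodCongr (LinearEquiv.refl k (Fin m → k)) (LinearEquiv.neg k)).trans
    (opBasis k m).toDualEquiv

theorem toDualGen_apply (e f : AsLabel k m) : toDualGen k m e f =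
    ∑ p, opSign k p * ((opBasis k m).repr e p * (opBasis k m).repr f p) := by
  conv_lhs => rw [← (opBasis k m).sum_repr f, map_sum]
  refine Finset.sum_congr rfl fun p _ => ?_
  rw [map_smul, smul_eq_mul]
  have h : toDualGen k m e (opBasis k m p) = opSign k p * (opBasis k m).repr e p := by
    refine ((opBasis k m).toDual_eq_repr _ p).trans ?_
    rcases p with i | i
    · exact (one_mul _).symm
    · exact (neg_one_mul _).symm
  rw [h]
  ring

/-- The sign `opSign` changes when `x ⋆ᵢ y` and `y ⋆ᵢ x` are exchanged, which accounts for the twist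
by the sign representation in the quadratic dual. -/
theorem toDualGen_swap (e : AsLabel k m) :
    toDualGen k m (starSwap k m e) = -(starSwap k m).dualMap (toDualGen k m e) := by
  refine LinearMap.ext fun f => ?_
  rw [LinearMap.neg_apply, LinearMap.dualMap_apply, toDualGen_apply, toDualGen_apply,
    Fintype.sum_sum_type, Fintype.sum_sum_type, neg_add_rev, ← Finset.sum_neg_distrib,
    ← Finset.sum_neg_distrib]
  simp only [repr_starSwap, Sum.swap_inl, Sum.swap_inr, opSign, Sum.elim_inl, Sum.elim_inr,
    one_mul, neg_one_mul, neg_neg]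

theorem dualDistrib_toDualGen (x y : AsLabel k m ⊗[k] AsLabel k m) :
    TensorProduct.dualDistrib k _ _
      (TensorProduct.map (toDualGen k m).toLinearMap (toDualGen k m).toLinearMap x) y =
    ∑ p, ∑ q, opSign k p * opSign k q *
      (((opBasis k m).tensorProduct (opBasis k m)).repr x (p, q) *
        ((opBasis k m).tensorProduct (opBasis k m)).repr y (p, q)) := by
  induction x using TensorProduct.induction_on with
  | zero => simp
  | add a b ha hb =>
    simp only [map_add, LinearMap.add_apply, ha, hb, Finsupp.add_apply, add_mul, mul_add,
      Finset.sum_add_distrib]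
  | tmul a b =>
  induction y using TensorProduct.induction_on with
  | zero => simp
  | add a b ha hb =>
    simp only [map_add, ha, hb, Finsupp.add_apply, mul_add, Finset.sum_add_distrib]
  | tmul c d =>
    rw [TensorProduct.map_tmul, TensorProduct.dualDistrib_apply]
    change toDualGen k m a c * toDualGen k m b d = _
    rw [toDualGen_apply, toDualGen_apply, Finset.sum_mul_sum]
    refine Finset.sum_congr rfl fun p _ => Finset.sum_congr rfl fun q _ => ?_
    rw [Module.Basis.tensorProduct_repr_tmul_apply, Module.Basis.tensorProduct_repr_tmul_apply,
      smul_eq_mul, smul_eq_mul]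
    ring

variable (k m) in
/-- The bilinear form on ternary operations given by the duality. -/
noncomputable def dualForm (r s : CubicSpace k m) : k :=
  ∑ u, ∑ p, ∑ q, opSign k p * opSign k q * (cubicCoeff k m u p q r * cubicCoeff k m u p q s)

theorem pairing_toDualGen (r s : CubicSpace k m) :
    (asData k m).pairing (fun u => TensorProduct.map (toDualGen k m).toLinearMap
      (toDualGen k m).toLinearMap (r u)) s = dualForm k m r s :=
  ((asData k m).pairing_apply _ s).trans
    (Finset.sum_congr rfl fun u _ => dualDistrib_toDualGen (r u) (s u))

theorem dualForm_cubicElem (r : CubicSpace k m) (u : Fin 3) (p q : Fin m ⊕ Fin m) :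
    dualForm k m r (cubicElem k m u p q) = opSign k p * opSign k q * cubicCoeff k m u p q r := by
  simp only [dualForm, cubicCoeff_cubicElem]
  rw [Finset.sum_eq_single u, Finset.sum_eq_single p, Finset.sum_eq_single q]
  · simp
  · intro q' _ h; simp [h]
  · simp
  · intro p' _ h; simp [h]
  · simp
  · intro u' _ h; simp [h]
  · simp

theorem dualForm_sub (r s t : CubicSpace k m) :
    dualForm k m r (s - t) = dualForm k m r s - dualForm k m r t := by
  rw [← pairing_toDualGen, ← pairing_toDualGen, ← pairing_toDualGen]
  exact map_sub _ s t

/-- The form is diagonal, with opposite signs on the two coordinates of each pair, so two vectors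
whose pairs sum to zero are orthogonal. Conversely, orthogonality to the relation supported on one
pair says that the coordinates in this pair sum to zero. -/
theorem mem_asRel_iff_dualForm (r : CubicSpace k m) :
    r ∈ asRel k m ↔ ∀ s ∈ asRel k m, dualForm k m r s = 0 := by
  constructor
  · intro hr s hs
    rw [asRel_eq] at hr hs
    rw [dualForm, sum_cubic]
    refine Finset.sum_eq_zero fun u _ => Finset.sum_eq_zero fun i _ => Finset.sum_eq_zero
      fun j _ => ?_
    rw [eq_neg_of_add_eq_zero_left (hr u i j).1, eq_neg_of_add_eq_zero_left (hs u i j).1,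
      eq_neg_of_add_eq_zero_left (hr u i j).2, eq_neg_of_add_eq_zero_left (hs u i j).2]
    simp only [opSign, Sum.elim_inl, Sum.elim_inr]
    ring
  · intro h
    rw [asRel_eq]
    intro u i j
    have h1 := h _ (sub_mem_asRel u i j)
    have h2 := h _ (sub_mem_asRel' u i j)
    rw [dualForm_sub, dualForm_cubicElem, dualForm_cubicElem] at h1 h2
    simp only [opSign, Sum.elim_inl, Sum.elim_inr] at h1 h2
    exact ⟨by linear_combination -h1, by linear_combination h2⟩

theorem toDualGen_symm_swap (f : Module.Dual k (AsLabel k m)) :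
    (toDualGen k m).symm (-(starSwap k m).dualMap f) = starSwap k m ((toDualGen k m).symm f) := by
  rw [LinearEquiv.symm_apply_eq, toDualGen_swap, LinearEquiv.apply_symm_apply]

theorem map_toDualGen_map_symm
    (x : Module.Dual k (AsLabel k m) ⊗[k] Module.Dual k (AsLabel k m)) :
    TensorProduct.map (toDualGen k m).toLinearMap (toDualGen k m).toLinearMap
      (TensorProduct.map (toDualGen k m).symm.toLinearMap (toDualGen k m).symm.toLinearMap x) =
      x := by
  rw [← LinearMap.comp_apply, ← TensorProduct.map_comp, LinearEquiv.comp_symm,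
    TensorProduct.map_id, LinearMap.id_apply]

theorem map_symm_mem_asRel_iff
    (s : Fin 3 → Module.Dual k (AsLabel k m) ⊗[k] Module.Dual k (AsLabel k m)) :
    (fun u => TensorProduct.map (toDualGen k m).symm.toLinearMap
      (toDualGen k m).symm.toLinearMap (s u)) ∈ asRel k m ↔
      ∀ t ∈ asRel k m, (asData k m).pairing s t = 0 := by
  refine (mem_asRel_iff_dualForm _).trans (forall₂_congr fun t _ => ?_)
  have h : (fun u => TensorProduct.map (toDualGen k m).toLinearMap
      (toDualGen k m).toLinearMap (TensorProduct.map (toDualGen k m).symm.toLinearMap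
        (toDualGen k m).symm.toLinearMap (s u))) = s :=
    funext fun u => map_toDualGen_map_symm (s u)
  rw [← pairing_toDualGen, h]

theorem asData_isSelfDual : (asData k m).IsSelfDual :=
  BinaryQuadraticData.isomorphic_of_equiv (D := (asData k m).dual) (D' := asData k m)
    (toDualGen k m).symm toDualGen_symm_swap fun s => (map_symm_mem_asRel_iff s).trans
      (Submodule.mem_dualAnnihilator _).symm

end SelfDual

/-! ### Calculus of composites and tensor products of cochains. -/

section CochainMor

variable (k : Type u) [Field k] (A : Type v) [Ring A] [Algebra k A]

/-- A cochain, together with its source and its target. -/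
structure CochainMor where
  src : ℕ
  tgt : ℕ
  map : TensorCochain k A src tgt

namespace CochainMor

variable {k A}

/-- Bundling the arities confines the casts between tensor powers to this criterion; the identities
below are then plain equalities. -/
theorem ext_of_cast {f g : CochainMor k A} (hs : f.src = g.src) (ht : f.tgt = g.tgt)
    (h : ∀ x, TensorPower.cast k A ht (f.map x) = g.map (TensorPower.cast k A hs x)) : f = g := by
  obtain ⟨s, t, f⟩ := f
  obtain ⟨s', t', g⟩ := g
  obtain rfl : s = s' := hs
  obtain rfl : t = t' := ht
  simp only [TensorPower.cast_refl, LinearEquiv.refl_apply] at h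
  rw [LinearMap.ext h]

/-- The product of tensors. -/
noncomputable def tmul {m n : ℕ} (x : ⨂[k]^m A) (y : ⨂[k]^n A) : ⨂[k]^(m + n) A :=
  TensorPower.mulEquiv (x ⊗ₜ[k] y)

theorem tmul_assoc {m n l : ℕ} (x : ⨂[k]^m A) (y : ⨂[k]^n A) (z : ⨂[k]^l A) :
    TensorPower.cast k A (add_assoc _ _ _) (tmul (tmul x y) z) = tmul x (tmul y z) :=
  TensorPower.mul_assoc x y z

theorem ext_tmul {m n : ℕ} {M : Type*} [AddCommMonoid M] [Module k M]
    {f g : (⨂[k]^(m + n) A) →ₗ[k] M} (h : ∀ x y, f (tmul x y) = g (tmul x y)) : f = g := by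
  have : f ∘ₗ (TensorPower.mulEquiv (R := k) (M := A) (n := m) (m := n)).toLinearMap =
      g ∘ₗ TensorPower.mulEquiv.toLinearMap := TensorProduct.ext' h
  refine LinearMap.ext fun x => ?_
  obtain ⟨x, rfl⟩ := TensorPower.mulEquiv.surjective x
  exact LinearMap.congr_fun this x

theorem ext_tmul₃ {m n l : ℕ} {M : Type*} [AddCommMonoid M] [Module k M]
    {f g : (⨂[k]^(m + n + l) A) →ₗ[k] M}
    (h : ∀ x y z, f (tmul (tmul x y) z) = g (tmul (tmul x y) z)) : f = g := by
  refine ext_tmul fun x z => ?_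
  let F : (⨂[k]^(m + n) A) →ₗ[k] (⨂[k]^(m + n + l) A) :=
    TensorPower.mulEquiv.toLinearMap ∘ₗ (TensorProduct.mk k _ _).flip z
  have : f ∘ₗ F = g ∘ₗ F := ext_tmul fun x y => h x y z
  exact LinearMap.congr_fun this x

theorem cochainTensor_tmul {p q r s : ℕ} (f : TensorCochain k A p r) (g : TensorCochain k A q s)
    (x : ⨂[k]^p A) (y : ⨂[k]^q A) : cochainTensor k f g (tmul x y) = tmul (f x) (g y) := by
  change TensorPower.mulEquiv (TensorProduct.map f g (TensorPower.mulEquiv.symm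
    (TensorPower.mulEquiv (x ⊗ₜ[k] y)))) = _
  rw [LinearEquiv.symm_apply_apply, TensorProduct.map_tmul]
  rfl

theorem cochainTensor_assoc {p q r s t u : ℕ} (f : TensorCochain k A p s)
    (g : TensorCochain k A q t) (h : TensorCochain k A r u) (x : ⨂[k]^p A) (y : ⨂[k]^q A)
    (z : ⨂[k]^r A) : TensorPower.cast k A (add_assoc _ _ _)
      (cochainTensor k (cochainTensor k f g) h (tmul (tmul x y) z)) =
    cochainTensor k f (cochainTensor k g h)
      (TensorPower.cast k A (add_assoc _ _ _) (tmul (tmul x y) z)) := by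
  rw [tmul_assoc, cochainTensor_tmul, cochainTensor_tmul, cochainTensor_tmul, cochainTensor_tmul,
    tmul_assoc]

/-- The tensor product of cochains. -/
noncomputable def tens (f g : CochainMor k A) : CochainMor k A :=
  ⟨f.src + g.src, f.tgt + g.tgt, cochainTensor k f.map g.map⟩

/-- The composition of cochains, which is zero if they are not composable. -/
noncomputable def comp (f g : CochainMor k A) : CochainMor k A :=
  ⟨g.src, f.tgt, if h : g.tgt = f.src then f.map ∘ₗ cochainCast k rfl h g.map else 0⟩

variable (k A) in
/-- The identity of a tensor power. -/
noncomputable def one (n : ℕ) : CochainMor k A := ⟨n, n, LinearMap.id⟩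

local infixr:75 " ⊙ " => comp
local infixr:80 " ⊠ " => tens
local notation "𝟙" => one k A

@[simp] theorem src_tens (f g : CochainMor k A) : (f ⊠ g).src = f.src + g.src := rfl
@[simp] theorem tgt_tens (f g : CochainMor k A) : (f ⊠ g).tgt = f.tgt + g.tgt := rfl
@[simp] theorem src_comp (f g : CochainMor k A) : (f ⊙ g).src = g.src := rfl
@[simp] theorem tgt_comp (f g : CochainMor k A) : (f ⊙ g).tgt = f.tgt := rfl
@[simp] theorem src_one (n : ℕ) : (𝟙 n).src = n := rfl
@[simp] theorem tgt_one (n : ℕ) : (𝟙 n).tgt = n := rfl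

theorem cochainCast_refl {p r : ℕ} (hp : p = p) (hr : r = r) (f : TensorCochain k A p r) :
    cochainCast k hp hr f = f := by
  refine LinearMap.ext fun x => ?_
  change TensorPower.cast k A hr (f ((TensorPower.cast k A hp).symm x)) = f x
  rw [TensorPower.cast_refl, TensorPower.cast_refl]
  rfl

theorem comp_mk {p q r : ℕ} (f : TensorCochain k A q r) (g : TensorCochain k A p q) :
    (⟨q, r, f⟩ : CochainMor k A) ⊙ ⟨p, q, g⟩ = ⟨p, r, f ∘ₗ g⟩ := by
  rw [comp]
  simp only [dif_pos, cochainCast_refl]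

theorem comp_eq_zero {f g : CochainMor k A} (h : g.tgt ≠ f.src) :
    f ⊙ g = ⟨g.src, f.tgt, 0⟩ := by
  rw [comp, dif_neg h]

theorem tens_assoc (f g h : CochainMor k A) : (f ⊠ g) ⊠ h = f ⊠ g ⊠ h := by
  refine ext_of_cast (add_assoc _ _ _) (add_assoc _ _ _) fun x => ?_
  refine LinearMap.congr_fun (f := (TensorPower.cast k A _).toLinearMap ∘ₗ ((f ⊠ g) ⊠ h).map)
    (g := (f ⊠ g ⊠ h).map ∘ₗ (TensorPower.cast k A _).toLinearMap) (ext_tmul₃ fun x y z => ?_) x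
  exact cochainTensor_assoc f.map g.map h.map x y z

theorem one_tens_one (m n : ℕ) : 𝟙 m ⊠ 𝟙 n = 𝟙 (m + n) := by
  rw [tens, one, one, one]
  congr 1
  exact ext_tmul fun x y => cochainTensor_tmul _ _ x y

theorem one_tens_one_tens (m n : ℕ) (f : CochainMor k A) : 𝟙 m ⊠ 𝟙 n ⊠ f = 𝟙 (m + n) ⊠ f := by
  rw [← tens_assoc, one_tens_one]

theorem tens_comp_tens {f g f' g' : CochainMor k A} (h : g.tgt = f.src) (h' : g'.tgt = f'.src) :
    (f ⊠ f') ⊙ (g ⊠ g') = (f ⊙ g) ⊠ (f' ⊙ g') := by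
  obtain ⟨q, r, f⟩ := f
  obtain ⟨p, q', g⟩ := g
  obtain ⟨q₁, r₁, f'⟩ := f'
  obtain ⟨p₁, q₁', g'⟩ := g'
  obtain rfl : q' = q := h
  obtain rfl : q₁' = q₁ := h'
  rw [comp_mk, comp_mk]
  refine (comp_mk _ _).trans ?_
  rw [tens]
  congr 1
  refine ext_tmul fun x y => ?_
  rw [LinearMap.comp_apply, cochainTensor_tmul, cochainTensor_tmul, cochainTensor_tmul]
  rfl

theorem one_comp {n : ℕ} (f : CochainMor k A) (h : f.tgt = n) : 𝟙 n ⊙ f = f := by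
  subst h
  exact comp_mk _ _

theorem comp_one {n : ℕ} (f : CochainMor k A) (h : f.src = n) : f ⊙ 𝟙 n = f := by
  subst h
  exact comp_mk _ _

/-- The value zero for pairs that are not composable makes associativity unconditional, so that it
can be used for rewriting. -/
theorem comp_assoc (f g h : CochainMor k A) : (f ⊙ g) ⊙ h = f ⊙ g ⊙ h := by
  by_cases h1 : g.tgt = f.src
  · by_cases h2 : h.tgt = g.src
    · obtain ⟨q, r, f⟩ := f
      obtain ⟨p, q', g⟩ := g
      obtain ⟨o, p', h⟩ := h
      obtain rfl : q' = q := h1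
      obtain rfl : p' = p := h2
      simp only [comp_mk]
      rfl
    · rw [comp_eq_zero h2, comp_eq_zero (f := f ⊙ g) h2]
      obtain ⟨q, r, f⟩ := f
      obtain ⟨p, q', g⟩ := g
      obtain rfl : q' = q := h1
      refine Eq.trans ?_ (comp_mk _ _).symm
      rw [LinearMap.comp_zero]
      rfl
  · rw [comp_eq_zero h1, comp_eq_zero (g := g ⊙ h) h1]
    by_cases h2 : h.tgt = g.src
    · obtain ⟨p, q', g⟩ := g
      obtain ⟨o, p', h⟩ := h
      obtain rfl : p' = p := h2
      refine (comp_mk _ _).trans ?_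
      rw [LinearMap.zero_comp]
      rfl
    · exact comp_eq_zero (f := ⟨g.src, f.tgt, 0⟩) h2

theorem zero_tens (p r : ℕ) (f : CochainMor k A) :
    (⟨p, r, 0⟩ : CochainMor k A) ⊠ f = ⟨p + f.src, r + f.tgt, 0⟩ := by
  rw [tens]
  simp only [map_zero, LinearMap.zero_apply]

theorem tens_zero (p r : ℕ) (f : CochainMor k A) :
    f ⊠ (⟨p, r, 0⟩ : CochainMor k A) = ⟨f.src + p, f.tgt + r, 0⟩ := by
  rw [tens]
  simp only [map_zero]

/-- Here `f` is applied at the earlier stage, and in the primed version at the later one. Pairs that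
are not composable give zero on both sides. -/
theorem tens_comp {n : ℕ} (f g h : CochainMor k A) (hf : f.tgt = n) :
    f ⊠ (g ⊙ h) = (𝟙 n ⊠ g) ⊙ (f ⊠ h) := by
  subst hf
  by_cases hgh : h.tgt = g.src
  · rw [tens_comp_tens rfl hgh, one_comp f rfl]
  · rw [comp_eq_zero hgh, tens_zero, comp_eq_zero (by simp only [tgt_tens, src_tens, src_one]; omega)]
    rfl

theorem tens_comp' {n : ℕ} (f g h : CochainMor k A) (hf : f.src = n) :
    f ⊠ (g ⊙ h) = (f ⊠ g) ⊙ (𝟙 n ⊠ h) := by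
  subst hf
  by_cases hgh : h.tgt = g.src
  · rw [tens_comp_tens rfl hgh, comp_one f rfl]
  · rw [comp_eq_zero hgh, tens_zero, comp_eq_zero (by simp only [tgt_tens, src_tens, tgt_one]; omega)]
    rfl

theorem comp_tens {n : ℕ} (f g h : CochainMor k A) (hf : f.tgt = n) :
    (g ⊙ h) ⊠ f = (g ⊠ 𝟙 n) ⊙ (h ⊠ f) := by
  subst hf
  by_cases hgh : h.tgt = g.src
  · rw [tens_comp_tens hgh rfl, one_comp f rfl]
  · rw [comp_eq_zero hgh, zero_tens, comp_eq_zero (by simp only [tgt_tens, src_tens, src_one]; omega)]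
    rfl

theorem comp_tens' {n : ℕ} (f g h : CochainMor k A) (hf : f.src = n) :
    (g ⊙ h) ⊠ f = (g ⊠ f) ⊙ (h ⊠ 𝟙 n) := by
  subst hf
  by_cases hgh : h.tgt = g.src
  · rw [tens_comp_tens hgh rfl, comp_one f rfl]
  · rw [comp_eq_zero hgh, zero_tens, comp_eq_zero (by simp only [tgt_tens, src_tens, tgt_one]; omega)]
    rfl

/-- Cochains applied to disjoint sets of components commute. -/
theorem exchange {f h : CochainMor k A} {p r u v : ℕ} (hp : f.src = p + 1) (hr : f.tgt = r + 1)
    (hu : h.src = u + 1) (hv : h.tgt = v + 1) (s : ℕ) :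
    (f ⊠ 𝟙 (s + 1 + v)) ⊙ (𝟙 (p + (s + 1)) ⊠ h) = (𝟙 (r + (s + 1)) ⊠ h) ⊙ (f ⊠ 𝟙 (s + 1 + u)) := by
  -- The `s + 1 + v` components consist of `s` components touched by neither map and the `v + 1`
  -- values of `h`.
  have e1 : 𝟙 (s + 1 + v) = 𝟙 s ⊠ 𝟙 (v + 1) := by rw [one_tens_one]; congr 1; omega
  have e2 : 𝟙 (s + 1 + u) = 𝟙 s ⊠ 𝟙 (u + 1) := by rw [one_tens_one]; congr 1; omega
  have e3 : 𝟙 (p + (s + 1)) ⊠ h = 𝟙 (p + 1) ⊠ 𝟙 s ⊠ h := by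
    rw [one_tens_one_tens]; congr 2; omega
  have e4 : 𝟙 (r + (s + 1)) ⊠ h = 𝟙 (r + 1) ⊠ 𝟙 s ⊠ h := by
    rw [one_tens_one_tens]; congr 2; omega
  have e5 : (f ⊠ 𝟙 s ⊠ 𝟙 (v + 1)) ⊙ (𝟙 (p + 1) ⊠ 𝟙 s ⊠ h) = f ⊠ 𝟙 s ⊠ h := by
    rw [tens_comp_tens hp.symm (congrArg (s + ·) hv), comp_one f hp,
      tens_comp_tens (tgt_one s) hv, one_comp h hv, one_comp _ (tgt_one s)]
  have e6 : (𝟙 (r + 1) ⊠ 𝟙 s ⊠ h) ⊙ (f ⊠ 𝟙 s ⊠ 𝟙 (u + 1)) = f ⊠ 𝟙 s ⊠ h := by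
    rw [tens_comp_tens hr (congrArg (s + ·) hu.symm), one_comp f hr,
      tens_comp_tens (tgt_one s) hu.symm, comp_one h hu, one_comp _ (tgt_one s)]
  rw [e1, e2, e3, e4, e5, e6]

/-- The operation `⊢`, where `f` has `p + 1` arguments and `g` has values in `A^{⊗ (s + 1)}`. -/
noncomputable def vdash (p s : ℕ) (f g : CochainMor k A) : CochainMor k A :=
  (f ⊠ 𝟙 s) ⊙ (𝟙 p ⊠ g)

/-- The operation `⊣`, where `f` has values in `A^{⊗ (r + 1)}` and `g` has `q + 1` arguments. -/
noncomputable def dashv (r q : ℕ) (f g : CochainMor k A) : CochainMor k A :=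
  (𝟙 r ⊠ g) ⊙ (f ⊠ 𝟙 q)

variable (k A) in
/-- The multiplication. -/
noncomputable def mul : CochainMor k A := ⟨2, 1, mulCochain k⟩

@[simp] theorem src_mul : (mul k A).src = 2 := rfl
@[simp] theorem tgt_mul : (mul k A).tgt = 1 := rfl

/-- The cup product, where `f` and `g` have values in `A^{⊗ (r + 1)}` and `A^{⊗ (s + 1)}`. -/
noncomputable def cup (r s : ℕ) (f g : CochainMor k A) : CochainMor k A :=
  (𝟙 r ⊠ mul k A ⊠ 𝟙 s) ⊙ (f ⊠ g)

variable {f g h : CochainMor k A} {p q r s u v : ℕ}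

/-- Both sides apply `h`, then `g`, then `f`; only the bracketing differs. -/
theorem vdash_vdash : vdash p (s + v) f (vdash q v g h) = vdash (p + q) v (vdash p s f g) h := by
  rw [vdash, vdash, vdash, vdash, tens_comp (𝟙 p) _ _ (tgt_one p), comp_tens (𝟙 v) _ _ (tgt_one v)]
  simp only [comp_assoc, tens_assoc, one_tens_one, one_tens_one_tens]

theorem dashv_dashv : dashv r (q + u) f (dashv s u g h) = dashv (r + s) u (dashv r q f g) h := by
  rw [dashv, dashv, dashv, dashv, tens_comp (𝟙 r) _ _ (tgt_one r), comp_tens (𝟙 u) _ _ (tgt_one u)]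
  simp only [comp_assoc, tens_assoc, one_tens_one, one_tens_one_tens]

/-- Both sides apply `g` first; then `f` uses the first component of its value and `h` the last. The
index `s + 1` stands for a `g` with values in `A^{⊗ (s + 2)}`, so these components differ and `f`
and `h` can be exchanged. -/
theorem vdash_dashv (hp : f.src = p + 1) (hr : f.tgt = r + 1) (hu : h.src = u + 1)
    (hv : h.tgt = v + 1) : vdash p (s + 1 + v) f (dashv (s + 1) u g h) =
      dashv (r + (s + 1)) u (vdash p (s + 1) f g) h := by
  rw [vdash, vdash, dashv, dashv, tens_comp (𝟙 p) _ _ (tgt_one p), comp_tens (𝟙 u) _ _ (tgt_one u)]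
  simp only [tens_assoc, one_tens_one, one_tens_one_tens]
  rw [← comp_assoc, exchange hp hr hu hv, comp_assoc]

/-- Both sides apply `g` last; its first argument comes from `f` and its last from `h`. The index `q
+ 1` stands for a `g` with `q + 2` arguments, so these differ. -/
theorem dashv_vdash (hp : f.src = p + 1) (hr : f.tgt = r + 1) (hu : h.src = u + 1)
    (hv : h.tgt = v + 1) : dashv r (q + 1 + u) f (vdash (q + 1) v g h) =
      vdash (p + (q + 1)) v (dashv r (q + 1) f g) h := by
  rw [vdash, vdash, dashv, dashv, tens_comp (𝟙 r) _ _ (tgt_one r), comp_tens (𝟙 v) _ _ (tgt_one v)]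
  simp only [comp_assoc, tens_assoc, one_tens_one, one_tens_one_tens]
  rw [exchange hp hr hu hv]

/-- One multiplication uses the first component of the value of `g`, the other one the last. -/
theorem cup_cup (hr : f.tgt = r + 1) (hv : h.tgt = v + 1) :
    cup r (s + 1 + v) f (cup (s + 1) v g h) = cup (r + (s + 1)) v (cup r (s + 1) f g) h := by
  rw [cup, cup, cup, cup, tens_comp f _ _ hr, comp_tens h _ _ hv]
  have e := exchange (f := 𝟙 r ⊠ mul k A) (h := mul k A ⊠ 𝟙 v) (p := r + 1) (r := r) (u := v + 1)
    (v := v) rfl rfl (by simp; omega) (by simp; omega) s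
  simp only [tens_assoc, one_tens_one, one_tens_one_tens] at e ⊢
  rw [← comp_assoc, e, comp_assoc]

/-- Here `f` uses the first component of the value of `g`, and the multiplication the last. -/
theorem vdash_cup (hp : f.src = p + 1) (hr : f.tgt = r + 1) (hv : h.tgt = v + 1) :
    vdash p (s + 1 + v) f (cup (s + 1) v g h) =
      cup (r + (s + 1)) v (vdash p (s + 1) f g) h := by
  rw [vdash, vdash, cup, cup, tens_comp (𝟙 p) _ _ (tgt_one p), comp_tens h _ _ hv]
  have e := exchange (h := mul k A ⊠ 𝟙 v) (u := v + 1) (v := v) hp hr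
    (by simp; omega) (by simp; omega) s
  simp only [tens_assoc, one_tens_one, one_tens_one_tens] at e ⊢
  rw [← comp_assoc, e, comp_assoc]

/-- Both sides apply `h`, then `f` and `g` side by side, then the multiplication; nothing has to be
exchanged. -/
theorem cup_vdash (hp : f.src = p + 1) :
    cup r (s + v) f (vdash q v g h) = vdash (p + 1 + q) v (cup r s f g) h := by
  rw [vdash, vdash, cup, cup, tens_comp' f _ _ hp, comp_tens (𝟙 v) _ _ (tgt_one v)]
  simp only [comp_assoc, tens_assoc, one_tens_one, one_tens_one_tens]

theorem dashv_cup (hu : h.src = u + 1) :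
    dashv r (q + (u + 1)) f (cup s v g h) = cup (r + s) v (dashv r q f g) h := by
  rw [dashv, dashv, cup, cup, tens_comp (𝟙 r) _ _ (tgt_one r), comp_tens' h _ _ hu]
  simp only [comp_assoc, tens_assoc, one_tens_one, one_tens_one_tens]

/-- The mirror image of `vdash_cup`: the multiplication uses the first component of the value of
`g`, and `h` the last. -/
theorem cup_dashv (hr : f.tgt = r + 1) (hu : h.src = u + 1) (hv : h.tgt = v + 1) :
    cup r (s + 1 + v) f (dashv (s + 1) u g h) =
      dashv (r + (s + 1)) u (cup r (s + 1) f g) h := by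
  rw [dashv, dashv, cup, cup, tens_comp f _ _ hr, comp_tens (𝟙 u) _ _ (tgt_one u)]
  have e := exchange (f := 𝟙 r ⊠ mul k A) (p := r + 1) (r := r) rfl rfl hu hv s
  simp only [tens_assoc, one_tens_one, one_tens_one_tens] at e ⊢
  rw [← comp_assoc, e, comp_assoc]

end CochainMor

end CochainMor

/-! ### The algebra structures on the space of cochains. -/

section CochainAlgebra

variable {k : Type u} [Field k] {A : Type v} [Ring A] [Algebra k A]

/-- The inclusion of the cochains in the space `C(A, A_t^+)_{≥ 2}`. -/
noncomputable def CochainMor.incl (f : CochainMor k A) : CochainSpace k A :=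
  if h : f.src = f.src - 2 + 2 ∧ f.tgt = f.tgt - 2 + 2 then
    cochainIncl k A (f.src - 2) (f.tgt - 2) h.1 h.2 f.map else 0

theorem CochainMor.incl_mk (a b : ℕ) {p r : ℕ} (hp : p = a + 2) (hr : r = b + 2)
    (f : TensorCochain k A p r) :
    CochainMor.incl ⟨p, r, f⟩ = cochainIncl k A a b hp hr f := by
  subst hp hr
  exact dif_pos ⟨rfl, rfl⟩

/-- The homogeneous elements of `C(A, A_t^+)_{≥ 2}`. -/
def CochainMor.IsProper (f : CochainMor k A) : Prop := 2 ≤ f.src ∧ 2 ≤ f.tgt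

theorem directSumBilin_lof {ι : Type} [DecidableEq ι] {M : ι → Type w} {N : Type w}
    [∀ i, AddCommMonoid (M i)] [∀ i, Module k (M i)] [AddCommMonoid N] [Module k N]
    (op : ∀ i j, M i →ₗ[k] M j →ₗ[k] N) (i j : ι) (x : M i) (y : M j) :
    directSumBilin k op (DirectSum.lof k ι M i x) (DirectSum.lof k ι M j y) = op i j x y := by
  rw [directSumBilin, DirectSum.toModule_lof, LinearMap.flip_apply, DirectSum.toModule_lof,
    LinearMap.flip_apply]

theorem CochainMor.incl_lof (i : ℕ × ℕ) (f : TensorCochain k A (i.1 + 2) (i.2 + 2)) :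
    CochainMor.incl ⟨i.1 + 2, i.2 + 2, f⟩ =
      DirectSum.lof k (ℕ × ℕ) (fun i => TensorCochain k A (i.1 + 2) (i.2 + 2)) i f := by
  rw [CochainMor.incl_mk i.1 i.2 rfl rfl, cochainIncl, LinearMap.comp_apply,
    CochainMor.cochainCast_refl]

namespace CochainMor

theorem comp_mk_cast {p q q' r : ℕ} (h : q' = q) (f : TensorCochain k A q r)
    (g : TensorCochain k A p q') :
    comp (⟨q, r, f⟩ : CochainMor k A) ⟨p, q', g⟩ = ⟨p, r, f ∘ₗ cochainCast k rfl h g⟩ := by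
  rw [comp]
  simp only [dif_pos h]

theorem cochainCast_src {p p' r : ℕ} (h : p = p') (f : TensorCochain k A p r) :
    (⟨p', r, cochainCast k h rfl f⟩ : CochainMor k A) = ⟨p, r, f⟩ := by
  subst h
  rw [cochainCast_refl]

theorem mk_vdash {p q r s : ℕ} (f : TensorCochain k A (p + 1) r)
    (g : TensorCochain k A q (s + 1)) :
    (⟨p + q, r + s, cochainVdash k f g⟩ : CochainMor k A) =
      vdash p s ⟨p + 1, r, f⟩ ⟨q, s + 1, g⟩ :=
  (comp_mk_cast (by omega) (cochainTensor k f LinearMap.id)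
    (cochainTensor k LinearMap.id g)).symm

theorem mk_dashv {p q r s : ℕ} (f : TensorCochain k A p (r + 1))
    (g : TensorCochain k A (q + 1) s) :
    (⟨p + q, r + s, cochainDashv k f g⟩ : CochainMor k A) =
      dashv r q ⟨p, r + 1, f⟩ ⟨q + 1, s, g⟩ :=
  (comp_mk_cast (by omega) (cochainTensor k LinearMap.id g)
    (cochainTensor k f LinearMap.id)).symm

theorem mk_merge (r s : ℕ) :
    (⟨(r + 1) + (s + 1), r + 1 + s, mergeCochain k r s⟩ : CochainMor k A) =
      tens (one k A r) (tens (mul k A) (one k A s)) := by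
  rw [← tens_assoc]
  exact cochainCast_src _ _

theorem mk_cup {p q r s : ℕ} (f : TensorCochain k A p (r + 1))
    (g : TensorCochain k A q (s + 1)) :
    (⟨p + q, r + 1 + s, cochainCup k f g⟩ : CochainMor k A) =
      cup r s ⟨p, r + 1, f⟩ ⟨q, s + 1, g⟩ := by
  rw [cup, ← mk_merge]
  exact (comp_mk (mergeCochain k r s) (cochainTensor k f g)).symm

theorem exists_eq_mk {f : CochainMor k A} (hf : f.IsProper) :
    ∃ (i : ℕ × ℕ) (g : TensorCochain k A (i.1 + 2) (i.2 + 2)), f = ⟨i.1 + 2, i.2 + 2, g⟩ := by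
  obtain ⟨p, r, f⟩ := f
  obtain ⟨a, rfl⟩ := Nat.exists_eq_add_of_le' hf.1
  obtain ⟨b, rfl⟩ := Nat.exists_eq_add_of_le' hf.2
  exact ⟨(a, b), f, rfl⟩

variable {f g h : CochainMor k A} {p q r s u v : ℕ}

theorem opVdash_incl (hf : f.IsProper) (hg : g.IsProper) (hp : f.src = p + 1)
    (hs : g.tgt = s + 1) : opVdash k A f.incl g.incl = (vdash p s f g).incl := by
  obtain ⟨i, f, rfl⟩ := exists_eq_mk hf
  obtain ⟨j, g, rfl⟩ := exists_eq_mk hg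
  obtain rfl : i.1 + 1 = p := Nat.succ.inj hp
  obtain rfl : j.2 + 1 = s := Nat.succ.inj hs
  rw [incl_lof, incl_lof, opVdash, directSumBilin_lof, LinearMap.compr₂_apply]
  refine (incl_mk _ _ _ _ _).symm.trans ?_
  rw [mk_vdash]

theorem opDashv_incl (hf : f.IsProper) (hg : g.IsProper) (hr : f.tgt = r + 1)
    (hq : g.src = q + 1) : opDashv k A f.incl g.incl = (dashv r q f g).incl := by
  obtain ⟨i, f, rfl⟩ := exists_eq_mk hf
  obtain ⟨j, g, rfl⟩ := exists_eq_mk hg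
  obtain rfl : i.2 + 1 = r := Nat.succ.inj hr
  obtain rfl : j.1 + 1 = q := Nat.succ.inj hq
  rw [incl_lof, incl_lof, opDashv, directSumBilin_lof, LinearMap.compr₂_apply]
  refine (incl_mk _ _ _ _ _).symm.trans ?_
  rw [mk_dashv]

theorem opCup_incl (hf : f.IsProper) (hg : g.IsProper) (hr : f.tgt = r + 1)
    (hs : g.tgt = s + 1) : opCup k A f.incl g.incl = (cup r s f g).incl := by
  obtain ⟨i, f, rfl⟩ := exists_eq_mk hf
  obtain ⟨j, g, rfl⟩ := exists_eq_mk hg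
  obtain rfl : i.2 + 1 = r := Nat.succ.inj hr
  obtain rfl : j.2 + 1 = s := Nat.succ.inj hs
  rw [incl_lof, incl_lof, opCup, directSumBilin_lof, LinearMap.compr₂_apply]
  refine (incl_mk _ _ _ _ _).symm.trans ?_
  rw [mk_cup]

theorem IsProper.vdash (hf : f.IsProper) (hg : g.IsProper) : (vdash p s f g).IsProper :=
  ⟨le_add_left hg.1, le_add_right hf.2⟩

theorem IsProper.dashv (hf : f.IsProper) (hg : g.IsProper) : (dashv r q f g).IsProper :=
  ⟨le_add_right hf.1, le_add_left hg.2⟩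

theorem IsProper.cup (hf : f.IsProper) (hr : f.tgt = r + 1) : (cup r s f g).IsProper :=
  ⟨le_add_right hf.1, by have := hf.2; simp [CochainMor.cup]; omega⟩

end CochainMor

/-- A trilinear identity on `C(A, A_t^+)_{≥ 2}` holds if it holds for homogeneous elements. -/
theorem mutuallyAssociative_of_incl
    {α β : CochainSpace k A →ₗ[k] CochainSpace k A →ₗ[k] CochainSpace k A}
    (H : ∀ f g h : CochainMor k A, f.IsProper → g.IsProper → h.IsProper →
      ∀ p q r s u v, f.src = p + 1 → f.tgt = r + 1 → g.src = q + 1 + 1 → g.tgt = s + 1 + 1 →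
      h.src = u + 1 → h.tgt = v + 1 →
      α f.incl (β g.incl h.incl) = β (α f.incl g.incl) h.incl)
    (x y z : CochainSpace k A) : α x (β y z) = β (α x y) z := by
  induction x using DirectSum.induction_on with
  | zero => simp only [map_zero, LinearMap.zero_apply]
  | add x x' hx hx' => simp only [map_add, LinearMap.add_apply, hx, hx']
  | of i f =>
  induction y using DirectSum.induction_on with
  | zero => simp only [map_zero, LinearMap.zero_apply]
  | add x x' hx hx' => simp only [map_add, LinearMap.add_apply, hx, hx']
  | of j g =>
  induction z using DirectSum.induction_on with
  | zero => simp only [map_zero]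
  | add x x' hx hx' => simp only [map_add, hx, hx']
  | of l h =>
    have e := H ⟨i.1 + 2, i.2 + 2, f⟩ ⟨j.1 + 2, j.2 + 2, g⟩ ⟨l.1 + 2, l.2 + 2, h⟩
      ⟨Nat.le_add_left _ _, Nat.le_add_left _ _⟩ ⟨Nat.le_add_left _ _, Nat.le_add_left _ _⟩
      ⟨Nat.le_add_left _ _, Nat.le_add_left _ _⟩ _ _ _ _ _ _ rfl rfl rfl rfl rfl rfl
    simp only [CochainMor.incl_lof] at e
    exact e

variable (x y z : CochainSpace k A)

open CochainMor

theorem opVdash_opVdash :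
    opVdash k A x (opVdash k A y z) = opVdash k A (opVdash k A x y) z := by
  refine mutuallyAssociative_of_incl ?_ x y z
  intro f g h hf hg hh p q r s u v hp hr hq hs hu hv
  -- The index `s + 1 + v` is one less than the number of values of `g ⊢ h`, and `p + (q + 1)` is
  -- one less than the number of arguments of `f ⊢ g`.
  rw [opVdash_incl hg hh hq hv, opVdash_incl hf hg hp hs,
    opVdash_incl (s := s + 1 + v) hf (IsProper.vdash hg hh) hp (by simp [vdash]; omega),
    opVdash_incl (p := p + (q + 1)) (IsProper.vdash hf hg) hh (by simp [vdash]; omega) hv,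
    vdash_vdash]

theorem opVdash_opDashv :
    opVdash k A x (opDashv k A y z) = opDashv k A (opVdash k A x y) z := by
  refine mutuallyAssociative_of_incl ?_ x y z
  intro f g h hf hg hh p q r s u v hp hr hq hs hu hv
  rw [opDashv_incl hg hh hs hu, opVdash_incl hf hg hp hs,
    opVdash_incl (s := s + 1 + v) hf (IsProper.dashv hg hh) hp (by simp [dashv]; omega),
    opDashv_incl (r := r + (s + 1)) (IsProper.vdash hf hg) hh (by simp [vdash]; omega) hu,
    vdash_dashv hp hr hu hv]

theorem opVdash_opCup :
    opVdash k A x (opCup k A y z) = opCup k A (opVdash k A x y) z := by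
  refine mutuallyAssociative_of_incl ?_ x y z
  intro f g h hf hg hh p q r s u v hp hr hq hs hu hv
  rw [opCup_incl hg hh hs hv, opVdash_incl hf hg hp hs,
    opVdash_incl (s := s + 1 + v) hf (IsProper.cup hg hs) hp (by simp [cup]; omega),
    opCup_incl (r := r + (s + 1)) (IsProper.vdash hf hg) hh (by simp [vdash]; omega) hv,
    vdash_cup hp hr hv]

theorem opDashv_opVdash :
    opDashv k A x (opVdash k A y z) = opVdash k A (opDashv k A x y) z := by
  refine mutuallyAssociative_of_incl ?_ x y z
  intro f g h hf hg hh p q r s u v hp hr hq hs hu hv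
  rw [opVdash_incl hg hh hq hv, opDashv_incl hf hg hr hq,
    opDashv_incl (q := q + 1 + u) hf (IsProper.vdash hg hh) hr (by simp [vdash]; omega),
    opVdash_incl (p := p + (q + 1)) (IsProper.dashv hf hg) hh (by simp [dashv]; omega) hv,
    dashv_vdash hp hr hu hv]

theorem opDashv_opDashv :
    opDashv k A x (opDashv k A y z) = opDashv k A (opDashv k A x y) z := by
  refine mutuallyAssociative_of_incl ?_ x y z
  intro f g h hf hg hh p q r s u v hp hr hq hs hu hv
  rw [opDashv_incl hg hh hs hu, opDashv_incl hf hg hr hq,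
    opDashv_incl (q := q + 1 + u) hf (IsProper.dashv hg hh) hr (by simp [dashv]; omega),
    opDashv_incl (r := r + (s + 1)) (IsProper.dashv hf hg) hh (by simp [dashv]; omega) hu,
    dashv_dashv]

theorem opDashv_opCup :
    opDashv k A x (opCup k A y z) = opCup k A (opDashv k A x y) z := by
  refine mutuallyAssociative_of_incl ?_ x y z
  intro f g h hf hg hh p q r s u v hp hr hq hs hu hv
  rw [opCup_incl hg hh hs hv, opDashv_incl hf hg hr hq,
    opDashv_incl (q := q + 1 + (u + 1)) hf (IsProper.cup hg hs) hr (by simp [cup]; omega),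
    opCup_incl (r := r + (s + 1)) (IsProper.dashv hf hg) hh (by simp [dashv]; omega) hv,
    dashv_cup hu]

theorem opCup_opVdash :
    opCup k A x (opVdash k A y z) = opVdash k A (opCup k A x y) z := by
  refine mutuallyAssociative_of_incl ?_ x y z
  intro f g h hf hg hh p q r s u v hp hr hq hs hu hv
  rw [opVdash_incl hg hh hq hv, opCup_incl hf hg hr hs,
    opCup_incl (s := s + 1 + v) hf (IsProper.vdash hg hh) hr (by simp [vdash]; omega),
    opVdash_incl (p := p + 1 + (q + 1)) (IsProper.cup hf hr) hh (by simp [cup]; omega) hv,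
    cup_vdash hp]

theorem opCup_opDashv :
    opCup k A x (opDashv k A y z) = opDashv k A (opCup k A x y) z := by
  refine mutuallyAssociative_of_incl ?_ x y z
  intro f g h hf hg hh p q r s u v hp hr hq hs hu hv
  rw [opDashv_incl hg hh hs hu, opCup_incl hf hg hr hs,
    opCup_incl (s := s + 1 + v) hf (IsProper.dashv hg hh) hr (by simp [dashv]; omega),
    opDashv_incl (r := r + (s + 1)) (IsProper.cup hf hr) hh (by simp [cup]; omega) hu,
    cup_dashv hr hu hv]

theorem opCup_opCup :
    opCup k A x (opCup k A y z) = opCup k A (opCup k A x y) z := by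
  refine mutuallyAssociative_of_incl ?_ x y z
  intro f g h hf hg hh p q r s u v hp hr hq hs hu hv
  rw [opCup_incl hg hh hs hv, opCup_incl hf hg hr hs,
    opCup_incl (s := s + 1 + v) hf (IsProper.cup hg hs) hr (by simp [cup]; omega),
    opCup_incl (r := r + (s + 1)) (IsProper.cup hf hr) hh (by simp [cup]; omega) hv,
    cup_cup hr hv]

theorem bilin_sub_left (α : CochainSpace k A →ₗ[k] CochainSpace k A →ₗ[k] CochainSpace k A) :
    α (x - y) z = α x z - α y z := by
  have h := map_add (α.flip z) (x - y) y
  rw [sub_add_cancel] at h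
  exact eq_sub_of_add_eq h.symm

theorem opVee_apply : opVee k A x y = opVdash k A x y - opDashv k A x y := rfl

/-- The operations `⊢` and `⊣` are mutually associative in all four combinations, and these
identities are bilinear in the two operations. -/
theorem opVee_opVee : opVee k A x (opVee k A y z) = opVee k A (opVee k A x y) z := by
  simp only [opVee_apply, map_sub, bilin_sub_left, opVdash_opVdash, opVdash_opDashv,
    opDashv_opVdash, opDashv_opDashv]
  abel

theorem opVee_opCup : opVee k A x (opCup k A y z) = opCup k A (opVee k A x y) z := by
  simp only [opVee_apply, bilin_sub_left, opVdash_opCup, opDashv_opCup]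

theorem opCup_opVee : opCup k A x (opVee k A y z) = opVee k A (opCup k A x y) z := by
  simp only [opVee_apply, map_sub, opCup_opVdash, opCup_opDashv]

variable (k A)

theorem isAsAlgebra_vee_cup : IsAsAlgebra k 2 (CochainSpace k A) ![opVee k A, opCup k A] := by
  refine isAsAlgebra_of_mutuallyAssociative _ fun i j a b c => ?_
  fin_cases i <;> fin_cases j
  · exact opVee_opVee a b c
  · exact opVee_opCup a b c
  · exact opCup_opVee a b c
  · exact opCup_opCup a b c

theorem isAsAlgebra_vdash_dashv_cup :
    IsAsAlgebra k 3 (CochainSpace k A) ![opVdash k A, opDashv k A, opCup k A] := by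
  refine isAsAlgebra_of_mutuallyAssociative _ fun i j a b c => ?_
  fin_cases i <;> fin_cases j
  · exact opVdash_opVdash a b c
  · exact opVdash_opDashv a b c
  · exact opVdash_opCup a b c
  · exact opDashv_opVdash a b c
  · exact opDashv_opDashv a b c
  · exact opDashv_opCup a b c
  · exact opCup_opVdash a b c
  · exact opCup_opDashv a b c
  · exact opCup_opCup a b c

end CochainAlgebra

theorem proposition7 {k : Type u} [Field k] [CharZero k] :
    ((asData k 2).operad.IsKoszul ∧ (asData k 2).IsSelfDual) ∧
    ((asData k 3).operad.IsKoszul ∧ (asData k 3).IsSelfDual) ∧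
    (∀ (A : Type v) [Ring A] [Algebra k A],
      IsAsAlgebra k 2 (CochainSpace k A) ![opVee k A, opCup k A] ∧
      IsAsAlgebra k 3 (CochainSpace k A) ![opVdash k A, opDashv k A, opCup k A]) :=
  ⟨⟨asOperad_isKoszul, asData_isSelfDual⟩, ⟨asOperad_isKoszul, asData_isSelfDual⟩,
    fun A _ _ => ⟨isAsAlgebra_vee_cup k A, isAsAlgebra_vdash_dashv_cup k A⟩⟩
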